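/- **Terms and rewriting.** Terms of the $\lambda$-calculus with letrec are built from variables, $\lambda y.L$, $L_0L_1$ and $\mathsf{letrec}\ f_1=L_1,\dots,f_n=L_n\ \mathsf{in}\ L$ ($n\ge 0$, written $\mathsf{letrec}\ B\ \mathsf{in}\ L$), modulo $\alpha$-equivalence; prefixed terms are $(\lambda\vec x)L$ where $\vec x$ contains the free $\lambda$-variables of $L$ and $L$ has no free recursion variable. The system $\mathit{Reg}_{\mathsf{letrec}}$ has the decomposition rules * $@_0,@_1$: $(\lambda\vec x)L_0L_1\to(\lambda\vec x)L_i$, and $\lambda$: $(\lambda\vec x)\lambda y.L\to(\lambda\vec xy)L$; * compression: $(\lambda x_1\dots x_n)L\to(\lambda x_1\dots x_{i-1}x_{i+1}\dots x_n)L$ if $x_i$ does not occur in $L$; and the unfolding rules (at the outermost letrec below the prefix) * unf.@: $\mathsf{letrec}\,B\,\mathsf{in}\,L_0L_1\to(\mathsf{letrec}\,B\,\mathsf{in}\,L_0)(\mathsf{letrec}\,B\,\mathsf{in}\,L_1)$; unf.$\lambda$: $\mathsf{letrec}\,B\,\mathsf{in}\,\lambda y.L\to\lambda y.\mathsf{letrec}\,B\,\mathsf{in}\,L$;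 * unf.letrec: $\mathsf{letrec}\,B_0\,\mathsf{in}\,\mathsf{letrec}\,B_1\,\mathsf{in}\,L\to\mathsf{letrec}\,B_0,B_1\,\mathsf{in}\,L$; unf.rec: $\mathsf{letrec}\,B\,\mathsf{in}\,f_i\to\mathsf{letrec}\,B\,\mathsf{in}\,L_i$; unf.nil: $\mathsf{letrec}\ \mathsf{in}\,L\to L$; * unf.reduce: removal of all bindings of $B$ not reachable from $L$ in $\mathsf{letrec}\,B\,\mathsf{in}\,L$, if there are any. In $\mathit{Reg}^+_{\mathsf{letrec}}$ compression is restricted to $i=n$. A history-aware strategy is a strategy (a sub-system with the same normal forms) for a labelled version of the system together with an initial labelling. It is scope-delimiting (for $\mathit{Reg}^+_{\mathsf{letrec}}$: scope$^+$-delimiting) if the sources of more than one of its steps are precisely the sources of exactly an $@_0$- and an $@_1$-step, and these two steps only occur together. $ST_{\mathbb S}(L)$ is the set of terms reachable from $(\lambda)L$ by $\mathbb S$-rewrite sequences; $L$ is $\mathbb S$-regular if this set is finite, and $\mathbb S$-productive if every infinite $\mathbb S$-rewrite sequence from $(\lambda)L$ contains infinitely many $\lambda$-, $@_0$- or $@_1$-steps.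 **Derivations.** Derivations in $\mathbf{ug\text{-}Reg}^+_{\mathsf{letrec}}$ are finite prooftrees with axioms $(\lambda\vec xy)y$, rules $(\lambda)$ from $(\lambda\vec xy)L$ to $(\lambda\vec x)\lambda y.L$, $(@)$ from $(\lambda\vec x)L_0$ and $(\lambda\vec x)L_1$ to $(\lambda\vec x)L_0L_1$, $(\mathsf{Vac})$ from $(\lambda x_1\dots x_{n-1})L$ to $(\lambda x_1\dots x_n)L$ if $x_n$ does not occur in $L$, and $(\mathrm{FIX}_{\mathsf{letrec}})$, which from derivations $\mathcal D_j$ of $(\lambda\vec x)L_j[\vec f:=\vec c]$, $1\le j\le n+1$, concludes $(\lambda\vec x)\,\mathsf{letrec}\,f_1=L_1,\dots,f_n=L_n\,\mathsf{in}\,L_{n+1}$ and discharges in all $\mathcal D_j$ the marked assumptions $(\lambda\vec x)c_i$ for fresh distinct constants $c_i$; here every prefix $\vec y$ on a thread in $\mathcal D_j$ down from such an assumption satisfies $|\vec y|\ge|\vec x|$ and still contains all the variables $\vec x$ (none of them is removed on the thread). In $\mathbf{ug\text{-}Reg}_{\mathsf{letrec}}$ the axioms are only $(\lambda y)y$, and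 $(\mathsf{Vac})$ may remove any vacuous binding. An access path starts at the conclusion and steps upwards through $(\lambda)$, $(\mathsf{Vac})$, through $(@)$ to either premise, through $(\mathrm{FIX}_{\mathsf{letrec}})$ to the rightmost premise, and from a discharged assumption $(\lambda\vec x)c_i$ to the premise $(\lambda\vec x)L_i[\vec f:=\vec c]$ of the instance that discharges it. A derivation is *guarded on access path cycles* if each cycle of each access path passes an instance of $(\lambda)$ or $(@)$; it is a derivation in $\mathbf{Reg}_{\mathsf{letrec}}$ (resp. $\mathbf{Reg}^+_{\mathsf{letrec}}$) if the subderivation ending in any bottommost instance of $(\mathrm{FIX}_{\mathsf{letrec}})$ is guarded on access path cycles. **Correspondence.** A term *arises* from an occurrence $o$ of $(\lambda\vec y)P$ in $\mathcal D$ if it is $(\lambda\vec y)P$ and no $(\mathrm{FIX}_{\mathsf{letrec}})$-instance is below $o$, or if there is one below $o$ and the term is $(\lambda\vec y)\,\mathsf{letrec}\,B\,\mathsf{in}\,\tilde P$ where $P=\tilde P[\vec f:=\vec c]$ and $B$ consists of bindings from the outermost binding groups in the conclusions of the $(\mathrm{FIX}_{\mathsf{letrec}})$-instances below $o$, including all those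 reachable from $\tilde P$. A rewrite sequence from $(\lambda)L$ *corresponds* to an access path if it is composed of the following steps for the passes of the path, and after each pass the term reached arises from the occurrence reached: * $(\mathrm{FIX}_{\mathsf{letrec}})$: the empty sequence at a bottommost instance, otherwise unf.letrec; * $(@)$ to the left/right: $@_0$/$@_1$, and $(\lambda)$: $\lambda$, preceded by unf.@ resp. unf.$\lambda$ if above a $(\mathrm{FIX}_{\mathsf{letrec}})$-instance; * $(\mathsf{Vac})$: the compression step for the same binding, preceded by unf.reduce if it is not possible directly; * step from a marked assumption: unf.rec, followed by unf.reduce if possible. It corresponds *partially* if it is continued by a proper initial part of the steps for one more pass or, at an axiom, by unf.reduce- and unf.nil-steps. An infinite rewrite sequence corresponds to an infinite access path if arbitrarily long initial segments of it correspond to the initial segments of the path. **Lemma.** Let $\mathcal D$ be a closed derivation in $\mathbf{ug\text{-}Reg}_{\mathsf{letrec}}$ (in $\mathbf{ug\text{-}Reg}^+_{\mathsf{letrec}}$) with conclusion $(\lambda)L$. Then there is a (in general history-aware) scope-delimiting (scope$^+$-delimiting) strategy $\mathbb S_{\mathcal D}$ for $\mathit{Reg}_{\mathsf{letrec}}$ ($\mathit{Reg}^+_{\mathsf{letrec}}$)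 such that: 1. every finite or infinite access path of $\mathcal D$ has a corresponding $\mathbb S_{\mathcal D}$-rewrite sequence from $(\lambda)L$; 2. every finite $\mathbb S_{\mathcal D}$-rewrite sequence from $(\lambda)L$ corresponds, possibly partially, to an access path of $\mathcal D$, and every infinite one corresponds to an infinite access path; 3. $ST_{\mathbb S_{\mathcal D}}(L)$ is the set of last terms of the rewrite sequences that correspond, possibly partially, to access paths of $\mathcal D$; and $L$ is $\mathbb S_{\mathcal D}$-regular; 4. $L$ is $\mathbb S_{\mathcal D}$-productive if and only if $\mathcal D$ is guarded on access path cycles, if and only if $\mathcal D$ is a derivation in $\mathbf{Reg}_{\mathsf{letrec}}$ (in $\mathbf{Reg}^+_{\mathsf{letrec}}$). -/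

import Mathlib

namespace LetrecReg

/-! ## Terms of the lambda calculus with letrec -/

/-- Terms of the lambda calculus with letrec, up to renaming of bound variables.
`Tm n m` is the type of terms over a lambda-abstraction prefix `x_0 … x_{n-1}` (the variable `x_i`
is `var i`, and the innermost one has the largest number) and over `m` free recursion variables
(or constants standing for them) `f_0 … f_{m-1}`.
`letrec k B t` is `letrec f_m = B 0, …, f_{m+k-1} = B (k-1) in t`. -/
inductive Tm : ℕ → ℕ → Type
  | var {n m : ℕ} (x : Fin n) : Tm n m
  | rvar {n m : ℕ} (f : Fin m) : Tm n m
  | lam {n m : ℕ} (t : Tm (n + 1) m) : Tm n m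
  | app {n m : ℕ} (t u : Tm n m) : Tm n m
  | letrec {n m : ℕ} (k : ℕ) (B : Fin k → Tm n (m + k)) (t : Tm n (m + k)) : Tm n m

/-- A renaming of prefix variables, carried below one abstraction. -/
def liftVar {n n' : ℕ} (ρ : Fin n → Fin n') : Fin (n + 1) → Fin (n' + 1) :=
  Fin.lastCases (Fin.last n') (fun x => (ρ x).castSucc)

/-- A renaming of recursion variables, carried below a binding group of size `k`. -/
def liftRec {m m' : ℕ} (ξ : Fin m → Fin m') (k : ℕ) : Fin (m + k) → Fin (m' + k) :=
  Fin.addCases (fun f => Fin.castAdd k (ξ f)) (fun j => Fin.natAdd m' j)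

/-- A map between two innermost binding groups, leaving the `m` outer recursion variables fixed. -/
def mapGroup (m : ℕ) {k k' : ℕ} (e : Fin k → Fin k') : Fin (m + k) → Fin (m + k') :=
  Fin.addCases (fun f => Fin.castAdd k' f) (fun j => Fin.natAdd m (e j))

/-- Simultaneous renaming of prefix variables and of recursion variables. -/
def Tm.ren : {n m n' m' : ℕ} → (Fin n → Fin n') → (Fin m → Fin m') → Tm n m → Tm n' m'
  | _, _, _, _, ρ, _, .var x => .var (ρ x)
  | _, _, _, _, _, ξ, .rvar f => .rvar (ξ f)
  | _, _, _, _, ρ, ξ, .lam t => .lam (t.ren (liftVar ρ) ξ)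
  | _, _, _, _, ρ, ξ, .app t u => .app (t.ren ρ ξ) (u.ren ρ ξ)
  | _, _, _, _, ρ, ξ, .letrec k B t =>
      .letrec k (fun j => (B j).ren ρ (liftRec ξ k)) (t.ren ρ (liftRec ξ k))

/-- The free recursion variable `f` occurs in the term. -/
def Tm.Occurs : {n m : ℕ} → Fin m → Tm n m → Prop
  | _, _, _, .var _ => False
  | _, _, f, .rvar g => f = g
  | _, _, f, .lam t => t.Occurs f
  | _, _, f, .app t u => t.Occurs f ∨ u.Occurs f
  | _, _, f, .letrec k B t =>
      (∃ j, (B j).Occurs (Fin.castAdd k f)) ∨ t.Occurs (Fin.castAdd k f)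

/-- The recursion variables of the binding group `B` that are reachable from `t`. -/
inductive Reachable {n m k : ℕ} (B : Fin k → Tm n (m + k)) (t : Tm n (m + k)) : Fin k → Prop
  | body {j : Fin k} : t.Occurs (Fin.natAdd m j) → Reachable B t j
  | bind {i j : Fin k} : Reachable B t i → (B i).Occurs (Fin.natAdd m j) → Reachable B t j

/-! ## The rewrite systems on prefixed terms -/

/-- Prefixed terms `(λ x_0 … x_{n-1}) L` without free recursion variables. -/
structure PTerm where
  len : ℕ
  body : Tm len 0

/-- The term `L` with the empty prefix. -/
def PTerm.ofTm (L : Tm 0 0) : PTerm := ⟨0, L⟩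

/-- Selects one of the two systems: the basic one, where every vacuous binding of a prefix
may be removed, and the `plus` one, where only the last binding may be removed. -/
inductive Sys
  | basic
  | plus

/-- The bindings that may be removed from a prefix of length `n + 1`. -/
def Sys.Removable : Sys → {n : ℕ} → Fin (n + 1) → Prop
  | .basic, _, _ => True
  | .plus, n, i => i = Fin.last n

/-- The prefixed variables `(λ x_0 … x_{n-1}) x` that are axioms: `(λ y) y` in the basic system,
and `(λ x⃗ y) y` in the `plus` system. -/
def Sys.IsAxiom : Sys → {n : ℕ} → Fin n → Prop
  | .basic, n, _ => n = 1
  | .plus, n, x => (x : ℕ) + 1 = n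

/-- Names of the rewrite rules; `compress i` removes the vacuous binding of `x_i`. -/
inductive Rule
  | appL
  | appR
  | lam
  | compress (i : ℕ)
  | unfApp
  | unfLam
  | unfLetrec
  | unfRec
  | unfNil
  | unfReduce

/-- The rewrite relations of the systems for decomposing prefixed letrec-terms: the rules that
decompose applications and abstractions and remove vacuous bindings from the prefix, and
the rules that unfold an outermost letrec. -/
inductive Step (s : Sys) : Rule → PTerm → PTerm → Prop
  | appL {n : ℕ} (t u : Tm n 0) : Step s .appL ⟨n, .app t u⟩ ⟨n, t⟩
  | appR {n : ℕ} (t u : Tm n 0) : Step s .appR ⟨n, .app t u⟩ ⟨n, u⟩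
  | lam {n : ℕ} (t : Tm (n + 1) 0) : Step s .lam ⟨n, .lam t⟩ ⟨n + 1, t⟩
  /- a term is of the form `t.ren i.succAbove id` iff `x_i` does not occur in it -/
  | compress {n : ℕ} (i : Fin (n + 1)) (t : Tm n 0) : s.Removable i →
      Step s (.compress i) ⟨n + 1, t.ren i.succAbove id⟩ ⟨n, t⟩
  | unfApp {n k : ℕ} (B : Fin k → Tm n (0 + k)) (t u : Tm n (0 + k)) :
      Step s .unfApp ⟨n, .letrec k B (.app t u)⟩ ⟨n, .app (.letrec k B t) (.letrec k B u)⟩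
  | unfLam {n k : ℕ} (B : Fin k → Tm n (0 + k)) (t : Tm (n + 1) (0 + k)) :
      Step s .unfLam ⟨n, .letrec k B (.lam t)⟩
        ⟨n, .lam (.letrec k (fun j => (B j).ren Fin.castSucc id) t)⟩
  | unfLetrec {n k l : ℕ} (B : Fin k → Tm n (0 + k)) (C : Fin l → Tm n (0 + k + l))
      (t : Tm n (0 + k + l)) :
      Step s .unfLetrec ⟨n, .letrec k B (.letrec l C t)⟩
        ⟨n, .letrec (k + l)
          (Fin.addCases (fun j => (B j).ren id (mapGroup 0 (Fin.castAdd l)))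
            (fun j => (C j).ren id (Fin.cast (Nat.add_assoc 0 k l))))
          (t.ren id (Fin.cast (Nat.add_assoc 0 k l)))⟩
  | unfRec {n k : ℕ} (B : Fin k → Tm n (0 + k)) (j : Fin k) :
      Step s .unfRec ⟨n, .letrec k B (.rvar (Fin.natAdd 0 j))⟩ ⟨n, .letrec k B (B j)⟩
  | unfNil {n : ℕ} (B : Fin 0 → Tm n 0) (t : Tm n 0) :
      Step s .unfNil ⟨n, .letrec 0 B t⟩ ⟨n, t⟩
  /- removal of all unreachable bindings, if there are any; `e` enumerates the reachable ones -/
  | unfReduce {n k k' : ℕ} (B : Fin k → Tm n (0 + k)) (t : Tm n (0 + k))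
      (e : Fin k' ↪o Fin k) (B' : Fin k' → Tm n (0 + k')) (t' : Tm n (0 + k')) :
      k' < k → (∀ j, (∃ i, e i = j) ↔ Reachable B t j) →
      (∀ i, (B' i).ren id (mapGroup 0 e) = B (e i)) → t'.ren id (mapGroup 0 e) = t →
      Step s .unfReduce ⟨n, .letrec k B t⟩ ⟨n, .letrec k' B' t'⟩

/-- The list of the steps of a rewrite sequence: for each step, its rule and its target. -/
abbrev RSeq := List (Rule × PTerm)

/-- The last term of a rewrite sequence with source `t`. -/
def target : PTerm → RSeq → PTerm
  | t, [] => t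
  | _, x :: τ => target x.2 τ

/-- `τ` is the list of the steps of a rewrite sequence from `t`. -/
def IsRewriteSeq (s : Sys) : PTerm → RSeq → Prop
  | _, [] => True
  | t, x :: τ => Step s x.1 t x.2 ∧ IsRewriteSeq s x.2 τ

/-! ## Strategies -/

/-- A history-aware strategy: the rewrite system is labelled (terms start with the label
`init t`; the lift of a step `t → u` by rule `r` leads from label `l` to `relabel t l r u`), and a
sub-system of the labelled system with the same normal forms is singled out.
`next t l (r, u)`: from `t` with label `l` the strategy may use rule `r` with target `u`. -/
structure Strategy (s : Sys) where
  Label : Type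
  init : PTerm → Label
  relabel : PTerm → Label → Rule → PTerm → Label
  next : PTerm → Label → Rule × PTerm → Prop
  step_of_next : ∀ t l x, next t l x → Step s x.1 t x.2
  next_of_step : ∀ t l r u, Step s r t u → ∃ x, next t l x

variable {s : Sys}

/-- Scope-delimiting strategies (scope⁺-delimiting ones for the `plus` system): the only sources
of more than one step are those where precisely the two steps to the left and to the right part
of an application are possible, and these two steps are possible only together. -/
def Strategy.IsScopeDelimiting (S : Strategy s) : Prop :=
  ∀ t l,
    (∀ x y, S.next t l x → S.next t l y → x ≠ y →
      (x.1 = .appL ∧ y.1 = .appR) ∨ (x.1 = .appR ∧ y.1 = .appL)) ∧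
    ((∃ x, S.next t l x ∧ x.1 = .appL) ↔ (∃ x, S.next t l x ∧ x.1 = .appR))

/-- `τ` lists the steps of a rewrite sequence according to the strategy from `t` with label `l`. -/
def Strategy.IsSeqFrom (S : Strategy s) : PTerm → S.Label → RSeq → Prop
  | _, _, [] => True
  | t, l, x :: τ => S.next t l x ∧ S.IsSeqFrom x.2 (S.relabel t l x.1 x.2) τ

/-- Finite rewrite sequences according to the strategy that start on `() L`. -/
def Strategy.IsSeq (S : Strategy s) (L : Tm 0 0) (τ : RSeq) : Prop :=
  S.IsSeqFrom (.ofTm L) (S.init (.ofTm L)) τ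

/-- Infinite rewrite sequences according to the strategy that start on `() L`. -/
def Strategy.IsInfSeq (S : Strategy s) (L : Tm 0 0) (σ : ℕ → Rule × PTerm) : Prop :=
  ∀ N, S.IsSeq L ((List.range N).map σ)

/-- The generated subterms of `L` with respect to the strategy. -/
def Strategy.generatedSubterms (S : Strategy s) (L : Tm 0 0) : Set PTerm :=
  {t | ∃ τ, S.IsSeq L τ ∧ target (.ofTm L) τ = t}

/-- `L` is regular with respect to the strategy. -/
def Strategy.Regular (S : Strategy s) (L : Tm 0 0) : Prop := (S.generatedSubterms L).Finite

/-- The rules that decompose an application or an abstraction. -/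
def Rule.IsGuard : Rule → Prop
  | .appL | .appR | .lam => True
  | _ => False

/-- `L` is productive with respect to the strategy: every infinite rewrite sequence according to
the strategy that starts on `() L` decomposes an abstraction or an application infinitely often. -/
def Strategy.Productive (S : Strategy s) (L : Tm 0 0) : Prop :=
  ∀ σ, S.IsInfSeq L σ → ∀ N, ∃ i, N ≤ i ∧ (σ i).1.IsGuard

/-! ## Derivations -/

/-- Prooftrees built from the axioms and rules of the two unguarded proof systems, before
imposing the side condition on discharged assumptions. `ProofTree s n m t` has as conclusion
the prefixed term `(λ x_0 … x_{n-1}) t`, where the `m` free recursion variables of `t` are the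
distinct constants introduced by the instances of the letrec-rule below. Hence marked assumptions
of a prooftree with `m = 0` are all discharged: such a prooftree is closed. -/
inductive ProofTree (s : Sys) : (n m : ℕ) → Tm n m → Type
  | ax {n m : ℕ} (x : Fin n) : s.IsAxiom x → ProofTree s n m (.var x)
  | assumption {n m : ℕ} (f : Fin m) : ProofTree s n m (.rvar f)
  | lam {n m : ℕ} {t : Tm (n + 1) m} : ProofTree s (n + 1) m t → ProofTree s n m (.lam t)
  | app {n m : ℕ} {t u : Tm n m} :
      ProofTree s n m t → ProofTree s n m u → ProofTree s n m (.app t u)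
  | vac {n m : ℕ} (i : Fin (n + 1)) {t : Tm n m} {t' : Tm (n + 1) m} : s.Removable i →
      t' = t.ren i.succAbove id → ProofTree s n m t → ProofTree s (n + 1) m t'
  | fix {n m : ℕ} {k : ℕ} {B : Fin k → Tm n (m + k)} {t : Tm n (m + k)} :
      (∀ j, ProofTree s n (m + k) (B j)) → ProofTree s n (m + k) t →
      ProofTree s n m (.letrec k B t)

/-- Positions in prooftrees: the premises of an instance are numbered from the left, from `0`. -/
abbrev Pos := List ℕ

/-- A formula occurrence in a prooftree, with its position, its formula, the subderivation that
ends in it, and data that depend on the part of the prooftree below it: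
* `origin f`: the position of the letrec-rule instance that introduces the constant `f`,
  and the number of the corresponding binding;
* `binds f u`: `u` is the right-hand side of the binding for the recursion variable represented by
  `f` in the binding group in the conclusion of that instance, as a term over the present prefix
  (if it contains a prefix variable that has been removed in between, then there is no such `u`);
* `inFix`: there is an instance of the letrec-rule below the occurrence. -/
structure Occ (s : Sys) where
  pos : Pos
  len : ℕ
  consts : ℕ
  term : Tm len consts
  deriv : ProofTree s len consts term
  origin : Fin consts → Pos × ℕ
  binds : Fin consts → Tm len consts → Prop
  inFix : Prop

/-- The occurrence of the `i`-th premise of the instance whose conclusion is the given one. -/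
def Occ.child : Occ s → ℕ → Option (Occ s)
  | ⟨p, _, _, _, .lam d, org, bd, b⟩, 0 =>
      some ⟨p ++ [0], _, _, _, d, org,
        fun f u => ∃ v, bd f v ∧ u = v.ren Fin.castSucc id, b⟩
  | ⟨p, _, _, _, .app d _, org, bd, b⟩, 0 => some ⟨p ++ [0], _, _, _, d, org, bd, b⟩
  | ⟨p, _, _, _, .app _ d, org, bd, b⟩, 1 => some ⟨p ++ [1], _, _, _, d, org, bd, b⟩
  | ⟨p, _ + 1, _, _, .vac i _ _ d, org, bd, b⟩, 0 =>
      some ⟨p ++ [0], _, _, _, d, org, fun f u => bd f (u.ren i.succAbove id), b⟩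
  | ⟨p, n, m, _, .fix (k := k) (B := B) dB d, org, bd, _⟩, i =>
      let org' : Fin (m + k) → Pos × ℕ := Fin.addCases org (fun j => (p, (j : ℕ)))
      let bd' : Fin (m + k) → Tm n (m + k) → Prop :=
        Fin.addCases (fun f u => ∃ v, bd f v ∧ u = v.ren id (Fin.castAdd k)) (fun j u => u = B j)
      if h : i < k then
        some ⟨p ++ [i], _, _, _, dB ⟨i, h⟩, org', bd', True⟩
      else if i = k then
        some ⟨p ++ [i], _, _, _, d, org', bd', True⟩
      else none
  | _, _ => none

/-- Whether a formula occurrence is an axiom or a marked assumption, or of which rule it is the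
conclusion. For a marked assumption: the position of the instance of the letrec-rule that
discharges it, and the number of the binding. For `vac i`: the removed binding is that of `x_i`.
For `fix k`: the binding group has size `k`. -/
inductive Last
  | ax
  | assumption (b : Pos) (j : ℕ)
  | lam
  | app
  | vac (i : ℕ)
  | fix (k : ℕ)

/-- The axiom, marked assumption or last rule of the subderivation that ends in an occurrence. -/
def Occ.last : Occ s → Last
  | ⟨_, _, _, _, .ax _ _, _, _, _⟩ => .ax
  | ⟨_, _, _, _, .assumption f, org, _, _⟩ => .assumption (org f).1 (org f).2
  | ⟨_, _, _, _, .lam _, _, _, _⟩ => .lam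
  | ⟨_, _, _, _, .app _ _, _, _, _⟩ => .app
  | ⟨_, _ + 1, _, _, .vac i _ _ _, _, _, _⟩ => .vac i
  | ⟨_, _, _, _, .fix (k := k) _ _, _, _, _⟩ => .fix k

namespace ProofTree

variable {L : Tm 0 0}

/-- The occurrence of the conclusion of a closed prooftree. -/
def root (D : ProofTree s 0 0 L) : Occ s :=
  ⟨[], 0, 0, L, D, Fin.elim0, fun f _ => f.elim0, False⟩

/-- The formula occurrence at a position of a closed prooftree. -/
def occ (D : ProofTree s 0 0 L) (p : Pos) : Option (Occ s) :=
  p.foldlM Occ.child D.root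

/-- The last rule of the subderivation at `p` is `r`. -/
def LastAt (D : ProofTree s 0 0 L) (p : Pos) (r : Last) : Prop :=
  ∃ o, D.occ p = some o ∧ o.last = r

/-- The position `p` is above an instance of the letrec-rule. -/
def InFix (D : ProofTree s 0 0 L) (p : Pos) : Prop := ∃ o, D.occ p = some o ∧ o.inFix

/-- Closed derivations of the unguarded proof systems: for every marked assumption `o`
and the conclusion `c` (with prefix `x⃗`) of the instance of the letrec-rule that discharges it, the
prefix of `o` is `x⃗`, and every formula `x` on the thread between them has a prefix that
is at least as long as `x⃗` and still contains all variables of `x⃗`, that is, if `x` is the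
conclusion of an instance that removes a binding, then this binding is not in `x⃗`. -/
def IsDerivation (D : ProofTree s 0 0 L) : Prop :=
  ∀ p o b j c, D.occ p = some o → o.last = .assumption b j → D.occ b = some c →
    o.len = c.len ∧
    ∀ q x, D.occ q = some x → b <+: q → q <+: p →
      c.len ≤ x.len ∧ ∀ i, x.last = .vac i → c.len ≤ i

/-! ### Access paths -/

/-- The kinds of steps of access paths. -/
inductive Pass
  | lam
  | appL
  | appR
  | vac (i : ℕ)
  | fix
  | jump

/-- The steps of (relative) access paths. At an instance of the letrec-rule they lead to
the rightmost premise, and from a marked assumption to the premise that belongs to the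
binding of its recursion variable, at the instance that discharges it. -/
inductive Access (D : ProofTree s 0 0 L) : Pass → Pos → Pos → Prop
  | lam {p : Pos} : D.LastAt p .lam → Access D .lam p (p ++ [0])
  | appL {p : Pos} : D.LastAt p .app → Access D .appL p (p ++ [0])
  | appR {p : Pos} : D.LastAt p .app → Access D .appR p (p ++ [1])
  | vac {p : Pos} {i : ℕ} : D.LastAt p (.vac i) → Access D (.vac i) p (p ++ [0])
  | fix {p : Pos} {k : ℕ} : D.LastAt p (.fix k) → Access D .fix p (p ++ [k])
  | jump {p b : Pos} {j : ℕ} : D.LastAt p (.assumption b j) → Access D .jump p (b ++ [j])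

/-- `p 0, …, p N` is a relative access path from `q`. -/
def IsAccessPathFrom (D : ProofTree s 0 0 L) (q : Pos) (N : ℕ) (p : ℕ → Pos) : Prop :=
  p 0 = q ∧ ∀ i < N, ∃ κ, D.Access κ (p i) (p (i + 1))

/-- The list `π` of positions is a (finite) access path: it starts at the conclusion. -/
def IsAccessPath (D : ProofTree s 0 0 L) (π : List Pos) : Prop :=
  ∃ N p, D.IsAccessPathFrom [] N p ∧ π = (List.range (N + 1)).map p

/-- `p 0, p 1, …` is an infinite access path. -/
def IsInfAccessPath (D : ProofTree s 0 0 L) (p : ℕ → Pos) : Prop :=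
  ∀ N, D.IsAccessPathFrom [] N p

/-- Every cycle on a relative access path from `q` passes an abstraction or application rule. -/
def GuardedFrom (D : ProofTree s 0 0 L) (q : Pos) : Prop :=
  ∀ N p, D.IsAccessPathFrom q N p → ∀ i j, i < j → j ≤ N → p i = p j →
    ∃ l, i ≤ l ∧ l < j ∧ (D.LastAt (p l) .lam ∨ D.LastAt (p l) .app)

/-- The derivation is guarded on access path cycles. -/
def GuardedOnAccessPathCycles (D : ProofTree s 0 0 L) : Prop := D.GuardedFrom []

/-- Closed derivations of the guarded proof systems: moreover, for every bottommost instance of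
the letrec-rule, the subderivation that ends in it is guarded on access path cycles. -/
def IsGuardedDerivation (D : ProofTree s 0 0 L) : Prop :=
  D.IsDerivation ∧ ∀ q k, D.LastAt q (.fix k) → ¬ D.InFix q → D.GuardedFrom q

end ProofTree

/-! ## The correspondence between access paths and rewrite sequences -/

/-- The prefixed term `t` arises from an occurrence of `(λ y⃗) P`. If no instance of the letrec-rule
is below the occurrence, then `t` is `(λ y⃗) P`. Otherwise `t` is `(λ y⃗) letrec B in P'`, where
`B` consists of bindings in the conclusions of the instances of the letrec-rule below, in the order
given by `e` and among them all those that are needed for the recursion variables in `P'` and `B`,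
and `P` results from `P'` by replacing the recursion variables by the constants for them. -/
def Occ.Arises (o : Occ s) (t : PTerm) : Prop :=
  (¬ o.inFix ∧ ∃ u : Tm o.len 0, t = ⟨o.len, u⟩ ∧ u.ren id Fin.elim0 = o.term) ∨
  (o.inFix ∧ ∃ (k : ℕ) (e : Fin k ↪o Fin o.consts) (B : Fin k → Tm o.len (0 + k))
    (P : Tm o.len (0 + k)), t = ⟨o.len, .letrec k B P⟩ ∧
      P.ren id (fun f => e (Fin.cast (Nat.zero_add k) f)) = o.term ∧
      ∀ j, o.binds (e j) ((B j).ren id (fun f => e (Fin.cast (Nat.zero_add k) f))))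

namespace ProofTree

variable {L : Tm 0 0}

/-- The rewrite steps on `t` that correspond to a step of an access path at position `p`. Above an
instance of the letrec-rule, the outermost letrec has to be unfolded first; unreachable bindings
are removed after the unfolding of a recursion variable, and if this is needed for a binding in
the prefix to be vacuous. -/
inductive PassSteps (D : ProofTree s 0 0 L) (p : Pos) : Pass → PTerm → RSeq → Prop
  | fix {t : PTerm} : ¬ D.InFix p → PassSteps D p .fix t []
  | fixUnf {t t' : PTerm} : D.InFix p → Step s .unfLetrec t t' →
      PassSteps D p .fix t [(.unfLetrec, t')]
  | appL {t t' : PTerm} : ¬ D.InFix p → Step s .appL t t' → PassSteps D p .appL t [(.appL, t')]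
  | appLUnf {t u t' : PTerm} : D.InFix p → Step s .unfApp t u → Step s .appL u t' →
      PassSteps D p .appL t [(.unfApp, u), (.appL, t')]
  | appR {t t' : PTerm} : ¬ D.InFix p → Step s .appR t t' → PassSteps D p .appR t [(.appR, t')]
  | appRUnf {t u t' : PTerm} : D.InFix p → Step s .unfApp t u → Step s .appR u t' →
      PassSteps D p .appR t [(.unfApp, u), (.appR, t')]
  | lam {t t' : PTerm} : ¬ D.InFix p → Step s .lam t t' → PassSteps D p .lam t [(.lam, t')]
  | lamUnf {t u t' : PTerm} : D.InFix p → Step s .unfLam t u → Step s .lam u t' →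
      PassSteps D p .lam t [(.unfLam, u), (.lam, t')]
  | vac {t t' : PTerm} {i : ℕ} : Step s (.compress i) t t' →
      PassSteps D p (.vac i) t [(.compress i, t')]
  | vacUnf {t u t' : PTerm} {i : ℕ} : D.InFix p → (∀ v, ¬ Step s (.compress i) t v) →
      Step s .unfReduce t u → Step s (.compress i) u t' →
      PassSteps D p (.vac i) t [(.unfReduce, u), (.compress i, t')]
  | jump {t t' : PTerm} : Step s .unfRec t t' → (∀ v, ¬ Step s .unfReduce t' v) →
      PassSteps D p .jump t [(.unfRec, t')]
  | jumpUnf {t u t' : PTerm} : Step s .unfRec t u → Step s .unfReduce u t' →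
      PassSteps D p .jump t [(.unfRec, u), (.unfReduce, t')]

/-- The rewrite sequence `τ` from `() L` corresponds to the access path `π`: it is composed of
the rewrite steps for the single steps of the path, and after each of them the term that is reached
arises from the occurrence that is reached. -/
inductive Corresponds (D : ProofTree s 0 0 L) : List Pos → RSeq → Prop
  | start : Corresponds D [[]] []
  | step {π : List Pos} {p q : Pos} {κ : Pass} {τ σ : RSeq} {o : Occ s} :
      Corresponds D (π ++ [p]) τ → D.Access κ p q →
      D.PassSteps p κ (target (.ofTm L) τ) σ →
      D.occ q = some o → o.Arises (target (.ofTm L) (τ ++ σ)) →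
      Corresponds D (π ++ [p, q]) (τ ++ σ)

/-- The rewrite sequence `σ` from `t` is a non-empty proper initial part of the rewrite steps for a
step of an access path at `p`, or `p` is an axiom and `σ` removes an outermost letrec above the
variable. -/
def PartialSteps (D : ProofTree s 0 0 L) (p : Pos) (t : PTerm) (σ : RSeq) : Prop :=
  σ ≠ [] ∧
  ((∃ κ q σ', D.Access κ p q ∧ σ' ≠ [] ∧ D.PassSteps p κ t (σ ++ σ')) ∨
   (D.LastAt p .ax ∧ IsRewriteSeq s t σ ∧ ∀ x ∈ σ, x.1 = .unfReduce ∨ x.1 = .unfNil))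

/-- The rewrite sequence `τ` corresponds to the access path `π`, continued by an initial
part of the rewrite steps for one more step, or by the removal of a letrec at an axiom. -/
def CorrespondsPartially (D : ProofTree s 0 0 L) (π : List Pos) (τ : RSeq) : Prop :=
  ∃ π' p τ' σ, π = π' ++ [p] ∧ τ = τ' ++ σ ∧ D.Corresponds π τ' ∧
    D.PartialSteps p (target (.ofTm L) τ') σ

/-- The infinite rewrite sequence `σ` corresponds to the infinite access path `p`. -/
def CorrespondsInf (D : ProofTree s 0 0 L) (p : ℕ → Pos) (σ : ℕ → Rule × PTerm) : Prop :=
  ∃ g : ℕ → ℕ, Monotone g ∧ Filter.Tendsto g Filter.atTop Filter.atTop ∧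
    ∀ N, D.Corresponds ((List.range (N + 1)).map p) ((List.range (g N)).map σ)

/-- The terms that arise from occurrences on access paths, with the intermediate ones. -/
def arisingTerms (D : ProofTree s 0 0 L) : Set PTerm :=
  {t | ∃ π τ, D.IsAccessPath π ∧ (D.Corresponds π τ ∨ D.CorrespondsPartially π τ) ∧
    target (.ofTm L) τ = t}

end ProofTree

end LetrecReg

/-!
The proof rests on the fact that rewriting follows the access paths of a closed derivation
deterministically, with one choice at each application.

*Following one step* (`exists_pass`). Suppose that a term arises from an occurrence `o`. Each step of
an access path from `o` has a code, a rewrite sequence of at most two steps, and the last term of the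
code arises from the occurrence that is reached. For decompositions and for merging binding
groups this is a matter of pushing renamings through. The two other cases use the side condition on
discharged assumptions. A constant that occurs in a formula comes from a marked assumption above
it, and hence no variable in the prefix of the discharging instance is removed in between.
This property is inherited by the constants in the right-hand sides of the bindings involved
(`Needed.kept`), and on such threads the right-hand side of a binding is, up to weakening, the
formula of the premise from which it comes (`binds_iff`). So after the removal of unreachable bindings
no remaining binding uses a variable that `Vac` removes (`not_varOccurs_of_reachable`). After the
unfolding of a recursion variable, all reachable bindings belong to constants that are already known
at the premise to which the access path jumps (`needed_source_of_reachable`).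

*Unique decoding* (`Run.decode`). Every rewrite rule is deterministic (`Step.unique`), and the codes of
the steps from one occurrence form a prefix code (`PassSteps.eq_of_prefix`). Hence a rewrite
sequence determines the access path to which it corresponds, except for steps at bottommost
instances of the letrec-rule, whose code is empty.

*The strategy* (`strategy`). Terms are labelled by the rewrite sequence that has led to them. As long
as this sequence corresponds, possibly partially, to an access path, the strategy continues it by
the next step of a code, or removes a letrec above an axiom. Unique decoding makes it
scope-delimiting, and its rewrite sequences are the ones that correspond, possibly partially, to
access paths. Infinite sequences and infinite paths are limits of finite ones: no two successive
codes are empty, and codes have bounded length.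

*Regularity and productivity.* A derivation has finitely many occurrences, and from each of them only
finitely many terms arise, since the right-hand side for a constant is unique (`binds_unique`). If the
derivation is guarded, an infinite access path, which visits some position twice after every
stage, passes abstractions and applications again and again. Conversely, an unguarded cycle can
be repeated forever. Finally, a cycle of an access path always lies above a bottommost
instance of the letrec-rule, because below such instances access paths only lead upwards
(`guarded_iff_bottommost`).
-/

namespace LetrecReg

variable {s : Sys}

/-! ### Renaming -/

@[simp] theorem liftVar_last {n n' : ℕ} (ρ : Fin n → Fin n') :
    liftVar ρ (Fin.last n) = Fin.last n' := by simp [liftVar]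

@[simp] theorem liftVar_castSucc {n n' : ℕ} (ρ : Fin n → Fin n') (x : Fin n) :
    liftVar ρ x.castSucc = (ρ x).castSucc := by simp [liftVar]

@[simp] theorem liftRec_castAdd {m m' : ℕ} (ξ : Fin m → Fin m') (k : ℕ) (f : Fin m) :
    liftRec ξ k (Fin.castAdd k f) = Fin.castAdd k (ξ f) := by simp [liftRec]

@[simp] theorem liftRec_natAdd {m m' : ℕ} (ξ : Fin m → Fin m') (k : ℕ) (j : Fin k) :
    liftRec ξ k (Fin.natAdd m j) = Fin.natAdd m' j := by simp [liftRec]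

@[simp] theorem mapGroup_natAdd (m : ℕ) {k k' : ℕ} (e : Fin k → Fin k') (j : Fin k) :
    mapGroup m e (Fin.natAdd m j) = Fin.natAdd m (e j) := by simp [mapGroup]

theorem liftVar_comp {n n' n'' : ℕ} (ρ' : Fin n' → Fin n'') (ρ : Fin n → Fin n') :
    liftVar ρ' ∘ liftVar ρ = liftVar (ρ' ∘ ρ) := by
  funext x; induction x using Fin.lastCases <;> simp

theorem liftRec_comp {m m' m'' : ℕ} (ξ' : Fin m' → Fin m'') (ξ : Fin m → Fin m') (k : ℕ) :
    liftRec ξ' k ∘ liftRec ξ k = liftRec (ξ' ∘ ξ) k := by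
  funext x; induction x using Fin.addCases <;> simp

@[simp] theorem liftVar_id (n : ℕ) : liftVar (id : Fin n → Fin n) = id := by
  funext x; induction x using Fin.lastCases <;> simp

@[simp] theorem liftRec_id (m k : ℕ) : liftRec (id : Fin m → Fin m) k = id := by
  funext x; induction x using Fin.addCases <;> simp

theorem liftVar_injective {n n' : ℕ} {ρ : Fin n → Fin n'} (h : Function.Injective ρ) :
    Function.Injective (liftVar ρ) := by
  intro x y
  induction x using Fin.lastCases <;> induction y using Fin.lastCases <;>
    simp [Fin.castSucc_ne_last, (Fin.castSucc_ne_last _).symm]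
  exact fun e => h e

theorem castAdd_ne_natAdd {m k : ℕ} (f : Fin m) (j : Fin k) :
    Fin.castAdd k f ≠ Fin.natAdd m j := by
  intro h
  have := congrArg Fin.val h
  simp at this
  omega

theorem liftRec_injective {m m' : ℕ} {ξ : Fin m → Fin m'} (h : Function.Injective ξ) (k : ℕ) :
    Function.Injective (liftRec ξ k) := by
  intro x y
  induction x using Fin.addCases <;> induction y using Fin.addCases <;>
    simp [castAdd_ne_natAdd, (castAdd_ne_natAdd _ _).symm]
  exact fun e => h e

theorem Tm.ren_ren {n m : ℕ} (t : Tm n m) : ∀ {n' m' n'' m'' : ℕ} (ρ : Fin n → Fin n')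
    (ξ : Fin m → Fin m') (ρ' : Fin n' → Fin n'') (ξ' : Fin m' → Fin m''),
    (t.ren ρ ξ).ren ρ' ξ' = t.ren (ρ' ∘ ρ) (ξ' ∘ ξ) := by
  induction t with
  | var x => intros; simp [Tm.ren]
  | rvar f => intros; simp [Tm.ren]
  | lam t ih => intros; simp [Tm.ren, ih, liftVar_comp]
  | app t u iht ihu => intros; simp [Tm.ren, iht, ihu]
  | letrec k B t ihB iht => intros; simp [Tm.ren, ihB, iht, liftRec_comp]

@[simp] theorem Tm.ren_id {n m : ℕ} (t : Tm n m) : t.ren id id = t := by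
  induction t with
  | var x => simp [Tm.ren]
  | rvar f => simp [Tm.ren]
  | lam t ih => simp [Tm.ren, ih]
  | app t u iht ihu => simp [Tm.ren, iht, ihu]
  | letrec k B t ihB iht => simp [Tm.ren, ihB, iht]

theorem Tm.ren_injective {n m : ℕ} (t : Tm n m) : ∀ {n' m' : ℕ} {ρ : Fin n → Fin n'}
    {ξ : Fin m → Fin m'}, Function.Injective ρ → Function.Injective ξ → ∀ u : Tm n m,
    t.ren ρ ξ = u.ren ρ ξ → t = u := by
  induction t with
  | var x => intro _ _ ρ ξ hρ hξ u h; cases u <;> simp [Tm.ren] at h ⊢; exact hρ h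
  | rvar f => intro _ _ ρ ξ hρ hξ u h; cases u <;> simp [Tm.ren] at h ⊢; exact hξ h
  | lam t ih =>
    intro _ _ ρ ξ hρ hξ u h; cases u <;> simp [Tm.ren] at h ⊢
    exact ih (liftVar_injective hρ) hξ _ h
  | app t u iht ihu =>
    intro _ _ ρ ξ hρ hξ u h; cases u <;> simp [Tm.ren] at h ⊢
    exact ⟨iht hρ hξ _ h.1, ihu hρ hξ _ h.2⟩
  | letrec k B t ihB iht =>
    intro _ _ ρ ξ hρ hξ u h
    cases u <;> simp only [Tm.ren, reduceCtorEq, Tm.letrec.injEq] at h ⊢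
    obtain ⟨rfl, hB, ht⟩ := h
    have hB := eq_of_heq hB
    refine ⟨rfl, heq_of_eq (funext fun j => ?_), heq_of_eq ?_⟩
    · exact ihB j hρ (liftRec_injective hξ _) _ (congrFun hB j)
    · exact iht hρ (liftRec_injective hξ _) _ (eq_of_heq ht)

/-- The prefix variable `x` occurs in the term. -/
def Tm.VarOccurs : {n m : ℕ} → Fin n → Tm n m → Prop
  | _, _, x, .var y => x = y
  | _, _, _, .rvar _ => False
  | _, _, x, .lam t => t.VarOccurs x.castSucc
  | _, _, x, .app t u => t.VarOccurs x ∨ u.VarOccurs x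
  | _, _, x, .letrec _ B t => (∃ j, (B j).VarOccurs x) ∨ t.VarOccurs x

theorem Tm.occurs_ren {n m : ℕ} (t : Tm n m) : ∀ {n' m' : ℕ} {ρ : Fin n → Fin n'}
    {ξ : Fin m → Fin m'} {g : Fin m'},
    (t.ren ρ ξ).Occurs g ↔ ∃ f, ξ f = g ∧ t.Occurs f := by
  induction t with
  | var x => simp [Tm.ren, Tm.Occurs]
  | rvar f => simp [Tm.ren, Tm.Occurs, eq_comm]
  | lam t ih => simp [Tm.ren, Tm.Occurs, ih]
  | app t u iht ihu =>
    intros; simp only [Tm.ren, Tm.Occurs, iht, ihu, and_or_left, exists_or]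
  | @letrec n m k B t ihB iht =>
    intro n' m' ρ ξ g
    have key : ∀ Q : Fin (m + k) → Prop, (∃ f, liftRec ξ k f = Fin.castAdd k g ∧ Q f) ↔
        ∃ f, ξ f = g ∧ Q (Fin.castAdd k f) := by
      intro Q
      constructor
      · rintro ⟨f, hf, hQ⟩
        induction f using Fin.addCases with
        | left f => exact ⟨f, by simpa using hf, hQ⟩
        | right j => simp [(castAdd_ne_natAdd _ _).symm] at hf
      · rintro ⟨f, rfl, hQ⟩
        exact ⟨_, liftRec_castAdd ξ k f, hQ⟩
    simp only [Tm.ren, Tm.Occurs, ihB, iht, key, and_or_left, exists_or]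
    refine or_congr ⟨?_, ?_⟩ Iff.rfl
    · rintro ⟨j, f, h, h'⟩; exact ⟨f, h, j, h'⟩
    · rintro ⟨f, h, j, h'⟩; exact ⟨j, f, h, h'⟩

theorem Tm.varOccurs_ren {n m : ℕ} (t : Tm n m) : ∀ {n' m' : ℕ} {ρ : Fin n → Fin n'}
    {ξ : Fin m → Fin m'} {y : Fin n'},
    (t.ren ρ ξ).VarOccurs y ↔ ∃ x, ρ x = y ∧ t.VarOccurs x := by
  induction t with
  | var x => simp [Tm.ren, Tm.VarOccurs, eq_comm]
  | rvar f => simp [Tm.ren, Tm.VarOccurs]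
  | lam t ih =>
    intro n' m' ρ ξ y
    simp only [Tm.ren, Tm.VarOccurs, ih]
    constructor
    · rintro ⟨x, hx, h⟩
      induction x using Fin.lastCases with
      | last => simp [(Fin.castSucc_ne_last _).symm] at hx
      | cast x => exact ⟨x, by simpa using hx, h⟩
    · rintro ⟨x, rfl, h⟩
      exact ⟨_, liftVar_castSucc ρ x, h⟩
  | app t u iht ihu =>
    intros; simp only [Tm.ren, Tm.VarOccurs, iht, ihu, and_or_left, exists_or]
  | letrec k B t ihB iht =>
    intros
    simp only [Tm.ren, Tm.VarOccurs, ihB, iht, and_or_left, exists_or]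
    refine or_congr ⟨?_, ?_⟩ Iff.rfl
    · rintro ⟨j, f, h, h'⟩; exact ⟨f, h, j, h'⟩
    · rintro ⟨f, h, j, h'⟩; exact ⟨j, f, h, h'⟩

/-- Strengthening: a term that only uses variables in the ranges of two renamings is the result of
renaming some term. -/
theorem Tm.exists_ren {n m : ℕ} (t : Tm n m) : ∀ {n' m' : ℕ} {ρ : Fin n' → Fin n}
    {ξ : Fin m' → Fin m}, (∀ x, t.VarOccurs x → x ∈ Set.range ρ) →
    (∀ f, t.Occurs f → f ∈ Set.range ξ) → ∃ u : Tm n' m', u.ren ρ ξ = t := by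
  induction t with
  | var x =>
    intro n' m' ρ ξ h _
    obtain ⟨y, rfl⟩ := h x rfl
    exact ⟨.var y, rfl⟩
  | rvar f =>
    intro n' m' ρ ξ _ h
    obtain ⟨y, rfl⟩ := h f rfl
    exact ⟨.rvar y, rfl⟩
  | lam t ih =>
    intro n' m' ρ ξ h h'
    obtain ⟨u, rfl⟩ := ih (ρ := liftVar ρ) (ξ := ξ) (by
      intro x hx
      induction x using Fin.lastCases with
      | last => exact ⟨_, liftVar_last ρ⟩
      | cast x =>
        obtain ⟨y, rfl⟩ := h x hx
        exact ⟨_, liftVar_castSucc ρ y⟩) h'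
    exact ⟨.lam u, rfl⟩
  | app t u iht ihu =>
    intro n' m' ρ ξ h h'
    obtain ⟨u₁, rfl⟩ := iht (fun x hx => h x (Or.inl hx)) (fun x hx => h' x (Or.inl hx))
    obtain ⟨u₂, rfl⟩ := ihu (fun x hx => h x (Or.inr hx)) (fun x hx => h' x (Or.inr hx))
    exact ⟨.app u₁ u₂, rfl⟩
  | @letrec n m k B t ihB iht =>
    intro n' m' ρ ξ h h'
    have key : ∀ f : Fin (m + k), (∀ f', f = Fin.castAdd k f' → f' ∈ Set.range ξ) →
        f ∈ Set.range (liftRec ξ k) := by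
      intro f hf
      induction f using Fin.addCases with
      | left f =>
        obtain ⟨y, rfl⟩ := hf f rfl
        exact ⟨_, liftRec_castAdd ξ k y⟩
      | right j => exact ⟨_, liftRec_natAdd ξ k j⟩
    have hB : ∀ j, ∃ u : Tm n' (m' + k), u.ren ρ (liftRec ξ k) = B j := fun j =>
      ihB j (fun x hx => h x (Or.inl ⟨j, hx⟩)) (fun f hf => key f (by
        rintro f' rfl; exact h' f' (Or.inl ⟨j, hf⟩)))
    obtain ⟨u, rfl⟩ := iht (ρ := ρ) (ξ := liftRec ξ k) (fun x hx => h x (Or.inr hx))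
      (fun f hf => key f (by rintro f' rfl; exact h' f' (Or.inr hf)))
    choose C hC using hB
    exact ⟨.letrec k C u, by simp [Tm.ren, hC]⟩

/-! ### Rewrite steps -/

theorem Step.compress_inv {s : Sys} {i : ℕ} {t u : PTerm} (h : Step s (.compress i) t u) :
    ∃ (n : ℕ) (i' : Fin (n + 1)) (v : Tm n 0), (i' : ℕ) = i ∧ s.Removable i' ∧
      t = ⟨n + 1, v.ren i'.succAbove id⟩ ∧ u = ⟨n, v⟩ := by
  cases h with
  | compress i' v hr => exact ⟨_, i', v, rfl, hr, rfl, rfl⟩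

theorem Step.unfRec_inv {s : Sys} {t u : PTerm} (h : Step s .unfRec t u) :
    ∃ (n k : ℕ) (B : Fin k → Tm n (0 + k)) (j : Fin k),
      t = ⟨n, .letrec k B (.rvar (Fin.natAdd 0 j))⟩ ∧ u = ⟨n, .letrec k B (B j)⟩ := by
  cases h with
  | unfRec B j => exact ⟨_, _, B, j, rfl, rfl⟩

theorem Step.unfReduce_inv {s : Sys} {t u : PTerm} (h : Step s .unfReduce t u) :
    ∃ (n k k' : ℕ) (B : Fin k → Tm n (0 + k)) (v : Tm n (0 + k))
      (e : Fin k' ↪o Fin k) (B' : Fin k' → Tm n (0 + k')) (v' : Tm n (0 + k')),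
      k' < k ∧ (∀ j, (∃ i, e i = j) ↔ Reachable B v j) ∧
      (∀ i, (B' i).ren id (mapGroup 0 e) = B (e i)) ∧ v'.ren id (mapGroup 0 e) = v ∧
      t = ⟨n, .letrec k B v⟩ ∧ u = ⟨n, .letrec k' B' v'⟩ := by
  cases h with
  | unfReduce B v e B' v' hk he hB hv => exact ⟨_, _, _, B, v, e, B', v', hk, he, hB, hv, rfl, rfl⟩

theorem mapGroup_injective (m : ℕ) {k k' : ℕ} {e : Fin k → Fin k'} (h : Function.Injective e) :
    Function.Injective (mapGroup m e) := by
  intro x y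
  induction x using Fin.addCases <;> induction y using Fin.addCases <;>
    simp [mapGroup, castAdd_ne_natAdd, (castAdd_ne_natAdd _ _).symm]
  exact fun e => h e

/-- An order embedding between finite initial segments is determined by its range. -/
theorem orderEmbedding_eq_of_range_eq {k k₁ k₂ : ℕ} (e₁ : Fin k₁ ↪o Fin k) (e₂ : Fin k₂ ↪o Fin k)
    (h : Set.range e₁ = Set.range e₂) : ∃ hk : k₁ = k₂, ∀ i, e₁ i = e₂ (Fin.cast hk i) := by
  have hk : k₁ = k₂ := by
    have h₁ := Set.ncard_range_of_injective e₁.injective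
    have h₂ := Set.ncard_range_of_injective e₂.injective
    rw [h] at h₁
    simpa using h₁.symm.trans h₂
  subst hk
  refine ⟨rfl, fun i => ?_⟩
  have : (e₁ : Fin k₁ → Fin k) = e₂ :=
    (StrictMono.range_inj e₁.strictMono e₂.strictMono).1 h
  simpa using congrFun this i

theorem Step.unique {s : Sys} {r : Rule} {t u u' : PTerm} (h : Step s r t u) (h' : Step s r t u') :
    u = u' := by
  cases r with
  | compress i =>
    obtain ⟨n, i₁, v, hi, -, rfl, rfl⟩ := h.compress_inv
    obtain ⟨n', i₂, v', hi', -, ht, rfl⟩ := h'.compress_inv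
    rw [PTerm.mk.injEq] at ht
    obtain ⟨hn, ht⟩ := ht
    obtain rfl : n = n' := by omega
    obtain rfl : i₁ = i₂ := Fin.ext (hi.trans hi'.symm)
    rw [Tm.ren_injective _ Fin.succAbove_right_injective Function.injective_id _ (eq_of_heq ht)]
  | unfRec =>
    obtain ⟨n, k, B, j, rfl, rfl⟩ := h.unfRec_inv
    obtain ⟨n', k', B', j', ht, rfl⟩ := h'.unfRec_inv
    rw [PTerm.mk.injEq] at ht
    obtain ⟨rfl, ht₁⟩ := ht
    have ht₂ := eq_of_heq ht₁
    rw [Tm.letrec.injEq] at ht₂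
    obtain ⟨rfl, hB, ht₃⟩ := ht₂
    obtain rfl := eq_of_heq hB
    have ht₄ := Tm.rvar.inj (eq_of_heq ht₃)
    obtain rfl : j = j' := by simpa [Fin.ext_iff] using ht₄
    rfl
  | unfReduce =>
    obtain ⟨n, k, k₁, B, v, e₁, B₁, v₁, -, he₁, hB₁, hv₁, rfl, rfl⟩ := h.unfReduce_inv
    obtain ⟨n', k', k₂, B', v', e₂, B₂, v₂, -, he₂, hB₂, hv₂, ht, rfl⟩ := h'.unfReduce_inv
    cases ht
    obtain ⟨rfl, he⟩ := orderEmbedding_eq_of_range_eq e₁ e₂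
      (Set.ext fun j => (he₁ j).trans (he₂ j).symm)
    obtain rfl : e₁ = e₂ := by ext i; simpa using congrArg Fin.val (he i)
    have inj := mapGroup_injective 0 e₁.injective
    have : B₁ = B₂ := funext fun i =>
      Tm.ren_injective _ Function.injective_id inj _ ((hB₁ i).trans (hB₂ i).symm)
    rw [this, Tm.ren_injective _ Function.injective_id inj _ (hv₁.trans hv₂.symm)]
  | appL => cases h; cases h'; rfl
  | appR => cases h; cases h'; rfl
  | lam => cases h; cases h'; rfl
  | unfApp => cases h; cases h'; rfl
  | unfLam => cases h; cases h'; rfl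
  | unfLetrec => cases h; cases h'; rfl
  | unfNil => cases h; cases h'; rfl

/-- The bindings that are not reachable from the body of a letrec can be removed. Either there
are none, and then nothing changes, or this is an `unfReduce`-step. -/
theorem exists_reduce (s : Sys) {n k : ℕ} (B : Fin k → Tm n (0 + k)) (t : Tm n (0 + k)) :
    ∃ (k' : ℕ) (e : Fin k' ↪o Fin k) (B' : Fin k' → Tm n (0 + k')) (t' : Tm n (0 + k')),
      (∀ j, (∃ i, e i = j) ↔ Reachable B t j) ∧
      (∀ i, (B' i).ren id (mapGroup 0 e) = B (e i)) ∧ t'.ren id (mapGroup 0 e) = t ∧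
      (Step s .unfReduce ⟨n, .letrec k B t⟩ ⟨n, .letrec k' B' t'⟩ ∨
        ((∀ v, ¬ Step s .unfReduce ⟨n, .letrec k B t⟩ v) ∧
          (⟨n, .letrec k' B' t'⟩ : PTerm) = ⟨n, .letrec k B t⟩)) := by
  classical
  set A : Finset (Fin k) := Finset.univ.filter (Reachable B t) with hA
  set e := A.orderEmbOfFin rfl with he
  have hr : ∀ j, (∃ i, e i = j) ↔ Reachable B t j := by
    intro j
    have := Finset.range_orderEmbOfFin A rfl
    have h2 : j ∈ Set.range e ↔ j ∈ (A : Set (Fin k)) := by rw [this]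
    simpa [hA] using h2
  have hin : ∀ f : Fin (0 + k), (∀ j, f = Fin.natAdd 0 j → Reachable B t j) →
      f ∈ Set.range (mapGroup 0 e) := by
    intro f hf
    induction f using Fin.addCases with
    | left f => exact f.elim0
    | right j =>
      obtain ⟨i, rfl⟩ := (hr j).2 (hf j rfl)
      exact ⟨_, mapGroup_natAdd 0 e i⟩
  obtain ⟨t', ht'⟩ := t.exists_ren (ρ := id) (ξ := mapGroup 0 e) (by simp)
    (fun f hf => hin f (by rintro j rfl; exact .body hf))
  have hB : ∀ i, ∃ u : Tm n (0 + A.card), u.ren id (mapGroup 0 e) = B (e i) := fun i =>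
    (B (e i)).exists_ren (by simp)
      (fun f hf => hin f (by rintro j rfl; exact .bind ((hr _).1 ⟨i, rfl⟩) hf))
  choose B' hB' using hB
  refine ⟨A.card, e, B', t', hr, hB', ht', ?_⟩
  rcases (card_finset_fin_le A).lt_or_eq with hlt | heq
  · exact Or.inl (.unfReduce B t e B' t' hlt hr hB' ht')
  · right
    have hall : ∀ j, Reachable B t j := by
      intro j
      have : A = Finset.univ := Finset.eq_univ_of_card A (by simpa using heq)
      have hj : j ∈ A := by rw [this]; simp
      simpa [hA] using hj
    constructor
    · intro v hv
      obtain ⟨n', k₁, k₂, B₁, v₁, e₁, B₂, v₂, hlt, he₁, -, -, ht, -⟩ := hv.unfReduce_inv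
      cases ht
      have := Fintype.card_le_of_surjective e₁ (fun j => (he₁ j).2 (hall j))
      simp at this
      omega
    · clear_value e
      clear hin he hA
      generalize A.card = c at *
      subst heq
      obtain ⟨_, he⟩ := orderEmbedding_eq_of_range_eq e (RelEmbedding.refl _)
        (Set.ext fun j => by simpa using (hr j).2 (hall j))
      have hid : mapGroup 0 e = id := by
        funext x
        induction x using Fin.addCases with
        | left f => exact f.elim0
        | right j => rw [mapGroup_natAdd, he j]; rfl
      rw [hid] at ht'
      rw [hid] at hB'
      obtain rfl : t' = t := by simpa using ht'
      obtain rfl : B' = B := funext fun i => by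
        have h := hB' i
        rw [he i] at h
        simpa using h
      rfl

/-! ### Formula occurrences -/

/-- `IsPremise o i o'`: the occurrence `o'` is the `i`-th premise of the instance with
conclusion `o`. This is `Occ.child` as a relation, so that it can be analysed by cases. -/
inductive IsPremise : Occ s → ℕ → Occ s → Prop
  | lam {p : Pos} {n m : ℕ} {t : Tm (n + 1) m} (d : ProofTree s (n + 1) m t)
      (org : Fin m → Pos × ℕ) (bd : Fin m → Tm n m → Prop) (b : Prop) :
      IsPremise ⟨p, n, m, .lam t, .lam d, org, bd, b⟩ 0 ⟨p ++ [0], n + 1, m, t, d, org,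
        fun f u => ∃ v, bd f v ∧ u = v.ren Fin.castSucc id, b⟩
  | appL {p : Pos} {n m : ℕ} {t u : Tm n m} (d : ProofTree s n m t) (d' : ProofTree s n m u)
      (org : Fin m → Pos × ℕ) (bd : Fin m → Tm n m → Prop) (b : Prop) :
      IsPremise ⟨p, n, m, .app t u, .app d d', org, bd, b⟩ 0 ⟨p ++ [0], n, m, t, d, org, bd, b⟩
  | appR {p : Pos} {n m : ℕ} {t u : Tm n m} (d : ProofTree s n m t) (d' : ProofTree s n m u)
      (org : Fin m → Pos × ℕ) (bd : Fin m → Tm n m → Prop) (b : Prop) :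
      IsPremise ⟨p, n, m, .app t u, .app d d', org, bd, b⟩ 1 ⟨p ++ [1], n, m, u, d', org, bd, b⟩
  | vac {p : Pos} {n m : ℕ} (i : Fin (n + 1)) {t : Tm n m} {t' : Tm (n + 1) m}
      (hi : s.Removable i) (ht : t' = t.ren i.succAbove id) (d : ProofTree s n m t)
      (org : Fin m → Pos × ℕ) (bd : Fin m → Tm (n + 1) m → Prop) (b : Prop) :
      IsPremise ⟨p, n + 1, m, t', .vac i hi ht d, org, bd, b⟩ 0 ⟨p ++ [0], n, m, t, d, org,
        fun f u => bd f (u.ren i.succAbove id), b⟩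
  | fixBind {p : Pos} {n m k : ℕ} {B : Fin k → Tm n (m + k)} {t : Tm n (m + k)}
      (dB : ∀ j, ProofTree s n (m + k) (B j)) (d : ProofTree s n (m + k) t)
      (org : Fin m → Pos × ℕ) (bd : Fin m → Tm n m → Prop) (b : Prop) (j : Fin k) :
      IsPremise ⟨p, n, m, .letrec k B t, .fix dB d, org, bd, b⟩ j ⟨p ++ [(j : ℕ)], n, m + k, B j, dB j,
        Fin.addCases org (fun j => (p, (j : ℕ))),
        Fin.addCases (fun f u => ∃ v, bd f v ∧ u = v.ren id (Fin.castAdd k)) (fun j u => u = B j),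
        True⟩
  | fixBody {p : Pos} {n m k : ℕ} {B : Fin k → Tm n (m + k)} {t : Tm n (m + k)}
      (dB : ∀ j, ProofTree s n (m + k) (B j)) (d : ProofTree s n (m + k) t)
      (org : Fin m → Pos × ℕ) (bd : Fin m → Tm n m → Prop) (b : Prop) :
      IsPremise ⟨p, n, m, .letrec k B t, .fix dB d, org, bd, b⟩ k ⟨p ++ [k], n, m + k, t, d,
        Fin.addCases org (fun j => (p, (j : ℕ))),
        Fin.addCases (fun f u => ∃ v, bd f v ∧ u = v.ren id (Fin.castAdd k)) (fun j u => u = B j),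
        True⟩

theorem child_eq_some_iff {o o' : Occ s} {i : ℕ} : o.child i = some o' ↔ IsPremise o i o' := by
  constructor
  · intro h
    obtain ⟨p, n, m, t, d, org, bd, b⟩ := o
    cases d with
    | ax x hx => simp [Occ.child] at h
    | assumption f => simp [Occ.child] at h
    | lam d =>
      match i, h with
      | 0, h => obtain rfl := Option.some.inj h; exact .lam ..
    | app d d' =>
      match i, h with
      | 0, h => obtain rfl := Option.some.inj h; exact .appL ..
      | 1, h => obtain rfl := Option.some.inj h; exact .appR ..
    | vac j hj ht d =>
      match i, h with
      | 0, h => obtain rfl := Option.some.inj h; exact .vac ..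
    | @fix _ _ k B t dB d =>
      simp only [Occ.child] at h
      split_ifs at h with h₁ h₂
      · obtain rfl := Option.some.inj h
        exact .fixBind dB d org bd b ⟨i, h₁⟩
      · subst h₂
        obtain rfl := Option.some.inj h
        exact .fixBody ..
  · intro h
    cases h with
    | fixBind dB d org bd b j => simp [Occ.child]
    | fixBody => simp [Occ.child]
    | _ => rfl

theorem IsPremise.inFix {o o' : Occ s} {i : ℕ} (h : IsPremise o i o') (ho : o.inFix) :
    o'.inFix := by
  cases h <;> first | exact ho | trivial

namespace ProofTree

variable {L : Tm 0 0} {D : ProofTree s 0 0 L}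

theorem occ_concat (p : Pos) (i : ℕ) : D.occ (p ++ [i]) = (D.occ p).bind (·.child i) := by
  simp [occ, List.foldlM_append]

theorem occ_concat_eq_some {p : Pos} {i : ℕ} {o' : Occ s} :
    D.occ (p ++ [i]) = some o' ↔ ∃ o, D.occ p = some o ∧ IsPremise o i o' := by
  rw [occ_concat, Option.bind_eq_some_iff]
  simp only [child_eq_some_iff]

theorem occ_nil : D.occ [] = some D.root := rfl

theorem pos_of_occ {p : Pos} {o : Occ s} (h : D.occ p = some o) : o.pos = p := by
  induction p using List.reverseRecOn generalizing o with
  | nil => rw [occ_nil] at h; obtain rfl := Option.some.inj h; rfl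
  | append_singleton p i ih =>
    obtain ⟨o', ho', hc⟩ := occ_concat_eq_some.1 h
    have := ih ho'
    cases hc <;> simp_all

theorem occ_of_prefix {p q : Pos} {o : Occ s} (h : D.occ q = some o) (hpq : p <+: q) :
    ∃ o', D.occ p = some o' := by
  obtain ⟨r, rfl⟩ := hpq
  induction r using List.reverseRecOn generalizing o with
  | nil => exact ⟨o, by simpa using h⟩
  | append_singleton r i ih =>
    rw [← List.append_assoc] at h
    obtain ⟨o', ho', -⟩ := occ_concat_eq_some.1 h
    exact ih ho'

theorem inFix_of_prefix {p q : Pos} {o o' : Occ s} (hp : D.occ p = some o) (hq : D.occ q = some o')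
    (hpq : p <+: q) (h : o.inFix) : o'.inFix := by
  obtain ⟨r, rfl⟩ := hpq
  induction r using List.reverseRecOn generalizing o' with
  | nil =>
    rw [List.append_nil, hp] at hq
    obtain rfl := Option.some.inj hq
    exact h
  | append_singleton r i ih =>
    rw [← List.append_assoc] at hq
    obtain ⟨o'', ho'', hc⟩ := occ_concat_eq_some.1 hq
    exact hc.inFix (ih ho'')

theorem inFix_iff {p : Pos} {o : Occ s} (h : D.occ p = some o) : D.InFix p ↔ o.inFix := by
  simp [InFix, h]

theorem lastAt_iff {p : Pos} {o : Occ s} (h : D.occ p = some o) {r : Last} :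
    D.LastAt p r ↔ o.last = r := by
  simp [LastAt, h]

/-- The position of the premise for the binding that a constant stands for. -/
def _root_.LetrecReg.Occ.source (o : Occ s) (f : Fin o.consts) : Pos :=
  (o.origin f).1 ++ [(o.origin f).2]

/-- The instance of the letrec-rule that introduces the constant `f`, which occurs at `o`:
its conclusion is the occurrence `c`, and `o'` is its premise for the binding of `f`. The constants
known at `o'` are an initial segment of those known at `o`, and they have the same origins. -/
structure Introduces (D : ProofTree s 0 0 L) (o : Occ s) (f : Fin o.consts) (c o' : Occ s) :
    Prop where
  occ_conclusion : D.occ (o.origin f).1 = some c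
  occ_premise : D.occ (o.source f) = some o'
  last_conclusion : ∃ k, c.last = .fix k
  len_eq : o'.len = c.len
  inFix : o'.inFix
  lt : (f : ℕ) < o'.consts
  le : o'.consts ≤ o.consts
  isPrefix : (o.origin f).1 <+: o.pos
  ne : (o.origin f).1 ≠ o.pos
  origin_eq : ∀ g, o.origin (Fin.castLE le g) = o'.origin g

theorem append_singleton_ne {b p : Pos} (h : b <+: p) (i : ℕ) : b ≠ p ++ [i] := by
  rintro rfl
  simpa using h.length_le

theorem exists_introduces {p : Pos} {o : Occ s} (h : D.occ p = some o) (f : Fin o.consts) :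
    ∃ c o', D.Introduces o f c o' := by
  induction p using List.reverseRecOn generalizing o with
  | nil => rw [occ_nil] at h; obtain rfl := Option.some.inj h; exact f.elim0
  | append_singleton p i ih =>
    obtain ⟨o₁, ho₁, hc⟩ := occ_concat_eq_some.1 h
    have hp := pos_of_occ ho₁
    -- The constants that are known below an instance of the letrec-rule keep their origins.
    have key : ∀ (p' : Pos) (n m k : ℕ) (B : Fin k → Tm n (m + k)) (t : Tm n (m + k))
        (dB : ∀ j, ProofTree s n (m + k) (B j)) (d : ProofTree s n (m + k) t)
        (org : Fin m → Pos × ℕ) (bd : Fin m → Tm n m → Prop) (b : Prop),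
        o₁ = ⟨p', n, m, .letrec k B t, .fix dB d, org, bd, b⟩ → ∀ (i : ℕ) (u : Tm n (m + k))
        (d' : ProofTree s n (m + k) u) (bd') (f : Fin (m + k)), ∃ c o',
        D.Introduces ⟨p' ++ [i], n, m + k, u, d', Fin.addCases org (fun j => (p', (j : ℕ))),
          bd', True⟩ f c o' := by
      rintro p' n m k B t dB d org bd b rfl i u d' bd' f
      obtain rfl : p' = p := hp
      induction f using Fin.addCases with
      | left f =>
        obtain ⟨c, o', h₁, h₂, h₃, h₄, h₅, h₆, h₇, h₈, h₉, h₀⟩ := ih ho₁ f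
        have e : (Fin.addCases org (fun j => (p', (j : ℕ))) : Fin (m + k) → Pos × ℕ)
          (Fin.castAdd k f) = org f := by simp
        refine ⟨c, o', ?_, ?_, h₃, h₄, h₅, h₆, h₇.trans (Nat.le_add_right m k), ?_, ?_, ?_⟩
        · simpa only [e] using h₁
        · simpa only [e, Occ.source] using h₂
        · simpa only [e] using h₈.trans (List.prefix_append ..)
        · simpa only [e] using append_singleton_ne h₈ i
        · intro g
          rw [← h₀ g]
          have : Fin.castLE (h₇.trans (Nat.le_add_right m k)) g
            = Fin.castAdd k (Fin.castLE h₇ g) := rfl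
          simp [this]
      | right j =>
        have e : (Fin.addCases org (fun j => (p', (j : ℕ))) : Fin (m + k) → Pos × ℕ)
          (Fin.natAdd m j) = (p', (j : ℕ)) := by simp
        have hj := occ_concat_eq_some.2 ⟨_, ho₁, .fixBind dB d org bd b j⟩
        refine ⟨⟨p', n, m, .letrec k B t, .fix dB d, org, bd, b⟩,
          ⟨p' ++ [(j : ℕ)], n, m + k, B j, dB j, Fin.addCases org (fun j => (p', (j : ℕ))),
            Fin.addCases (fun f u => ∃ v, bd f v ∧ u = v.ren id (Fin.castAdd k))
              (fun j u => u = B j), True⟩, ?_,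
          (by simpa only [e, Occ.source] using hj), ⟨k, rfl⟩, rfl, trivial,
          (Fin.natAdd m j).isLt, le_rfl, ?_, ?_, fun g => rfl⟩
        all_goals simp only [e]
        · exact ho₁
        · exact List.prefix_append ..
        · exact append_singleton_ne (List.prefix_refl _) _
    cases hc with
    | fixBind dB d org bd b j => exact key _ _ _ _ _ _ dB d _ _ _ rfl _ _ _ _ f
    | fixBody dB d org bd b => exact key _ _ _ _ _ _ dB d _ _ _ rfl _ _ _ _ f
    | _ =>
      obtain ⟨c, o', h₁, h₂, h₃, h₄, h₅, h₆, h₇, h₈, h₉, h₀⟩ := ih ho₁ f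
      exact ⟨c, o', h₁, h₂, h₃, h₄, h₅, h₆, h₇, h₈.trans (List.prefix_append ..),
        append_singleton_ne h₈ _, h₀⟩

theorem Introduces.eq_of_occ {o o' o'' c : Occ s} {f : Fin o.consts} (h : D.Introduces o f c o')
    (h' : D.occ (o.source f) = some o'') : o' = o'' :=
  Option.some.inj (h.occ_premise.symm.trans h')

/-! ### Threads -/

/-- On the thread from `p` down to the conclusion `c` at position `b`, no binding of the prefix
of `c` is removed. -/
def Kept (D : ProofTree s 0 0 L) (p b : Pos) : Prop :=
  ∀ c, D.occ b = some c → ∀ q x, D.occ q = some x → b <+: q → q <+: p →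
    c.len ≤ x.len ∧ ∀ i, x.last = .vac i → c.len ≤ i

theorem Kept.of_prefix {p q b : Pos} (h : D.Kept p b) (hq : q <+: p) : D.Kept q b :=
  fun c hc r x hx hbr hrq => h c hc r x hx hbr (hrq.trans hq)

theorem Kept.trans {p b b' : Pos} {c : Occ s} (hc : D.occ b = some c) (h : D.Kept p b)
    (hb' : b' <+: b) (hb : b <+: p) (h' : D.Kept b b') : D.Kept p b' := by
  intro c' hc' q x hx hbq hqp
  rcases List.prefix_or_prefix_of_prefix hqp hb with hq | hq
  · exact h' c' hc' q x hx hbq hq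
  · have h₁ := h c hc q x hx hq hqp
    have h₂ := (h' c' hc' b c hc hb' (List.prefix_refl _)).1
    exact ⟨h₂.trans h₁.1, fun i hi => h₂.trans (h₁.2 i hi)⟩

theorem binds_unique {p : Pos} {o : Occ s} (h : D.occ p = some o) (f : Fin o.consts)
    {u u' : Tm o.len o.consts} (hu : o.binds f u) (hu' : o.binds f u') : u = u' := by
  induction p using List.reverseRecOn generalizing o with
  | nil => rw [occ_nil] at h; obtain rfl := Option.some.inj h; exact f.elim0
  | append_singleton p i ih =>
    obtain ⟨o₁, ho₁, hc⟩ := occ_concat_eq_some.1 h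
    have key : ∀ (n m k : ℕ) (B : Fin k → Tm n (m + k)) (bd : Fin m → Tm n m → Prop)
        (_ : ∀ (f : Fin m) {u u' : Tm n m}, bd f u → bd f u' → u = u')
        (f : Fin (m + k)) (u u' : Tm n (m + k)),
        (Fin.addCases (fun f u => ∃ v, bd f v ∧ u = v.ren id (Fin.castAdd k)) (fun j u => u = B j) :
          Fin (m + k) → Tm n (m + k) → Prop) f u →
        (Fin.addCases (fun f u => ∃ v, bd f v ∧ u = v.ren id (Fin.castAdd k)) (fun j u => u = B j) :
          Fin (m + k) → Tm n (m + k) → Prop) f u' → u = u' := by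
      intro n m k B bd ih f u u' hu hu'
      induction f using Fin.addCases with
      | left f =>
        simp only [Fin.addCases_left] at hu hu'
        obtain ⟨v, hv, rfl⟩ := hu
        obtain ⟨v', hv', rfl⟩ := hu'
        rw [ih f hv hv']
      | right j =>
        simp only [Fin.addCases_right] at hu hu'
        rw [hu, hu']
    cases hc with
    | lam d org bd b =>
      obtain ⟨v, hv, rfl⟩ := hu
      obtain ⟨v', hv', rfl⟩ := hu'
      rw [ih ho₁ f hv hv']
    | appL d d' org bd b => exact ih ho₁ f hu hu'
    | appR d d' org bd b => exact ih ho₁ f hu hu'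
    | vac i hi ht d org bd b =>
      exact Tm.ren_injective _ Fin.succAbove_right_injective Function.injective_id _
        (ih ho₁ f hu hu')
    | fixBind dB d org bd b j => exact key _ _ _ _ _ (fun f _ _ => ih ho₁ f) f u u' hu hu'
    | fixBody dB d org bd b => exact key _ _ _ _ _ (fun f _ _ => ih ho₁ f) f u u' hu hu'

/-- As long as the bindings of the prefix are kept, the right-hand side of the binding for a
constant is, up to weakening, the formula of the premise for this binding. -/
theorem binds_iff {p : Pos} {o o' : Occ s} (h : D.occ p = some o) {f : Fin o.consts}
    (hs : D.occ (o.source f) = some o') (hk : D.Kept p (o.origin f).1) :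
    ∃ (h₁ : o'.len ≤ o.len) (h₂ : o'.consts ≤ o.consts), ∀ u,
      o.binds f u ↔ u = o'.term.ren (Fin.castLE h₁) (Fin.castLE h₂) := by
  induction p using List.reverseRecOn generalizing o with
  | nil => rw [occ_nil] at h; obtain rfl := Option.some.inj h; exact f.elim0
  | append_singleton p i ih =>
    obtain ⟨o₁, ho₁, hc⟩ := occ_concat_eq_some.1 h
    have hp := pos_of_occ ho₁
    have key : ∀ (p' : Pos) (n m k : ℕ) (B : Fin k → Tm n (m + k)) (t : Tm n (m + k))
        (dB : ∀ j, ProofTree s n (m + k) (B j)) (d : ProofTree s n (m + k) t)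
        (org : Fin m → Pos × ℕ) (bd : Fin m → Tm n m → Prop) (b : Prop),
        o₁ = ⟨p', n, m, .letrec k B t, .fix dB d, org, bd, b⟩ → ∀ (f : Fin (m + k))
        (org' : Fin (m + k) → Pos × ℕ) (_ : org' = Fin.addCases org (fun j => (p', (j : ℕ)))),
        D.occ ((org' f).1 ++ [(org' f).2]) = some o' → D.Kept (p ++ [i]) (org' f).1 →
        ∃ (h₁ : o'.len ≤ n) (h₂ : o'.consts ≤ m + k), ∀ u,
          (Fin.addCases (fun f u => ∃ v, bd f v ∧ u = v.ren id (Fin.castAdd k))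
            (fun j u => u = B j) : Fin (m + k) → Tm n (m + k) → Prop) f u ↔
          u = o'.term.ren (Fin.castLE h₁) (Fin.castLE h₂) := by
      rintro p' n m k B t dB d org bd b rfl f org' rfl hs hk
      obtain rfl : p' = p := hp
      induction f using Fin.addCases with
      | left f =>
        simp only [Fin.addCases_left] at hs hk ⊢
        obtain ⟨h₁, h₂, hu⟩ := ih ho₁ (f := f) hs (hk.of_prefix (List.prefix_append ..))
        replace hu : ∀ u, bd f u ↔ u = _ := hu
        refine ⟨h₁, h₂.trans (Nat.le_add_right m k), fun u => ?_⟩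
        simp only [hu, exists_eq_left, Tm.ren_ren]
        rfl
      | right j =>
        simp only [Fin.addCases_right] at hs ⊢
        have hj := occ_concat_eq_some.2 ⟨_, ho₁, .fixBind dB d org bd b j⟩
        obtain rfl := Option.some.inj (hj.symm.trans hs)
        exact ⟨le_rfl, le_rfl, fun u => by
          rw [show Fin.castLE (le_refl n) = id from rfl,
            show Fin.castLE (le_refl (m + k)) = id from rfl, Tm.ren_id]⟩
    cases hc with
    | lam d org bd b =>
      obtain ⟨h₁, h₂, hu⟩ := ih ho₁ (f := f) hs (hk.of_prefix (List.prefix_append ..))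
      replace hu : ∀ u, bd f u ↔ u = _ := hu
      refine ⟨h₁.trans (Nat.le_succ _), h₂, fun u => ?_⟩
      change (∃ v, bd f v ∧ u = v.ren Fin.castSucc id) ↔ _
      simp only [hu, exists_eq_left, Tm.ren_ren]
      rfl
    | appL d d' org bd b => exact ih ho₁ (f := f) hs (hk.of_prefix (List.prefix_append ..))
    | appR d d' org bd b => exact ih ho₁ (f := f) hs (hk.of_prefix (List.prefix_append ..))
    | @vac _ n m i t t' hi ht d org bd b =>
      obtain ⟨h₁, h₂, hu⟩ := ih ho₁ (f := f) hs (hk.of_prefix (List.prefix_append ..))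
      obtain ⟨c, o'', hI⟩ := exists_introduces ho₁ f
      obtain rfl := hI.eq_of_occ hs
      have hpre := hI.isPrefix
      rw [pos_of_occ ho₁] at hpre
      have hi : c.len ≤ i := (hk c hI.occ_conclusion p _ ho₁ hpre (List.prefix_append ..)).2 i rfl
      have hn : c.len ≤ n := (hk c hI.occ_conclusion _ _ h
        (hpre.trans (List.prefix_append ..)) (List.prefix_refl _)).1
      have hlen := hI.len_eq
      have h₁' : o''.len ≤ n := by omega
      refine ⟨h₁', h₂, fun u => ?_⟩
      have e : o''.term.ren (Fin.castLE h₁) (Fin.castLE h₂)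
          = (o''.term.ren (Fin.castLE h₁') (Fin.castLE h₂)).ren i.succAbove id := by
        rw [Tm.ren_ren]
        congr 1
        funext x
        have hx : (Fin.castLE h₁' x).castSucc < i := by
          rw [Fin.lt_def]
          simpa using lt_of_lt_of_le x.isLt (hlen.le.trans hi)
        simp only [Function.comp_apply, Fin.succAbove_of_castSucc_lt _ _ hx]
        rfl
      replace hu : ∀ u, bd f u ↔ u = _ := hu
      change bd f (u.ren i.succAbove id) ↔ _
      rw [hu, e]
      exact ⟨fun h => Tm.ren_injective _ Fin.succAbove_right_injective Function.injective_id _ h,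
        fun h => h ▸ rfl⟩
    | fixBind dB d org bd b j => exact key _ _ _ _ _ _ dB d _ _ _ rfl f _ rfl hs hk
    | fixBody dB d org bd b => exact key _ _ _ _ _ _ dB d _ _ _ rfl f _ rfl hs hk

/-- A constant that occurs in a formula comes from a marked assumption above it. -/
theorem exists_assumption_of_occurs {n m : ℕ} {t : Tm n m} (d : ProofTree s n m t) :
    ∀ {p p' : Pos} {org : Fin m → Pos × ℕ} {bd : Fin m → Tm n m → Prop} {b : Prop} {f : Fin m},
      D.occ p = some ⟨p', n, m, t, d, org, bd, b⟩ → t.Occurs f →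
      ∃ q o, p <+: q ∧ D.occ q = some o ∧ o.last = .assumption (org f).1 (org f).2 := by
  induction d with
  | ax x hx => intro _ _ _ _ _ _ _ hf; exact hf.elim
  | assumption f =>
    intro p _ _ _ _ g h hf
    obtain rfl : g = f := hf
    exact ⟨p, _, List.prefix_refl _, h, rfl⟩
  | lam d ih =>
    intro p _ _ _ _ f h hf
    obtain ⟨q, o, hq, h⟩ := ih (occ_concat_eq_some.2 ⟨_, h, .lam ..⟩) hf
    exact ⟨q, o, (List.prefix_append ..).trans hq, h⟩
  | app d d' ih ih' =>
    intro p _ _ _ _ f h hf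
    rcases hf with hf | hf
    · obtain ⟨q, o, hq, h⟩ := ih (occ_concat_eq_some.2 ⟨_, h, .appL ..⟩) hf
      exact ⟨q, o, (List.prefix_append ..).trans hq, h⟩
    · obtain ⟨q, o, hq, h⟩ := ih' (occ_concat_eq_some.2 ⟨_, h, .appR ..⟩) hf
      exact ⟨q, o, (List.prefix_append ..).trans hq, h⟩
  | vac i hi ht d ih =>
    intro p _ _ _ _ f h hf
    subst ht
    obtain ⟨f, rfl, hf'⟩ := (Tm.occurs_ren _).1 hf
    obtain ⟨q, o, hq, h⟩ := ih (occ_concat_eq_some.2 ⟨_, h, .vac ..⟩) hf'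
    exact ⟨q, o, (List.prefix_append ..).trans hq, h⟩
  | fix dB d ihB ih =>
    intro p _ org _ _ f h hf
    rcases hf with ⟨j, hf⟩ | hf
    · obtain ⟨q, o, hq, h⟩ := ihB j (occ_concat_eq_some.2 ⟨_, h, .fixBind _ _ _ _ _ j⟩) hf
      exact ⟨q, o, (List.prefix_append ..).trans hq, by simpa using h⟩
    · obtain ⟨q, o, hq, h⟩ := ih (occ_concat_eq_some.2 ⟨_, h, .fixBody ..⟩) hf
      exact ⟨q, o, (List.prefix_append ..).trans hq, by simpa using h⟩

theorem kept_of_occurs (hD : D.IsDerivation) {p : Pos} {o : Occ s} (h : D.occ p = some o)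
    {f : Fin o.consts} (hf : o.term.Occurs f) : D.Kept p (o.origin f).1 := by
  obtain ⟨q, x, hpq, hx, hl⟩ := exists_assumption_of_occurs o.deriv (h.trans rfl) hf
  intro c hc r y hy hbr hrp
  exact (hD q x _ _ c hx hl hc).2 r y hy hbr (hrp.trans hpq)

/-- The constants that are needed at an occurrence: those in its formula, and those in
the bindings for needed constants. -/
inductive Needed (D : ProofTree s 0 0 L) (o : Occ s) : Fin o.consts → Prop
  | occurs {f : Fin o.consts} : o.term.Occurs f → Needed D o f
  | binding {f : Fin o.consts} {c o' : Occ s} (hi : D.Introduces o f c o') {g : Fin o'.consts} :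
      Needed D o f → o'.term.Occurs g → Needed D o (Fin.castLE hi.le g)

theorem Needed.kept (hD : D.IsDerivation) {p : Pos} {o : Occ s} (h : D.occ p = some o)
    {f : Fin o.consts} (hf : D.Needed o f) : D.Kept p (o.origin f).1 := by
  induction hf with
  | occurs hf => exact kept_of_occurs hD h hf
  | @binding f c o' hi g _ hg ih =>
    have hk := kept_of_occurs hD hi.occ_premise hg
    obtain ⟨c', o'', hi'⟩ := exists_introduces hi.occ_premise g
    rw [hi.origin_eq]
    have hp := pos_of_occ hi.occ_premise
    have hb : (o'.origin g).1 <+: (o.origin f).1 := by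
      have h₁ := hi'.isPrefix
      have h₂ := hi'.ne
      rw [hp, Occ.source] at h₁ h₂
      rcases List.prefix_concat_iff.1 h₁ with h₁ | h₁
      · exact absurd h₁ h₂
      · exact h₁
    refine Kept.trans hi.occ_conclusion ih hb ?_ (hk.of_prefix (List.prefix_append ..))
    have := hi.isPrefix
    rwa [pos_of_occ h] at this

/-- What is needed at the source of the binding for a needed constant is needed. -/
theorem Needed.of_source {p : Pos} {o o' c : Occ s} (h : D.occ p = some o)
    {f : Fin o.consts} (hi : D.Introduces o f c o') (hf : D.Needed o f) {g : Fin o'.consts}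
    (hg : D.Needed o' g) :
    D.Needed o (Fin.castLE hi.le g) := by
  induction hg with
  | occurs hg => exact .binding hi hf hg
  | @binding g c' o'' hi' g' _ hg ih =>
    have e := hi.origin_eq g
    obtain ⟨c₁, o₁, hi₁⟩ := exists_introduces h (Fin.castLE hi.le g)
    obtain rfl : o₁ = o'' := hi₁.eq_of_occ (by rw [Occ.source, e]; exact hi'.occ_premise)
    exact .binding hi₁ ih hg

end ProofTree

/-! ### Terms that arise from an occurrence -/

/-- The renaming of recursion variables that belongs to a choice of constants. -/
def groupMap {k c : ℕ} (e : Fin k ↪o Fin c) : Fin (0 + k) → Fin c :=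
  fun f => e (Fin.cast (Nat.zero_add k) f)

@[simp] theorem groupMap_natAdd {k c : ℕ} (e : Fin k ↪o Fin c) (j : Fin k) :
    groupMap e (Fin.natAdd 0 j) = e j := by
  unfold groupMap; congr 1; ext; simp

theorem groupMap_injective {k c : ℕ} (e : Fin k ↪o Fin c) : Function.Injective (groupMap e) :=
  fun _ _ h => Fin.cast_injective _ (e.injective h)

theorem groupMap_trans {k k' c : ℕ} (e' : Fin k' ↪o Fin k) (e : Fin k ↪o Fin c) :
    groupMap (e'.trans e) = groupMap e ∘ mapGroup 0 e' := by
  funext f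
  induction f using Fin.addCases with
  | left f => exact f.elim0
  | right j =>
    simp only [Function.comp_apply, mapGroup_natAdd, groupMap_natAdd]
    rfl

/-- The term `letrec B in P` arises from the occurrence `o`, above some instance of the letrec-rule,
where the binding group `B` consists of the bindings for the constants `e j`. -/
structure Occ.Represents (o : Occ s) {k : ℕ} (e : Fin k ↪o Fin o.consts)
    (B : Fin k → Tm o.len (0 + k)) (P : Tm o.len (0 + k)) : Prop where
  term : P.ren id (groupMap e) = o.term
  binds : ∀ j, o.binds (e j) ((B j).ren id (groupMap e))

theorem Occ.Represents.arises {o : Occ s} (h : o.inFix) {k : ℕ} {e : Fin k ↪o Fin o.consts}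
    {B : Fin k → Tm o.len (0 + k)} {P : Tm o.len (0 + k)} (hr : o.Represents e B P) :
    o.Arises ⟨o.len, .letrec k B P⟩ :=
  Or.inr ⟨h, k, e, B, P, rfl, hr.term, hr.binds⟩

theorem Occ.Arises.represents {o : Occ s} (h : o.inFix) {t : PTerm} (ha : o.Arises t) :
    ∃ (k : ℕ) (e : Fin k ↪o Fin o.consts) (B : Fin k → Tm o.len (0 + k)) (P : Tm o.len (0 + k)),
      t = ⟨o.len, .letrec k B P⟩ ∧ o.Represents e B P := by
  rcases ha with ⟨h', -⟩ | ⟨-, k, e, B, P, rfl, h₁, h₂⟩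
  · exact absurd h h'
  · exact ⟨k, e, B, P, rfl, h₁, h₂⟩

theorem Occ.Arises.plain {o : Occ s} (h : ¬ o.inFix) {t : PTerm} (ha : o.Arises t) :
    ∃ u : Tm o.len 0, t = ⟨o.len, u⟩ ∧ u.ren id Fin.elim0 = o.term := by
  rcases ha with ⟨-, h'⟩ | ⟨h', -⟩
  · exact h'
  · exact absurd h' h

theorem Occ.Represents.restrict {o : Occ s} {k k' : ℕ} {e : Fin k ↪o Fin o.consts}
    {B : Fin k → Tm o.len (0 + k)} {P : Tm o.len (0 + k)} (hr : o.Represents e B P)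
    (e' : Fin k' ↪o Fin k) {B' : Fin k' → Tm o.len (0 + k')} {P' : Tm o.len (0 + k')}
    (hB : ∀ i, (B' i).ren id (mapGroup 0 e') = B (e' i)) (hP : P'.ren id (mapGroup 0 e') = P) :
    o.Represents (e'.trans e) B' P' := by
  constructor
  · rw [← hr.term, ← hP, Tm.ren_ren, groupMap_trans]; rfl
  · intro i
    have := hr.binds (e' i)
    rw [← hB, Tm.ren_ren] at this
    rw [groupMap_trans]
    exact this

theorem Occ.last_eq_lam {o : Occ s} (h : o.last = .lam) :
    ∃ (p : Pos) (n m : ℕ) (t : Tm (n + 1) m) (d : ProofTree s (n + 1) m t)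
      (org : Fin m → Pos × ℕ) (bd : Fin m → Tm n m → Prop) (b : Prop),
      o = ⟨p, n, m, .lam t, .lam d, org, bd, b⟩ := by
  obtain ⟨p, n, m, t, d, org, bd, b⟩ := o
  cases d with
  | lam d => exact ⟨_, _, _, _, d, _, _, _, rfl⟩
  | _ => simp [Occ.last] at h

theorem Occ.last_eq_app {o : Occ s} (h : o.last = .app) :
    ∃ (p : Pos) (n m : ℕ) (t u : Tm n m) (d : ProofTree s n m t) (d' : ProofTree s n m u)
      (org : Fin m → Pos × ℕ) (bd : Fin m → Tm n m → Prop) (b : Prop),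
      o = ⟨p, n, m, .app t u, .app d d', org, bd, b⟩ := by
  obtain ⟨p, n, m, t, d, org, bd, b⟩ := o
  cases d with
  | app d d' => exact ⟨_, _, _, _, _, d, d', _, _, _, rfl⟩
  | _ => simp [Occ.last] at h

theorem Occ.last_eq_vac {o : Occ s} {i : ℕ} (h : o.last = .vac i) :
    ∃ (p : Pos) (n m : ℕ) (i' : Fin (n + 1)) (t : Tm n m) (hr : s.Removable i')
      (d : ProofTree s n m t)
      (org : Fin m → Pos × ℕ) (bd : Fin m → Tm (n + 1) m → Prop) (b : Prop), (i' : ℕ) = i ∧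
      o = ⟨p, n + 1, m, t.ren i'.succAbove id, .vac i' hr rfl d, org, bd, b⟩ := by
  obtain ⟨p, n, m, t, d, org, bd, b⟩ := o
  cases d with
  | vac i' hr ht d =>
    subst ht
    exact ⟨_, _, _, i', _, hr, d, _, _, _, by simpa [Occ.last] using h, rfl⟩
  | _ => simp [Occ.last] at h

theorem Occ.last_eq_fix {o : Occ s} {k : ℕ} (h : o.last = .fix k) :
    ∃ (p : Pos) (n m : ℕ) (B : Fin k → Tm n (m + k)) (t : Tm n (m + k))
      (dB : ∀ j, ProofTree s n (m + k) (B j)) (d : ProofTree s n (m + k) t)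
      (org : Fin m → Pos × ℕ) (bd : Fin m → Tm n m → Prop) (b : Prop),
      o = ⟨p, n, m, .letrec k B t, .fix dB d, org, bd, b⟩ := by
  obtain ⟨p, n, m, t, d, org, bd, b⟩ := o
  cases d with
  | @fix _ _ k' B t dB d =>
    obtain rfl : k' = k := by simpa [Occ.last] using h
    exact ⟨_, _, _, _, _, dB, d, _, _, _, rfl⟩
  | _ => simp [Occ.last] at h

theorem Occ.last_eq_assumption {o : Occ s} {b' : Pos} {j : ℕ} (h : o.last = .assumption b' j) :
    ∃ f : Fin o.consts, o.term = .rvar f ∧ o.origin f = (b', j) := by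
  obtain ⟨p, n, m, t, d, org, bd, b⟩ := o
  cases d with
  | assumption f =>
    simp [Occ.last] at h
    exact ⟨f, rfl, Prod.ext h.1 h.2⟩
  | _ => simp [Occ.last] at h

theorem Occ.last_eq_ax {o : Occ s} (h : o.last = .ax) :
    ∃ x : Fin o.len, o.term = .var x ∧ s.IsAxiom x := by
  obtain ⟨p, n, m, t, d, org, bd, b⟩ := o
  cases d with
  | ax x hx => exact ⟨x, rfl, hx⟩
  | _ => simp [Occ.last] at h

namespace ProofTree

variable {L : Tm 0 0} {D : ProofTree s 0 0 L}

theorem needed_of_reachable (hD : D.IsDerivation) {p : Pos} {o : Occ s} (h : D.occ p = some o)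
    {k : ℕ} {e : Fin k ↪o Fin o.consts} {B : Fin k → Tm o.len (0 + k)} {P : Tm o.len (0 + k)}
    (hr : o.Represents e B P) {j : Fin k} (hj : Reachable B P j) : D.Needed o (e j) := by
  induction hj with
  | @body j hj =>
    refine .occurs ?_
    rw [← hr.term, Tm.occurs_ren]
    exact ⟨_, groupMap_natAdd e j, hj⟩
  | @bind i j hi hj ih =>
    obtain ⟨c, o', hI⟩ := exists_introduces h (e i)
    obtain ⟨h₁, h₂, hb⟩ := binds_iff h hI.occ_premise (ih.kept hD h)
    have hu := (hb _).1 (hr.binds i)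
    have : ((B i).ren id (groupMap e)).Occurs (e j) :=
      (Tm.occurs_ren _).2 ⟨_, groupMap_natAdd e j, hj⟩
    rw [hu, Tm.occurs_ren] at this
    obtain ⟨g, hg, hg'⟩ := this
    rw [← hg]
    exact .binding hI ih hg'

/-- The side condition on discharged assumptions makes it possible to remove a vacuous binding of
the prefix after the removal of the unreachable bindings of the binding group. -/
theorem not_varOccurs_of_reachable (hD : D.IsDerivation) {p : Pos} {o : Occ s}
    (h : D.occ p = some o) {i : ℕ} (hl : o.last = .vac i)
    {k : ℕ} {e : Fin k ↪o Fin o.consts} {B : Fin k → Tm o.len (0 + k)} {P : Tm o.len (0 + k)}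
    (hr : o.Represents e B P) {j : Fin k} (hj : Reachable B P j) {x : Fin o.len}
    (hx : (B j).VarOccurs x) : (x : ℕ) < i := by
  obtain ⟨c, o', hI⟩ := exists_introduces h (e j)
  have hk := (needed_of_reachable hD h hr hj).kept hD h
  obtain ⟨h₁, h₂, hb⟩ := binds_iff h hI.occ_premise hk
  have hu := (hb _).1 (hr.binds j)
  have : ((B j).ren id (groupMap e)).VarOccurs x := (Tm.varOccurs_ren _).2 ⟨x, rfl, hx⟩
  rw [hu, Tm.varOccurs_ren] at this
  obtain ⟨y, rfl, -⟩ := this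
  have hpre := hI.isPrefix
  rw [pos_of_occ h] at hpre
  have := (hk c hI.occ_conclusion p o h hpre (List.prefix_refl _)).2 i hl
  have hy := y.isLt
  have := hI.len_eq
  simp only [Fin.val_castLE]
  omega

/-- After the unfolding of a recursion variable that stands for the constant `f`, the bindings
that remain reachable belong to constants that are known at the source of the binding for `f`. -/
theorem needed_source_of_reachable (hD : D.IsDerivation) {p : Pos} {o o' c : Occ s}
    (h : D.occ p = some o) {f : Fin o.consts} (hf : D.Needed o f) (hI : D.Introduces o f c o')
    {k : ℕ} {e : Fin k ↪o Fin o.consts} {B : Fin k → Tm o.len (0 + k)}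
    (hB : ∀ j, o.binds (e j) ((B j).ren id (groupMap e))) {i : Fin k} (hi : e i = f)
    {j : Fin k} (hj : Reachable B (B i) j) :
    ∃ g, D.Needed o' g ∧ Fin.castLE hI.le g = e j := by
  have step : ∀ (i j : Fin k) (o'' : Occ s), D.Needed o (e i) →
      D.occ (o.source (e i)) = some o'' →
      (B i).Occurs (Fin.natAdd 0 j) → ∃ g, o''.term.Occurs g ∧ (g : ℕ) = e j := by
    intro i j o'' hn ho hj
    obtain ⟨h₁, h₂, hb⟩ := binds_iff h ho (hn.kept hD h)
    have hu := (hb _).1 (hB i)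
    have : ((B i).ren id (groupMap e)).Occurs (e j) :=
      (Tm.occurs_ren _).2 ⟨_, groupMap_natAdd e j, hj⟩
    rw [hu, Tm.occurs_ren] at this
    obtain ⟨g, hg, hg'⟩ := this
    exact ⟨g, hg', by rw [← hg]; rfl⟩
  induction hj with
  | @body j hj =>
    subst hi
    obtain ⟨g, hg, hgj⟩ := step i j o' hf hI.occ_premise hj
    exact ⟨g, .occurs hg, Fin.ext hgj⟩
  | @bind i' j hi' hj ih =>
    obtain ⟨g, hg, hgj⟩ := ih
    have hgo := hI.origin_eq g
    obtain ⟨c', o'', hI'⟩ := exists_introduces hI.occ_premise g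
    obtain ⟨g', hg', hgj'⟩ := step i' j o'' (hgj ▸ hf.of_source h hI hg)
      (by rw [Occ.source, ← hgj, hgo]; exact hI'.occ_premise) hj
    exact ⟨_, .binding hI' hg hg', Fin.ext hgj'⟩

end ProofTree

/-! ### Following a step of an access path -/

/-- The choice of constants after merging an inner binding group. -/
def groupExtend {k c : ℕ} (e : Fin k ↪o Fin c) (l : ℕ) : Fin (k + l) ↪o Fin (c + l) :=
  OrderEmbedding.ofStrictMono
    (Fin.addCases (fun j => Fin.castAdd l (e j)) (fun j => Fin.natAdd c j)) (by
      intro x y hxy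
      induction x using Fin.addCases with
      | left x =>
        induction y using Fin.addCases with
        | left y =>
          simp only [Fin.addCases_left]
          exact e.strictMono (show x < y from hxy)
        | right y =>
          simp only [Fin.addCases_left, Fin.addCases_right, Fin.lt_def, Fin.val_castAdd,
            Fin.val_natAdd]
          have := (e x).isLt
          omega
      | right x =>
        induction y using Fin.addCases with
        | left y =>
          have : k + (x : ℕ) < y := hxy
          omega
        | right y =>
          have : k + (x : ℕ) < k + y := hxy
          simp only [Fin.addCases_right, Fin.lt_def, Fin.val_natAdd]
          omega)

@[simp] theorem groupExtend_castAdd {k c : ℕ} (e : Fin k ↪o Fin c) (l : ℕ) (j : Fin k) :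
    groupExtend e l (Fin.castAdd l j) = Fin.castAdd l (e j) := by
  change Fin.addCases (motive := fun _ => Fin (c + l)) (fun j => Fin.castAdd l (e j))
    (fun j => Fin.natAdd c j) (Fin.castAdd l j) = _
  rw [Fin.addCases_left]

@[simp] theorem groupExtend_natAdd {k c : ℕ} (e : Fin k ↪o Fin c) (l : ℕ) (j : Fin l) :
    groupExtend e l (Fin.natAdd k j) = Fin.natAdd c j := by
  change Fin.addCases (motive := fun _ => Fin (c + l)) (fun j => Fin.castAdd l (e j))
    (fun j => Fin.natAdd c j) (Fin.natAdd k j) = _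
  rw [Fin.addCases_right]

theorem groupMap_groupExtend_cast {k c : ℕ} (e : Fin k ↪o Fin c) (l : ℕ) :
    groupMap (groupExtend e l) ∘ Fin.cast (Nat.add_assoc 0 k l) = liftRec (groupMap e) l := by
  funext f
  induction f using Fin.addCases with
  | left f =>
    induction f using Fin.addCases with
    | left f => exact f.elim0
    | right j =>
      rw [liftRec_castAdd, groupMap_natAdd, ← groupExtend_castAdd]
      rw [Function.comp_apply, groupMap]
      congr 1; ext; simp
  | right j =>
    rw [liftRec_natAdd, ← groupExtend_natAdd e]
    rw [Function.comp_apply, groupMap]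
    congr 1; ext; simp

theorem groupMap_groupExtend_mapGroup {k c : ℕ} (e : Fin k ↪o Fin c) (l : ℕ) :
    groupMap (groupExtend e l) ∘ mapGroup 0 (Fin.castAdd l) = Fin.castAdd l ∘ groupMap e := by
  funext f
  induction f using Fin.addCases with
  | left f => exact f.elim0
  | right j =>
    rw [Function.comp_apply, mapGroup_natAdd, groupMap_natAdd, groupExtend_castAdd,
      Function.comp_apply, groupMap_natAdd]

theorem Occ.arises_mk {p : Pos} {n m : ℕ} {t : Tm n m} {d : ProofTree s n m t}
    {org : Fin m → Pos × ℕ} {bd : Fin m → Tm n m → Prop} {b : Prop} (hb : b) {k : ℕ}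
    (e : Fin k ↪o Fin m) {B : Fin k → Tm n (0 + k)} {P : Tm n (0 + k)}
    (hP : P.ren id (groupMap e) = t) (hB : ∀ j, bd (e j) ((B j).ren id (groupMap e))) :
    Occ.Arises ⟨p, n, m, t, d, org, bd, b⟩ ⟨n, .letrec k B P⟩ :=
  Or.inr ⟨hb, k, e, B, P, rfl, hP, hB⟩

namespace ProofTree

variable {L : Tm 0 0} {D : ProofTree s 0 0 L}

theorem exists_pass_lam {p : Pos} {o : Occ s} (h : D.occ p = some o) {t : PTerm}
    (ha : o.Arises t) (hl : o.last = .lam) :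
    ∃ σ o', D.PassSteps p .lam t σ ∧ D.occ (p ++ [0]) = some o' ∧ o'.Arises (target t σ) := by
  obtain ⟨p', n, m, t₀, d, org, bd, b, rfl⟩ := Occ.last_eq_lam hl
  have h' := occ_concat_eq_some.2 ⟨_, h, .lam ..⟩
  by_cases hb : b
  · obtain ⟨k, e, B, P, rfl, hr⟩ := ha.represents hb
    obtain ⟨hP, hB⟩ := hr
    cases P <;> simp only [Tm.ren, reduceCtorEq, Tm.lam.injEq, liftVar_id] at hP
    rename_i P
    refine ⟨_, _, .lamUnf ((inFix_iff h).2 hb) (.unfLam B P) (.lam _), h',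
      Occ.arises_mk hb e hP fun j => ?_⟩
    refine ⟨_, hB j, ?_⟩
    simp only [Tm.ren_ren]
    rfl
  · obtain ⟨u, rfl, hu⟩ := ha.plain hb
    cases u <;> simp only [Tm.ren, reduceCtorEq, Tm.lam.injEq, liftVar_id] at hu
    exact ⟨_, _, .lam (mt (inFix_iff h).1 hb) (.lam _), h', Or.inl ⟨hb, _, rfl, hu⟩⟩

theorem exists_pass_app {p : Pos} {o : Occ s} (h : D.occ p = some o) {t : PTerm}
    (ha : o.Arises t) (hl : o.last = .app) :
    (∃ σ o', D.PassSteps p .appL t σ ∧ D.occ (p ++ [0]) = some o' ∧ o'.Arises (target t σ)) ∧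
    (∃ σ o', D.PassSteps p .appR t σ ∧ D.occ (p ++ [1]) = some o' ∧ o'.Arises (target t σ)) := by
  obtain ⟨p', n, m, t₀, u₀, d, d', org, bd, b, rfl⟩ := Occ.last_eq_app hl
  have h₀ := occ_concat_eq_some.2 ⟨_, h, .appL ..⟩
  have h₁ := occ_concat_eq_some.2 ⟨_, h, .appR ..⟩
  by_cases hb : b
  · obtain ⟨k, e, B, P, rfl, hr⟩ := ha.represents hb
    obtain ⟨hP, hB⟩ := hr
    cases P <;> simp only [Tm.ren, reduceCtorEq, Tm.app.injEq] at hP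
    exact ⟨⟨_, _, .appLUnf ((inFix_iff h).2 hb) (.unfApp B _ _) (.appL _ _), h₀,
        Occ.arises_mk hb e hP.1 hB⟩,
      ⟨_, _, .appRUnf ((inFix_iff h).2 hb) (.unfApp B _ _) (.appR _ _), h₁,
        Occ.arises_mk hb e hP.2 hB⟩⟩
  · obtain ⟨u, rfl, hu⟩ := ha.plain hb
    cases u <;> simp only [Tm.ren, reduceCtorEq, Tm.app.injEq] at hu
    exact ⟨⟨_, _, .appL (mt (inFix_iff h).1 hb) (.appL _ _), h₀, Or.inl ⟨hb, _, rfl, hu.1⟩⟩,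
      ⟨_, _, .appR (mt (inFix_iff h).1 hb) (.appR _ _), h₁, Or.inl ⟨hb, _, rfl, hu.2⟩⟩⟩

theorem exists_pass_fix {p : Pos} {o : Occ s} (h : D.occ p = some o) {t : PTerm}
    (ha : o.Arises t) {l : ℕ} (hl : o.last = .fix l) :
    ∃ σ o', D.PassSteps p .fix t σ ∧ D.occ (p ++ [l]) = some o' ∧ o'.Arises (target t σ) := by
  obtain ⟨p', n, m, C, t₀, dB, d, org, bd, b, rfl⟩ := Occ.last_eq_fix hl
  have h' := occ_concat_eq_some.2 ⟨_, h, .fixBody ..⟩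
  by_cases hb : b
  · obtain ⟨k, e, B, P, rfl, hr⟩ := ha.represents hb
    obtain ⟨hP, hB⟩ := hr
    cases P <;> simp only [Tm.ren, reduceCtorEq, Tm.letrec.injEq] at hP
    rename_i l' C' P
    obtain ⟨rfl, hC, hP⟩ := hP
    replace hC := eq_of_heq hC
    replace hP := eq_of_heq hP
    refine ⟨_, _, .fixUnf ((inFix_iff h).2 hb) (.unfLetrec B C' P), h',
      Occ.arises_mk trivial (groupExtend e l') ?_ fun j => ?_⟩
    · rw [Tm.ren_ren, groupMap_groupExtend_cast]
      exact hP
    · induction j using Fin.addCases with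
      | left j =>
        simp only [Fin.addCases_left, groupExtend_castAdd, Tm.ren_ren,
          groupMap_groupExtend_mapGroup]
        exact ⟨_, hB j, by rw [Tm.ren_ren]⟩
      | right j =>
        simp only [Fin.addCases_right, groupExtend_natAdd, Tm.ren_ren, groupMap_groupExtend_cast]
        exact congrFun hC j
  · obtain ⟨u, rfl, hu⟩ := ha.plain hb
    cases u <;> simp only [Tm.ren, reduceCtorEq, Tm.letrec.injEq] at hu
    rename_i l' C' P
    obtain ⟨rfl, hC, hP⟩ := hu
    replace hC := eq_of_heq hC
    replace hP := eq_of_heq hP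
    have e : groupMap (Fin.natAddOrderEmb m : Fin l' ↪o Fin (m + l')) = liftRec Fin.elim0 l' := by
      funext f
      induction f using Fin.addCases with
      | left f => exact f.elim0
      | right j => rw [groupMap_natAdd, liftRec_natAdd]; rfl
    refine ⟨_, _, .fix (mt (inFix_iff h).1 hb), h',
      Occ.arises_mk trivial (Fin.natAddOrderEmb m) ?_ fun j => ?_⟩
    · rw [e]; exact hP
    · rw [e]
      simp only [Fin.natAddOrderEmb_apply, Fin.addCases_right]
      exact congrFun hC j

theorem step_compress_of_not_varOccurs {n : ℕ} {i : Fin (n + 1)} (hi : s.Removable i)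
    {u : Tm (n + 1) 0} (hu : ∀ x, u.VarOccurs x → x ≠ i) :
    ∃ v, u = v.ren i.succAbove id ∧ Step s (.compress i) ⟨n + 1, u⟩ ⟨n, v⟩ := by
  obtain ⟨v, rfl⟩ := u.exists_ren (ρ := i.succAbove) (ξ := id)
    (fun x hx => by simpa [Fin.range_succAbove] using hu x hx) (by simp)
  exact ⟨v, rfl, .compress i v hi⟩

theorem exists_pass_vac (hD : D.IsDerivation) {p : Pos} {o : Occ s} (h : D.occ p = some o)
    {t : PTerm} (ha : o.Arises t) {i : ℕ} (hl : o.last = .vac i) :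
    ∃ σ o', D.PassSteps p (.vac i) t σ ∧ D.occ (p ++ [0]) = some o' ∧
      o'.Arises (target t σ) := by
  have hl' := hl
  obtain ⟨p', n, m, i, t₀, hi, d, org, bd, b, rfl, rfl⟩ := Occ.last_eq_vac hl
  have h' := occ_concat_eq_some.2 ⟨_, h, .vac ..⟩
  have inj := Fin.succAbove_right_injective (p := i)
  by_cases hb : b
  · -- A compression step leads to a term that arises from the premise.
    have key : ∀ (k : ℕ) (e : Fin k ↪o Fin m) (B : Fin k → Tm (n + 1) (0 + k))
        (P : Tm (n + 1) (0 + k)), Occ.Represents ⟨p', n + 1, m, t₀.ren i.succAbove id,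
          .vac i hi rfl d, org, bd, b⟩ e B P → ∀ v, Step s (.compress i)
        ⟨n + 1, .letrec k B P⟩ v → Occ.Arises ⟨p' ++ [0], n, m, t₀, d, org,
          fun f u => bd f (u.ren i.succAbove id), b⟩ v := by
      intro k e B P hr v hv
      obtain ⟨n', i', v, hii, -, ht, rfl⟩ := hv.compress_inv
      rw [PTerm.mk.injEq] at ht
      obtain ⟨hn, ht⟩ := ht
      obtain rfl : n = n' := by omega
      obtain rfl : i' = i := Fin.ext hii
      replace ht := eq_of_heq ht
      cases v <;> simp only [Tm.ren, reduceCtorEq, Tm.letrec.injEq, liftRec_id] at ht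
      rename_i k' B' P'
      obtain ⟨rfl, hB', hP'⟩ := ht
      obtain rfl := eq_of_heq hB'
      obtain rfl := eq_of_heq hP'
      refine Occ.arises_mk hb e ?_ fun j => ?_
      · have := hr.term
        rw [Tm.ren_ren] at this
        refine Tm.ren_injective _ inj Function.injective_id _ ?_
        rw [Tm.ren_ren]
        exact this
      · have := hr.binds j
        rw [Tm.ren_ren] at this
        change bd _ _
        rw [Tm.ren_ren]
        exact this
    obtain ⟨k, e, B, P, rfl, hr⟩ := ha.represents hb
    by_cases hc : ∃ v, Step s (.compress i) ⟨n + 1, .letrec k B P⟩ v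
    · obtain ⟨v, hv⟩ := hc
      exact ⟨_, _, .vac hv, h', key _ _ _ _ hr _ hv⟩
    · obtain ⟨k', e', B', P', he', hB', hP', hred⟩ := exists_reduce s B P
      have hr' := hr.restrict e' hB' hP'
      obtain ⟨v, -, hv⟩ := step_compress_of_not_varOccurs hi (u := .letrec k' B' P') (by
        rintro x (⟨j, hx⟩ | hx) rfl
        · refine (not_varOccurs_of_reachable hD h hl' hr ((he' (e' j)).1 ⟨j, rfl⟩) (x := x) ?_).ne rfl
          rw [← hB', Tm.varOccurs_ren]
          exact ⟨x, rfl, hx⟩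
        · have := (Tm.varOccurs_ren _ (ρ := id) (ξ := groupMap (e'.trans e))).2 ⟨x, rfl, hx⟩
          rw [hr'.term, Tm.varOccurs_ren] at this
          obtain ⟨y, hy, -⟩ := this
          exact Fin.succAbove_ne _ _ hy)
      rcases hred with hred | ⟨-, hred⟩
      · exact ⟨_, _, .vacUnf ((inFix_iff h).2 hb) (by simpa using hc) hred hv, h',
          key _ _ _ _ hr' _ hv⟩
      · rw [hred] at hv
        exact absurd ⟨_, hv⟩ hc
  · obtain ⟨u, rfl, hu⟩ := ha.plain hb
    obtain ⟨v, rfl, hv⟩ := step_compress_of_not_varOccurs hi (u := u) (by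
        rintro x hx rfl
        have := (Tm.varOccurs_ren u (ρ := id) (ξ := (Fin.elim0 : Fin 0 → Fin m))).2 ⟨x, rfl, hx⟩
        rw [hu, Tm.varOccurs_ren] at this
        obtain ⟨y, hy, -⟩ := this
        exact Fin.succAbove_ne _ _ hy)
    refine ⟨_, _, .vac hv, h', Or.inl ⟨hb, v, rfl, ?_⟩⟩
    refine Tm.ren_injective _ inj Function.injective_id _ ?_
    simp only [Tm.ren_ren] at hu ⊢
    rw [← hu]
    congr 1

theorem exists_pass_jump (hD : D.IsDerivation) {p : Pos} {o : Occ s} (h : D.occ p = some o)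
    {t : PTerm} (ha : o.Arises t) {b : Pos} {j : ℕ} (hl : o.last = .assumption b j) :
    ∃ σ o', D.PassSteps p .jump t σ ∧ D.occ (b ++ [j]) = some o' ∧
      o'.Arises (target t σ) := by
  obtain ⟨f, hf, hfo⟩ := Occ.last_eq_assumption hl
  obtain ⟨c, o', hI⟩ := exists_introduces h f
  have ho' := hI.occ_premise
  rw [Occ.source, hfo] at ho'
  have hlen : o.len = o'.len := by
    have := hI.occ_conclusion
    rw [hfo] at this
    rw [(hD p o b j c h hl this).1, hI.len_eq]
  have hn : D.Needed o f := .occurs (by rw [hf]; rfl)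
  by_cases hb : o.inFix
  · obtain ⟨k, e, B, P, rfl, hr⟩ := ha.represents hb
    have hP := hr.term
    rw [hf] at hP
    cases P <;> simp only [Tm.ren, reduceCtorEq, Tm.rvar.injEq] at hP
    rename_i i
    induction i using Fin.addCases with
    | left i => exact i.elim0
    | right i =>
    rw [groupMap_natAdd] at hP
    obtain ⟨k', e', B', P', he', hB', hP', hred⟩ := exists_reduce s B (B i)
    have key : o'.Arises ⟨o.len, .letrec k' B' P'⟩ := by
      have hex : ∀ j, ∃ g, D.Needed o' g ∧ Fin.castLE hI.le g = e (e' j) := fun j =>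
        needed_source_of_reachable hD h hn hI hr.binds hP ((he' _).1 ⟨j, rfl⟩)
      choose g hg hge using hex
      have gmono : StrictMono g := by
        intro x y hxy
        have := e.strictMono (e'.strictMono hxy)
        rw [← hge, ← hge] at this
        exact this
      have hcast : Fin.castLE hI.le ∘ groupMap (OrderEmbedding.ofStrictMono g gmono)
          = groupMap e ∘ mapGroup 0 e' := by
        funext x
        induction x using Fin.addCases with
        | left f => exact f.elim0
        | right j =>
          rw [Function.comp_apply, groupMap_natAdd, Function.comp_apply, mapGroup_natAdd,
            groupMap_natAdd]
          exact hge j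
      -- The formula of a source, seen from `o` and from `o'`.
      have hcastinj : Function.Injective (Fin.castLE hI.le) := Fin.castLE_injective _
      have hbind : ∀ (j : Fin k) (u : Tm o.len o'.consts) (g₀ : Fin o'.consts), D.Needed o' g₀ →
          Fin.castLE hI.le g₀ = e j → u.ren id (Fin.castLE hI.le) = (B j).ren id (groupMap e) →
          o'.binds g₀ (u.ren (Fin.cast hlen) id) := by
        intro j u g₀ hg₀ hgj hu
        obtain ⟨c'', o'', hI''⟩ := exists_introduces hI.occ_premise g₀
        obtain ⟨h₁, h₂, hb₁⟩ := binds_iff hI.occ_premise hI''.occ_premise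
          (hg₀.kept hD hI.occ_premise)
        have hn' := Needed.of_source h hI hn hg₀
        rw [hgj] at hn'
        obtain ⟨h₃, h₄, hb₂⟩ := binds_iff (o' := o'') h (f := e j)
          (by rw [Occ.source, ← hgj, hI.origin_eq]; exact hI''.occ_premise) (hn'.kept hD h)
        have hB := (hb₂ _).1 (hr.binds j)
        rw [← hu] at hB
        rw [hb₁]
        refine Tm.ren_injective _ (Fin.cast_injective hlen.symm) hcastinj _ ?_
        simp only [Tm.ren_ren]
        exact hB
      have hcongr : ∀ (n : ℕ) (hn : o.len = n) (k' : ℕ) (B' : Fin k' → Tm o.len (0 + k'))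
          (P' : Tm o.len (0 + k')), (⟨o.len, .letrec k' B' P'⟩ : PTerm) =
            ⟨n, .letrec k' (fun j => (B' j).ren (Fin.cast hn) id) (P'.ren (Fin.cast hn) id)⟩ := by
        rintro n rfl k' B' P'
        simp
      rw [hcongr _ hlen]
      refine Occ.Represents.arises (e := OrderEmbedding.ofStrictMono g gmono) hI.inFix ⟨?_, fun j => ?_⟩
      · obtain ⟨h₁, h₂, hb₁⟩ := binds_iff h hI.occ_premise (hn.kept hD h)
        have hB := hr.binds i
        rw [hP, hb₁] at hB
        refine Tm.ren_injective _ (Fin.cast_injective hlen.symm) hcastinj _ ?_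
        rw [← hP', Tm.ren_ren, ← hcast] at hB
        simp only [Tm.ren_ren]
        exact hB
      · have := hbind (e' j) ((B' j).ren id (groupMap (OrderEmbedding.ofStrictMono g gmono)))
          (g j) (hg j) (hge j) (by
            rw [← hB', Tm.ren_ren, Tm.ren_ren, hcast])
        rw [Tm.ren_ren] at this ⊢
        exact this
    rcases hred with hred | ⟨hnr, hred⟩
    · exact ⟨_, _, .jumpUnf (.unfRec B i) hred, ho', key⟩
    · rw [hred] at key
      exact ⟨_, _, .jump (.unfRec B i) hnr, ho', key⟩
  · obtain ⟨u, rfl, hu⟩ := ha.plain hb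
    rw [hf] at hu
    cases u <;> simp only [Tm.ren, reduceCtorEq, Tm.rvar.injEq] at hu
    rename_i i
    exact i.elim0

/-- Every step of an access path can be followed by rewriting a term that arises from its start, and
the result arises from its end. -/
theorem exists_pass (hD : D.IsDerivation) {p q : Pos} {κ : Pass} (hacc : D.Access κ p q)
    {o : Occ s} (h : D.occ p = some o) {t : PTerm} (ha : o.Arises t) :
    ∃ σ o', D.PassSteps p κ t σ ∧ D.occ q = some o' ∧ o'.Arises (target t σ) := by
  cases hacc with
  | lam hl => exact exists_pass_lam h ha ((lastAt_iff h).1 hl)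
  | appL hl => exact (exists_pass_app h ha ((lastAt_iff h).1 hl)).1
  | appR hl => exact (exists_pass_app h ha ((lastAt_iff h).1 hl)).2
  | vac hl => exact exists_pass_vac hD h ha ((lastAt_iff h).1 hl)
  | fix hl => exact exists_pass_fix h ha ((lastAt_iff h).1 hl)
  | jump hl => exact exists_pass_jump hD h ha ((lastAt_iff h).1 hl)

end ProofTree

/-! ### Rewrite sequences as codes of access paths -/

theorem target_append (t : PTerm) (τ σ : RSeq) : target t (τ ++ σ) = target (target t τ) σ := by
  induction τ generalizing t with
  | nil => rfl
  | cons x τ ih => exact ih x.2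

theorem isRewriteSeq_append {t : PTerm} {τ σ : RSeq} :
    IsRewriteSeq s t (τ ++ σ) ↔ IsRewriteSeq s t τ ∧ IsRewriteSeq s (target t τ) σ := by
  induction τ generalizing t with
  | nil => simp [IsRewriteSeq, target]
  | cons x τ ih => simp [IsRewriteSeq, target, ih, and_assoc]

theorem isRewriteSeq_middle {t : PTerm} {τ σ : RSeq} {x : Rule × PTerm}
    (h : IsRewriteSeq s t (τ ++ x :: σ)) : Step s x.1 (target t τ) x.2 :=
  (isRewriteSeq_append.1 h).2.1

namespace ProofTree

variable {L : Tm 0 0} {D : ProofTree s 0 0 L}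

theorem LastAt.unique {p : Pos} {r r' : Last} (h : D.LastAt p r) (h' : D.LastAt p r') : r = r' := by
  obtain ⟨o, ho, rfl⟩ := h
  exact (lastAt_iff ho).1 h'

theorem PassSteps.isRewriteSeq {p : Pos} {κ : Pass} {t : PTerm} {σ : RSeq}
    (h : D.PassSteps p κ t σ) : IsRewriteSeq s t σ := by
  cases h <;> simp_all [IsRewriteSeq]

theorem PassSteps.unique {p : Pos} {κ : Pass} {t : PTerm} {σ σ' : RSeq}
    (h : D.PassSteps p κ t σ) (h' : D.PassSteps p κ t σ') : σ = σ' := by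
  cases h with
  | fix h => cases h' with
    | fix => rfl
    | fixUnf h' => exact absurd h' h
  | fixUnf h h₁ => cases h' with
    | fix h' => exact absurd h h'
    | fixUnf _ h₁' => rw [h₁.unique h₁']
  | appL h h₁ => cases h' with
    | appL _ h₁' => rw [h₁.unique h₁']
    | appLUnf h' => exact absurd h' h
  | appLUnf h h₁ h₂ => cases h' with
    | appL h' => exact absurd h h'
    | appLUnf _ h₁' h₂' => obtain rfl := h₁.unique h₁'; rw [h₂.unique h₂']
  | appR h h₁ => cases h' with
    | appR _ h₁' => rw [h₁.unique h₁']
    | appRUnf h' => exact absurd h' h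
  | appRUnf h h₁ h₂ => cases h' with
    | appR h' => exact absurd h h'
    | appRUnf _ h₁' h₂' => obtain rfl := h₁.unique h₁'; rw [h₂.unique h₂']
  | lam h h₁ => cases h' with
    | lam _ h₁' => rw [h₁.unique h₁']
    | lamUnf h' => exact absurd h' h
  | lamUnf h h₁ h₂ => cases h' with
    | lam h' => exact absurd h h'
    | lamUnf _ h₁' h₂' => obtain rfl := h₁.unique h₁'; rw [h₂.unique h₂']
  | vac h₁ => cases h' with
    | vac h₁' => rw [h₁.unique h₁']
    | vacUnf _ h' => exact absurd h₁ (h' _)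
  | vacUnf _ h h₁ h₂ => cases h' with
    | vac h' => exact absurd h' (h _)
    | vacUnf _ _ h₁' h₂' => obtain rfl := h₁.unique h₁'; rw [h₂.unique h₂']
  | jump h₁ h => cases h' with
    | jump h₁' => rw [h₁.unique h₁']
    | jumpUnf h₁' h₂' => obtain rfl := h₁.unique h₁'; exact absurd h₂' (h _)
  | jumpUnf h₁ h₂ => cases h' with
    | jump h₁' h => obtain rfl := h₁.unique h₁'; exact absurd h₂ (h _)
    | jumpUnf h₁' h₂' => obtain rfl := h₁.unique h₁'; rw [h₂.unique h₂']

/-- An access path can only branch at an application. -/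
theorem Access.cases {p q q' : Pos} {κ κ' : Pass} (h : D.Access κ p q) (h' : D.Access κ' p q') :
    (κ = κ' ∧ q = q') ∨ (κ = .appL ∧ κ' = .appR) ∨ (κ = .appR ∧ κ' = .appL) := by
  cases h with
  | lam h => cases h' with
    | lam _ => exact Or.inl ⟨rfl, rfl⟩
    | _ h' => cases h.unique h'
  | appL h => cases h' with
    | appL _ => exact Or.inl ⟨rfl, rfl⟩
    | appR _ => exact Or.inr (Or.inl ⟨rfl, rfl⟩)
    | _ h' => cases h.unique h'
  | appR h => cases h' with
    | appL _ => exact Or.inr (Or.inr ⟨rfl, rfl⟩)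
    | appR _ => exact Or.inl ⟨rfl, rfl⟩
    | _ h' => cases h.unique h'
  | vac h => cases h' with
    | vac h' => cases h.unique h'; exact Or.inl ⟨rfl, rfl⟩
    | _ h' => cases h.unique h'
  | fix h => cases h' with
    | fix h' => cases h.unique h'; exact Or.inl ⟨rfl, rfl⟩
    | _ h' => cases h.unique h'
  | jump h => cases h' with
    | jump h' => cases h.unique h'; exact Or.inl ⟨rfl, rfl⟩
    | _ h' => cases h.unique h'

theorem Access.pass_unique {p q : Pos} {κ κ' : Pass} (h : D.Access κ p q) (h' : D.Access κ' p q) :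
    κ = κ' := by
  have hLR : D.Access .appL p q → D.Access .appR p q → False := by
    intro h h'
    have e : q = p ++ [0] := by cases h; rfl
    have e' : q = p ++ [1] := by cases h'; rfl
    simp [e] at e'
  rcases h.cases h' with h₁ | ⟨rfl, rfl⟩ | ⟨rfl, rfl⟩
  · exact h₁.1
  · exact (hLR h h').elim
  · exact (hLR h' h).elim

theorem Access.not_ax {p q : Pos} {κ : Pass} (h : D.Access κ p q) : ¬ D.LastAt p .ax := by
  intro h'
  cases h with
  | _ h => cases h.unique h'

theorem exists_access {p : Pos} {o : Occ s} (h : D.occ p = some o) :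
    D.LastAt p .ax ∨ ∃ κ q, D.Access κ p q := by
  cases hr : o.last with
  | ax => exact Or.inl ⟨o, h, hr⟩
  | assumption b j => exact Or.inr ⟨_, _, .jump ⟨o, h, hr⟩⟩
  | lam => exact Or.inr ⟨_, _, .lam ⟨o, h, hr⟩⟩
  | app => exact Or.inr ⟨_, _, .appL ⟨o, h, hr⟩⟩
  | vac i => exact Or.inr ⟨_, _, .vac ⟨o, h, hr⟩⟩
  | fix k => exact Or.inr ⟨_, _, .fix ⟨o, h, hr⟩⟩

/-- The codes for the two steps from an application only differ in the last rewrite step. -/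
theorem PassSteps.app {p : Pos} {t : PTerm} {σ σ' : RSeq}
    (h : D.PassSteps p .appL t σ) (h' : D.PassSteps p .appR t σ') :
    ∃ ρ u v, σ = ρ ++ [(.appL, u)] ∧ σ' = ρ ++ [(.appR, v)] ∧
      (ρ = [] ∨ ∃ w, ρ = [(.unfApp, w)]) := by
  cases h with
  | appL h h₁ => cases h' with
    | appR _ h₁' => exact ⟨[], _, _, rfl, rfl, Or.inl rfl⟩
    | appRUnf h' => exact absurd h' h
  | appLUnf h h₁ h₂ => cases h' with
    | appR h' => exact absurd h h'
    | appRUnf _ h₁' h₂' =>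
      obtain rfl := h₁.unique h₁'
      exact ⟨[_], _, _, rfl, rfl, Or.inr ⟨_, rfl⟩⟩

/-- The codes of the steps of access paths form a prefix code. -/
theorem PassSteps.eq_of_prefix {p q q' : Pos} {κ κ' : Pass} {t : PTerm} {σ σ' : RSeq}
    (ha : D.Access κ p q) (ha' : D.Access κ' p q') (h : D.PassSteps p κ t σ)
    (h' : D.PassSteps p κ' t σ') (hσ : σ <+: σ') : κ = κ' ∧ q = q' ∧ σ = σ' := by
  rcases ha.cases ha' with ⟨rfl, rfl⟩ | ⟨rfl, rfl⟩ | ⟨rfl, rfl⟩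
  · exact ⟨rfl, rfl, h.unique h'⟩
  · obtain ⟨ρ, u, v, rfl, rfl, -⟩ := h.app h'
    have := hσ.eq_of_length (by simp)
    simp at this
  · obtain ⟨ρ, u, v, rfl, rfl, -⟩ := h'.app h
    have := hσ.eq_of_length (by simp)
    simp at this

theorem PassSteps.nil {p : Pos} {κ : Pass} {t : PTerm} (h : D.PassSteps p κ t []) :
    κ = .fix ∧ ¬ D.InFix p := by
  cases h with
  | fix h => exact ⟨rfl, h⟩

theorem _root_.LetrecReg.IsPremise.inFix_of_fix {o o' : Occ s} {i k : ℕ} (h : IsPremise o i o')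
    (hl : o.last = .fix k) : o'.inFix := by
  cases h <;> trivial

theorem Access.inFix_of_fix {p q : Pos} (h : D.Access .fix p q) {o : Occ s}
    (ho : D.occ q = some o) : D.InFix q := by
  cases h with
  | fix h =>
    obtain ⟨o₁, ho₁, hl⟩ := h
    obtain ⟨o₁', ho₁', hc⟩ := occ_concat_eq_some.1 ho
    obtain rfl := Option.some.inj (ho₁.symm.trans ho₁')
    exact (inFix_iff ho).2 (hc.inFix_of_fix hl)

/-- `Run D π p τ`: the rewrite sequence `τ` corresponds to the access path `π ++ [p]`. -/
inductive Run (D : ProofTree s 0 0 L) : List Pos → Pos → RSeq → Prop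
  | start : Run D [] [] []
  | step {π : List Pos} {p q : Pos} {κ : Pass} {τ σ : RSeq} {o : Occ s} :
      Run D π p τ → D.Access κ p q → D.PassSteps p κ (target (.ofTm L) τ) σ →
      D.occ q = some o → o.Arises (target (.ofTm L) (τ ++ σ)) → Run D (π ++ [p]) q (τ ++ σ)

theorem corresponds_iff {P : List Pos} {τ : RSeq} :
    D.Corresponds P τ ↔ ∃ π p, P = π ++ [p] ∧ D.Run π p τ := by
  constructor
  · intro h
    induction h with
    | start => exact ⟨[], [], rfl, .start⟩
    | @step π p q κ τ σ o _ hacc hσ ho ha ih =>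
      obtain ⟨π', p', he, hr⟩ := ih
      obtain ⟨rfl, hp⟩ := List.append_inj' he rfl
      obtain rfl : p = p' := by simpa using hp
      exact ⟨π ++ [p], q, by simp, hr.step hacc hσ ho ha⟩
  · rintro ⟨π, p, rfl, h⟩
    induction h with
    | start => exact .start
    | @step π p q κ τ σ o _ hacc hσ ho ha ih =>
      have := ih.step hacc hσ ho ha
      simpa using this

theorem Run.exists_occ {π : List Pos} {p : Pos} {τ : RSeq} (h : D.Run π p τ) :
    ∃ o, D.occ p = some o ∧ o.Arises (target (.ofTm L) τ) := by
  cases h with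
  | start =>
    refine ⟨_, occ_nil, Or.inl ⟨id, L, rfl, ?_⟩⟩
    rw [Subsingleton.elim (Fin.elim0 : Fin 0 → Fin D.root.consts) id]
    exact Tm.ren_id L
  | step _ _ _ ho ha => exact ⟨_, ho, ha⟩

theorem Run.exists_next (hD : D.IsDerivation) {π : List Pos} {p q : Pos} {κ : Pass} {τ : RSeq}
    (h : D.Run π p τ) (hacc : D.Access κ p q) :
    ∃ σ, D.PassSteps p κ (target (.ofTm L) τ) σ ∧ D.Run (π ++ [p]) q (τ ++ σ) := by
  obtain ⟨o, ho, ha⟩ := h.exists_occ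
  obtain ⟨σ, o', hσ, ho', ha'⟩ := exists_pass hD hacc ho ha
  exact ⟨σ, hσ, h.step hacc hσ ho' (by rwa [target_append])⟩

theorem Run.next (hD : D.IsDerivation) {π : List Pos} {p q : Pos} {κ : Pass} {τ σ : RSeq}
    (h : D.Run π p τ) (hacc : D.Access κ p q) (hσ : D.PassSteps p κ (target (.ofTm L) τ) σ) :
    D.Run (π ++ [p]) q (τ ++ σ) := by
  obtain ⟨σ', hσ', hr⟩ := h.exists_next hD hacc
  rwa [hσ.unique hσ']

theorem Run.inv {π : List Pos} {p q : Pos} {τ : RSeq} (h : D.Run (π ++ [p]) q τ) :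
    ∃ κ τ' σ, D.Run π p τ' ∧ D.Access κ p q ∧ D.PassSteps p κ (target (.ofTm L) τ') σ ∧
      τ = τ' ++ σ := by
  generalize hP : π ++ [p] = P at h
  cases h with
  | start => simp at hP
  | @step π' p' q κ τ σ o hr hacc hσ ho ha =>
    obtain ⟨rfl, hp⟩ := List.append_inj' hP rfl
    obtain rfl : p = p' := by simpa using hp
    exact ⟨_, _, _, hr, hacc, hσ, rfl⟩

/-- The rewrite sequence that corresponds to an access path is unique. -/
theorem Run.unique {π : List Pos} {p : Pos} {τ τ' : RSeq} (h : D.Run π p τ) (h' : D.Run π p τ') :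
    τ = τ' := by
  induction h generalizing τ' with
  | start =>
    generalize hP : ([] : List Pos) = P at h'
    cases h' with
    | start => rfl
    | step => simp at hP
  | step _ hacc hσ ho ha ih =>
    obtain ⟨κ', τ₁, σ₁, hr₁, hacc₁, hσ₁, rfl⟩ := h'.inv
    obtain rfl := ih hr₁
    obtain rfl := hacc.pass_unique hacc₁
    rw [hσ.unique hσ₁]

theorem Run.head {π : List Pos} {p : Pos} {τ : RSeq} (h : D.Run π p τ) :
    [([] : Pos)] <+: π ++ [p] := by
  induction h with
  | start => exact List.prefix_refl _
  | step _ _ _ _ _ ih => exact ih.trans (List.prefix_append ..)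

theorem Run.split {π π' : List Pos} {p p' : Pos} {τ' : RSeq} (h : D.Run π' p' τ')
    (hp : π ++ [p] <+: π' ++ [p']) :
    (π = π' ∧ p = p') ∨ ∃ q κ τ σ, D.Run π p τ ∧ D.Access κ p q ∧
      D.PassSteps p κ (target (.ofTm L) τ) σ ∧ τ ++ σ <+: τ' ∧
      π ++ [p] ++ [q] <+: π' ++ [p'] := by
  induction h with
  | start =>
    left
    have := List.prefix_concat_iff.1 hp
    simp only [List.nil_append, List.prefix_nil, List.append_eq_nil_iff, List.cons_ne_self,
      and_false, or_false] at this
    obtain ⟨rfl, he⟩ := List.append_inj' (s₁ := π) (s₂ := []) this rfl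
    exact ⟨rfl, by simpa using he⟩
  | @step π₁ p₁ q₁ κ τ σ o hr hacc hσ ho ha ih =>
    rcases List.prefix_concat_iff.1 hp with he | hpre
    · obtain ⟨rfl, he⟩ := List.append_inj' he rfl
      exact Or.inl ⟨rfl, by simpa using he⟩
    · right
      rcases ih hpre with ⟨rfl, rfl⟩ | ⟨q, κ', τ₂, σ₂, h₁, h₂, h₃, h₄, h₅⟩
      · exact ⟨q₁, κ, τ, σ, hr, hacc, hσ, List.prefix_refl _, List.prefix_refl _⟩
      · exact ⟨q, κ', τ₂, σ₂, h₁, h₂, h₃, h₄.trans (List.prefix_append ..),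
          h₅.trans (List.prefix_append ..)⟩

/-- Unique decoding: a rewrite sequence determines the access path to which it corresponds, up to
a last step at a bottommost instance of the letrec-rule, for which nothing is rewritten. -/
theorem Run.decode {π π' : List Pos} {p p' : Pos} {τ τ' : RSeq} (h : D.Run π p τ)
    (h' : D.Run π' p' τ') (hτ : τ <+: τ') :
    π ++ [p] <+: π' ++ [p'] ∨ (τ = τ' ∧ π = π' ++ [p'] ∧ D.Access .fix p' p ∧ ¬ D.InFix p') := by
  induction h with
  | start => exact Or.inl h'.head
  | @step π₁ p₁ q₁ κ τ₁ σ o hr hacc hσ ho ha ih =>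
    rcases ih ((List.prefix_append ..).trans hτ) with h₁ | ⟨rfl, rfl, hf, hn⟩
    · rcases h'.split h₁ with ⟨rfl, rfl⟩ | ⟨q, κ', τ₂, σ₂, hr₂, hacc₂, hσ₂, hpre, hpre'⟩
      · obtain rfl := hr.unique h'
        obtain rfl : σ = [] := by
          have := hτ.length_le
          simpa using this
        obtain ⟨rfl, hn⟩ := hσ.nil
        exact Or.inr ⟨by simp, rfl, hacc, hn⟩
      · obtain rfl := hr.unique hr₂
        have : q₁ = q := by
          rcases List.prefix_or_prefix_of_prefix hτ hpre with h₂ | h₂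
          · exact (PassSteps.eq_of_prefix hacc hacc₂ hσ hσ₂
              ((List.prefix_append_right_inj _).1 h₂)).2.1
          · exact (PassSteps.eq_of_prefix hacc₂ hacc hσ₂ hσ
              ((List.prefix_append_right_inj _).1 h₂)).2.1.symm
        subst this
        exact Or.inl hpre'
    · obtain rfl : σ = [] := by
        have := hτ.length_le
        simpa using this
      obtain ⟨o₁, ho₁, -⟩ := hr.exists_occ
      exact absurd (hf.inFix_of_fix ho₁) hσ.nil.2

end ProofTree

/-! ### Prefixed terms at axioms -/

/-- A prefixed variable that is an axiom, possibly below one letrec. -/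
def AxForm (s : Sys) (t : PTerm) : Prop :=
  ∃ (n : ℕ) (x : Fin n), s.IsAxiom x ∧
    (t = ⟨n, .var x⟩ ∨ ∃ (k : ℕ) (B : Fin k → Tm n (0 + k)), t = ⟨n, .letrec k B (.var x)⟩)

/-- The rules that are used at axioms. -/
def Rule.IsCleanup : Rule → Prop
  | .unfReduce | .unfNil => True
  | _ => False

theorem Rule.isCleanup_iff {r : Rule} : r.IsCleanup ↔ r = .unfReduce ∨ r = .unfNil := by
  cases r <;> simp [Rule.IsCleanup]

theorem AxForm.step {r : Rule} {t u : PTerm} (h : AxForm s t) (hs : Step s r t u)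
    (hr : r.IsCleanup) : AxForm s u := by
  obtain ⟨n, x, hx, rfl | ⟨k, B, rfl⟩⟩ := h
  · rcases Rule.isCleanup_iff.1 hr with rfl | rfl <;> cases hs
  · rcases Rule.isCleanup_iff.1 hr with rfl | rfl
    · cases hs with
      | unfReduce _ _ e B' t' hk he hB ht =>
        cases t' <;> simp only [Tm.ren, reduceCtorEq, Tm.var.injEq, id] at ht
        subst ht
        exact ⟨n, _, hx, Or.inr ⟨_, _, rfl⟩⟩
    · cases hs with
      | unfNil => exact ⟨n, _, hx, Or.inl rfl⟩

theorem AxForm.of_isRewriteSeq {t : PTerm} {σ : RSeq} (h : AxForm s t) (hs : IsRewriteSeq s t σ)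
    (hσ : ∀ x ∈ σ, x.1.IsCleanup) : AxForm s (target t σ) := by
  induction σ generalizing t with
  | nil => exact h
  | cons x σ ih =>
    exact ih (h.step hs.1 (hσ x (by simp))) hs.2 (fun y hy => hσ y (by simp [hy]))

theorem AxForm.unique {r r' : Rule} {t u u' : PTerm} (hs : Step s r t u)
    (hs' : Step s r' t u') (hr : r.IsCleanup) (hr' : r'.IsCleanup) : r = r' := by
  have key : Step s .unfReduce t u → Step s .unfNil t u' → False := by
    intro h h'
    obtain ⟨n, k, k', B, v, e, B', v', hk, -, -, -, rfl, rfl⟩ := h.unfReduce_inv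
    cases h'
    omega
  have key' : Step s .unfNil t u → Step s .unfReduce t u' → False := by
    intro h' h
    obtain ⟨n, k, k', B, v, e, B', v', hk, -, -, -, rfl, rfl⟩ := h.unfReduce_inv
    cases h'
    omega
  rcases Rule.isCleanup_iff.1 hr with rfl | rfl <;> rcases Rule.isCleanup_iff.1 hr' with rfl | rfl
  · rfl
  · exact (key hs hs').elim
  · exact (key' hs hs').elim
  · rfl

theorem not_reachable_var {n m k : ℕ} {B : Fin k → Tm n (m + k)} {x : Fin n} {j : Fin k} :
    ¬ Reachable B (.var x) j := by
  intro h
  induction h with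
  | body h => exact h
  | bind _ _ ih => exact ih

/-- The only normal forms are axioms without a letrec. -/
theorem AxForm.exists_step {r : Rule} {t u : PTerm} (h : AxForm s t) (hs : Step s r t u) :
    ∃ r' u', r'.IsCleanup ∧ Step s r' t u' := by
  obtain ⟨n, x, hx, rfl | ⟨k, B, rfl⟩⟩ := h
  · exfalso
    cases r with
    | compress i =>
      obtain ⟨n', i', v, hi, hrem, ht, rfl⟩ := hs.compress_inv
      rw [PTerm.mk.injEq] at ht
      obtain ⟨rfl, ht⟩ := ht
      replace ht := eq_of_heq ht
      cases v <;> simp only [Tm.ren, reduceCtorEq, Tm.var.injEq] at ht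
      rename_i y
      cases s with
      | basic =>
        have : n' + 1 = 1 := hx
        have := y.isLt
        omega
      | plus =>
        have hx : (x : ℕ) + 1 = n' + 1 := hx
        have hrem : i' = Fin.last n' := hrem
        subst hrem
        rw [Fin.succAbove_last] at ht
        have := y.isLt
        rw [ht] at hx
        simp at hx
        omega
    | _ => cases hs
  · obtain ⟨k', e, B', t', he, -, -, hred⟩ := exists_reduce s B (.var x)
    rcases hred with hred | ⟨-, hred⟩
    · exact ⟨.unfReduce, _, trivial, hred⟩
    · obtain rfl : k' = k := by
        rw [PTerm.mk.injEq] at hred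
        have := eq_of_heq hred.2
        rw [Tm.letrec.injEq] at this
        exact this.1
      obtain rfl : k' = 0 := by
        by_contra h0
        exact not_reachable_var ((he _).1 ⟨⟨0, Nat.pos_of_ne_zero h0⟩, rfl⟩)
      exact ⟨.unfNil, _, trivial, .unfNil B (.var x)⟩

namespace ProofTree

variable {L : Tm 0 0} {D : ProofTree s 0 0 L}

theorem axForm_of_arises {p : Pos} {o : Occ s} (h : D.occ p = some o) (hl : D.LastAt p .ax)
    {t : PTerm} (ha : o.Arises t) : AxForm s t := by
  obtain ⟨x, hx, hax⟩ := Occ.last_eq_ax ((lastAt_iff h).1 hl)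
  by_cases hb : o.inFix
  · obtain ⟨k, e, B, P, rfl, hr⟩ := ha.represents hb
    have := hr.term
    rw [hx] at this
    cases P <;> simp only [Tm.ren, reduceCtorEq, Tm.var.injEq, id] at this
    subst this
    exact ⟨_, _, hax, Or.inr ⟨_, _, rfl⟩⟩
  · obtain ⟨u, rfl, hu⟩ := ha.plain hb
    rw [hx] at hu
    cases u <;> simp only [Tm.ren, reduceCtorEq, Tm.var.injEq, id] at hu
    subst hu
    exact ⟨_, _, hax, Or.inl rfl⟩

/-! ### The strategy of a derivation -/

/-- The state that the rewrite sequence `l` has reached: `τ` corresponds to an access path to `p`,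
and `σ` is an initial part of the code of one more step. A last step with an empty code
is included in the access path. -/
def At (D : ProofTree s 0 0 L) (l : RSeq) (p : Pos) (τ σ : RSeq) : Prop :=
  l = τ ++ σ ∧ ∃ π, D.Run π p τ ∧
    ((σ = [] ∧ ∀ κ q, D.Access κ p q → ¬ D.PassSteps p κ (target (.ofTm L) τ) []) ∨
      D.PartialSteps p (target (.ofTm L) τ) σ)

theorem At.eq_of_prefix {l : RSeq} {p p' : Pos} {τ τ' σ σ' : RSeq} (h : D.At l p τ σ)
    (h' : D.At l p' τ' σ') (hτ : τ <+: τ') : p = p' ∧ τ = τ' ∧ σ = σ' := by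
  obtain ⟨rfl, π, hr, hσ⟩ := h
  obtain ⟨hl, π', hr', hσ'⟩ := h'
  rcases hr.decode hr' hτ with hpre | ⟨rfl, -, hf, hn⟩
  · rcases hr'.split hpre with ⟨rfl, rfl⟩ | ⟨q₁, κ₁, τ₁, σ₁, hr₁, hacc₁, hσ₁, hpre₁, -⟩
    · obtain rfl := hr.unique hr'
      exact ⟨rfl, rfl, by simpa using hl⟩
    · exfalso
      obtain rfl := hr.unique hr₁
      have hpre₂ : σ₁ <+: σ := by
        refine (List.prefix_append_right_inj τ).1 (hpre₁.trans ?_)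
        rw [hl]
        exact List.prefix_append ..
      rcases hσ with ⟨rfl, hne⟩ | ⟨-, ⟨κ, q, ρ, hacc, hρ, hc⟩ | ⟨hax, -⟩⟩
      · obtain rfl := List.prefix_nil.1 hpre₂
        exact hne _ _ hacc₁ hσ₁
      · obtain ⟨-, -, rfl⟩ := hσ₁.eq_of_prefix hacc₁ hacc hc (hpre₂.trans (List.prefix_append ..))
        have := hpre₂.length_le
        simp at this
        exact hρ this
      · exact hacc₁.not_ax hax
  · exfalso
    rcases hσ' with ⟨-, hne⟩ | ⟨hne, ⟨κ', q, ρ, hacc, hρ, hc⟩ | ⟨hax, -⟩⟩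
    · exact hne _ _ hf (.fix hn)
    · obtain ⟨-, -, he⟩ := PassSteps.eq_of_prefix hf hacc (.fix hn) hc (List.nil_prefix)
      simp [hne] at he
    · exact hf.not_ax hax

theorem At.unique {l : RSeq} {p p' : Pos} {τ τ' σ σ' : RSeq} (h : D.At l p τ σ)
    (h' : D.At l p' τ' σ') : p = p' ∧ τ = τ' ∧ σ = σ' := by
  have h₁ : τ <+: l := h.1 ▸ List.prefix_append ..
  have h₂ : τ' <+: l := h'.1 ▸ List.prefix_append ..
  rcases List.prefix_or_prefix_of_prefix h₁ h₂ with h₃ | h₃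
  · exact h.eq_of_prefix h' h₃
  · obtain ⟨rfl, rfl, rfl⟩ := h'.eq_of_prefix h h₃
    exact ⟨rfl, rfl, rfl⟩

/-- The rewrite sequence corresponds, possibly partially, to an access path. -/
def Good (D : ProofTree s 0 0 L) (l : RSeq) : Prop := ∃ p τ σ, D.At l p τ σ

/-- The steps by which the strategy of the derivation continues the rewrite sequence `l`. -/
def Next (D : ProofTree s 0 0 L) (l : RSeq) (x : Rule × PTerm) : Prop :=
  ∃ p τ σ, D.At l p τ σ ∧
    ((∃ κ q ρ, D.Access κ p q ∧ D.PassSteps p κ (target (.ofTm L) τ) (σ ++ x :: ρ)) ∨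
      (D.LastAt p .ax ∧ IsRewriteSeq s (target (.ofTm L) τ) (σ ++ [x]) ∧
        ∀ y ∈ σ ++ [x], y.1.IsCleanup))

theorem Run.good (hD : D.IsDerivation) {π : List Pos} {p : Pos} {τ : RSeq} (h : D.Run π p τ) :
    D.Good τ := by
  by_cases hc : ∃ κ q, D.Access κ p q ∧ D.PassSteps p κ (target (.ofTm L) τ) []
  · obtain ⟨κ, q, hacc, hσ⟩ := hc
    have hr := h.next hD hacc hσ
    rw [List.append_nil] at hr
    refine ⟨q, τ, [], by simp, _, hr, Or.inl ⟨rfl, fun κ' q' _ h' => ?_⟩⟩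
    obtain ⟨rfl, -⟩ := hσ.nil
    obtain ⟨o, ho, -⟩ := hr.exists_occ
    exact h'.nil.2 (hacc.inFix_of_fix ho)
  · push Not at hc
    exact ⟨p, τ, [], by simp, π, h, Or.inl ⟨rfl, hc⟩⟩

theorem partialSteps_iff {p : Pos} {t : PTerm} {σ : RSeq} : D.PartialSteps p t σ ↔ σ ≠ [] ∧
    ((∃ κ q ρ, D.Access κ p q ∧ ρ ≠ [] ∧ D.PassSteps p κ t (σ ++ ρ)) ∨
      (D.LastAt p .ax ∧ IsRewriteSeq s t σ ∧ ∀ x ∈ σ, x.1.IsCleanup)) := by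
  simp only [PartialSteps, Rule.isCleanup_iff]

theorem Next.good (hD : D.IsDerivation) {l : RSeq} {x : Rule × PTerm} (h : D.Next l x) :
    D.Good (l ++ [x]) := by
  obtain ⟨p, τ, σ, ⟨rfl, π, hr, -⟩, ⟨κ, q, ρ, hacc, hc⟩ | ⟨hax, hrs, hcl⟩⟩ := h
  · rcases ρ with - | ⟨y, ρ⟩
    · rw [List.append_assoc]
      exact (hr.next hD hacc hc).good hD
    · refine ⟨p, τ, σ ++ [x], by simp, π, hr, Or.inr ⟨by simp, Or.inl ?_⟩⟩
      exact ⟨κ, q, y :: ρ, hacc, by simp, by simpa using hc⟩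
  · exact ⟨p, τ, σ ++ [x], by simp, π, hr,
      Or.inr (partialSteps_iff.2 ⟨by simp, Or.inr ⟨hax, hrs, hcl⟩⟩)⟩

/-- An initial part of a code is a state. -/
theorem Run.at_of_code {π : List Pos} {p q : Pos} {κ : Pass} {τ σ ρ : RSeq} {x : Rule × PTerm}
    (h : D.Run π p τ) (hacc : D.Access κ p q)
    (hc : D.PassSteps p κ (target (.ofTm L) τ) (σ ++ x :: ρ)) : D.At (τ ++ σ) p τ σ := by
  refine ⟨rfl, π, h, ?_⟩
  rcases σ with - | ⟨y, σ⟩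
  · refine Or.inl ⟨rfl, fun κ' q' hacc' h' => ?_⟩
    have := (h'.eq_of_prefix hacc' hacc hc List.nil_prefix).2.2
    simp at this
  · exact Or.inr ⟨by simp, Or.inl ⟨κ, q, x :: ρ, hacc, by simp, hc⟩⟩

theorem Run.next_of_snoc {π : List Pos} {p : Pos} {τ : RSeq} (h : D.Run π p τ) :
    ∀ {l : RSeq} {x : Rule × PTerm}, τ = l ++ [x] → D.Next l x := by
  induction h with
  | start => intro l x h; simp at h
  | @step π p q κ τ σ o hr hacc hσ ho ha ih =>
    intro l x h
    rcases List.eq_nil_or_concat σ with rfl | ⟨σ, y, rfl⟩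
    · exact ih (by simpa using h)
    · rw [List.concat_eq_append, ← List.append_assoc] at h
      obtain ⟨rfl, hy⟩ := List.append_inj' h rfl
      obtain rfl : y = x := by simpa using hy
      rw [List.concat_eq_append] at hσ
      exact ⟨p, τ, σ, hr.at_of_code hacc hσ, Or.inl ⟨κ, q, [], hacc, hσ⟩⟩

theorem Good.next {l : RSeq} {x : Rule × PTerm} (h : D.Good (l ++ [x])) : D.Next l x := by
  obtain ⟨p, τ, σ, hl, π, hr, hσ⟩ := h
  rcases List.eq_nil_or_concat σ with rfl | ⟨σ, y, rfl⟩
  · exact hr.next_of_snoc (by simpa using hl.symm)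
  · rw [List.concat_eq_append, ← List.append_assoc] at hl
    obtain ⟨rfl, hy⟩ := List.append_inj' hl rfl
    obtain rfl : x = y := by simpa using hy
    rw [List.concat_eq_append] at hσ
    rcases hσ with ⟨h0, -⟩ | hσ
    · simp at h0
    obtain ⟨-, ⟨κ, q, ρ, hacc, hρ, hc⟩ | ⟨hax, hrs, hcl⟩⟩ := partialSteps_iff.1 hσ
    · rw [List.append_assoc] at hc
      exact ⟨p, τ, σ, hr.at_of_code hacc hc, Or.inl ⟨κ, q, ρ, hacc, hc⟩⟩
    · refine ⟨p, τ, σ, ⟨rfl, π, hr, ?_⟩, Or.inr ⟨hax, hrs, hcl⟩⟩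
      rcases eq_or_ne σ [] with rfl | h0
      · exact Or.inl ⟨rfl, fun κ q hacc _ => hacc.not_ax hax⟩
      · exact Or.inr (partialSteps_iff.2 ⟨h0, Or.inr ⟨hax, (isRewriteSeq_append.1 hrs).1,
          fun y hy => hcl y (by simp [hy])⟩⟩)

theorem Next.good_left {l : RSeq} {x : Rule × PTerm} (h : D.Next l x) : D.Good l :=
  let ⟨p, τ, σ, ha, _⟩ := h
  ⟨p, τ, σ, ha⟩

theorem good_nil (hD : D.IsDerivation) : D.Good [] := Run.start.good hD

theorem Next.step {l : RSeq} {x : Rule × PTerm} (h : D.Next l x) :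
    Step s x.1 (target (.ofTm L) l) x.2 := by
  obtain ⟨p, τ, σ, ⟨rfl, -⟩, ⟨κ, q, ρ, hacc, hc⟩ | ⟨hax, hrs, hcl⟩⟩ := h
  · rw [target_append]
    exact isRewriteSeq_middle hc.isRewriteSeq
  · rw [target_append]
    exact isRewriteSeq_middle hrs

/-- The strategy of the derivation does not stop before a normal form is reached. -/
theorem Good.exists_next (hD : D.IsDerivation) {l : RSeq} (h : D.Good l) {r : Rule} {u : PTerm}
    (hs : Step s r (target (.ofTm L) l) u) : ∃ x, D.Next l x := by
  obtain ⟨p, τ, σ, hat⟩ := h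
  have hat' := hat
  obtain ⟨rfl, π, hr, hσ⟩ := hat'
  obtain ⟨o, ho, ha⟩ := hr.exists_occ
  rw [target_append] at hs
  have hax : D.LastAt p .ax → IsRewriteSeq s (target (.ofTm L) τ) σ →
      (∀ x ∈ σ, x.1.IsCleanup) → ∃ x, D.Next (τ ++ σ) x := by
    intro hax hrs hcl
    obtain ⟨r', u', hr', hs'⟩ :=
      ((axForm_of_arises ho hax ha).of_isRewriteSeq hrs hcl).exists_step hs
    refine ⟨(r', u'), p, τ, σ, hat, Or.inr ⟨hax, ?_, ?_⟩⟩
    · exact isRewriteSeq_append.2 ⟨hrs, hs', trivial⟩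
    · intro y hy
      rcases List.mem_append.1 hy with hy | hy
      · exact hcl y hy
      · obtain rfl : y = _ := by simpa using hy
        exact hr'
  rcases hσ with ⟨rfl, hne⟩ | hσ
  · rcases exists_access ho with h | ⟨κ, q, hacc⟩
    · exact hax h trivial (by simp)
    · obtain ⟨σ, hσ, -⟩ := hr.exists_next hD hacc
      rcases σ with - | ⟨x, ρ⟩
      · exact absurd hσ (hne _ _ hacc)
      · exact ⟨x, p, τ, [], hat, Or.inl ⟨κ, q, ρ, hacc, hσ⟩⟩
  · obtain ⟨-, ⟨κ, q, ρ, hacc, hρ, hc⟩ | ⟨h, hrs, hcl⟩⟩ := partialSteps_iff.1 hσ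
    · rcases ρ with - | ⟨x, ρ⟩
      · exact absurd rfl hρ
      · exact ⟨x, p, τ, σ, hat, Or.inl ⟨κ, q, ρ, hacc, hc⟩⟩
    · exact hax h hrs hcl

theorem cons_eq_of_append_eq {α : Type*} {σ ρ₁ ρ₂ ρ : List α} {x y a b : α}
    (hx : σ ++ x :: ρ₁ = ρ ++ [a]) (hy : σ ++ y :: ρ₂ = ρ ++ [b]) (h : x ≠ y) :
    σ = ρ ∧ x = a ∧ y = b := by
  induction σ generalizing ρ with
  | nil =>
    cases ρ with
    | nil => simp_all
    | cons c ρ => simp at hx hy; exact absurd (hx.1.trans hy.1.symm) h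
  | cons d σ ih =>
    cases ρ with
    | nil => simp at hx
    | cons c ρ =>
      simp at hx hy
      obtain ⟨rfl, h₁, h₂⟩ := ih hx.2 hy.2
      exact ⟨by rw [hx.1], h₁, h₂⟩

theorem Next.branch {l : RSeq} {x y : Rule × PTerm} (h : D.Next l x) (h' : D.Next l y)
    (hne : x ≠ y) : (x.1 = .appL ∧ y.1 = .appR) ∨ (x.1 = .appR ∧ y.1 = .appL) := by
  obtain ⟨p, τ, σ, hat, hx⟩ := h
  obtain ⟨p', τ', σ', hat', hy⟩ := h'
  obtain ⟨rfl, rfl, rfl⟩ := hat.unique hat'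
  rcases hx with ⟨κ, q, ρ, hacc, hc⟩ | ⟨hax, hrs, hcl⟩ <;>
    rcases hy with ⟨κ', q', ρ', hacc', hc'⟩ | ⟨hax', hrs', hcl'⟩
  · rcases hacc.cases hacc' with ⟨rfl, rfl⟩ | ⟨rfl, rfl⟩ | ⟨rfl, rfl⟩
    · have := hc.unique hc'
      simp at this
      exact absurd this.1 hne
    · obtain ⟨ρ₀, u, v, h₁, h₂, -⟩ := hc.app hc'
      obtain ⟨-, rfl, rfl⟩ := cons_eq_of_append_eq h₁ h₂ hne
      exact Or.inl ⟨rfl, rfl⟩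
    · obtain ⟨ρ₀, u, v, h₁, h₂, -⟩ := hc'.app hc
      obtain ⟨-, rfl, rfl⟩ := cons_eq_of_append_eq h₁ h₂ hne.symm
      exact Or.inr ⟨rfl, rfl⟩
  · exact absurd hax' hacc.not_ax
  · exact absurd hax hacc'.not_ax
  · exfalso
    have hs := isRewriteSeq_middle hrs
    have hs' := isRewriteSeq_middle hrs'
    obtain ⟨r, u⟩ := x
    obtain ⟨r', u'⟩ := y
    obtain rfl : r = r' := AxForm.unique hs hs' (hcl (r, u) (by simp)) (hcl' (r', u') (by simp))
    exact hne (by rw [show u = u' from hs.unique hs'])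

/-- The two steps from an application are only possible together. -/
theorem Next.appL_iff_appR (hD : D.IsDerivation) (l : RSeq) :
    (∃ x, D.Next l x ∧ x.1 = .appL) ↔ (∃ x, D.Next l x ∧ x.1 = .appR) := by
  have hmem : ∀ {p : Pos} {κ : Pass} {t : PTerm} {σ ρ : RSeq} {x : Rule × PTerm},
      D.PassSteps p κ t (σ ++ x :: ρ) →
      (x.1 = .appL → κ = .appL) ∧ (x.1 = .appR → κ = .appR) := by
    intro p κ t σ ρ x h
    have hx : x ∈ σ ++ x :: ρ := by simp
    generalize σ ++ x :: ρ = w at h hx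
    cases h with
    | fix => simp at hx
    | fixUnf | appL | appR | lam | vac | jump =>
      obtain rfl := List.mem_singleton.1 hx
      simp
    | appLUnf | appRUnf | lamUnf | vacUnf | jumpUnf =>
      rcases List.mem_pair.1 hx with rfl | rfl <;> simp
  have hsplit : ∀ {ρ₀ σ ρ : RSeq} {x : Rule × PTerm} {u : PTerm} {r : Rule},
      (x.1 = .appL ∨ x.1 = .appR) → (ρ₀ = [] ∨ ∃ w, ρ₀ = [(.unfApp, w)]) →
      σ ++ x :: ρ = ρ₀ ++ [(r, u)] → σ = ρ₀ := by
    rintro ρ₀ σ ρ x u r hx (rfl | ⟨w, rfl⟩) h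
    · rcases σ with - | ⟨c, σ⟩
      · rfl
      · simp at h
    · rcases σ with - | ⟨c, σ⟩
      · simp at h
        obtain ⟨rfl, -⟩ := h
        simp at hx
      · rcases σ with - | ⟨d, σ⟩
        · simp at h; simp [h.1]
        · simp at h
  constructor
  · rintro ⟨x, ⟨p, τ, σ, hat, ⟨κ, q, ρ, hacc, hc⟩ | ⟨hax, hrs, hcl⟩⟩, hx⟩
    · obtain rfl := (hmem hc).1 hx
      obtain ⟨rfl, π, hr, hσ⟩ := id hat
      cases hacc with
      | appL hl =>
        obtain ⟨σ', hσ', -⟩ := hr.exists_next hD (.appR hl)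
        obtain ⟨ρ₀, u, v, h₁, rfl, h₃⟩ := hc.app hσ'
        obtain rfl := hsplit (Or.inl hx) h₃ h₁
        exact ⟨_, ⟨p, τ, σ, hat, Or.inl ⟨_, _, [], .appR hl, hσ'⟩⟩, rfl⟩
    · have := hcl x (by simp)
      rw [hx] at this
      exact this.elim
  · rintro ⟨x, ⟨p, τ, σ, hat, ⟨κ, q, ρ, hacc, hc⟩ | ⟨hax, hrs, hcl⟩⟩, hx⟩
    · obtain rfl := (hmem hc).2 hx
      obtain ⟨rfl, π, hr, hσ⟩ := id hat
      cases hacc with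
      | appR hl =>
        obtain ⟨σ', hσ', -⟩ := hr.exists_next hD (.appL hl)
        obtain ⟨ρ₀, u, v, rfl, h₂, h₃⟩ := hσ'.app hc
        obtain rfl := hsplit (Or.inr hx) h₃ h₂
        exact ⟨_, ⟨p, τ, σ, hat, Or.inl ⟨_, _, [], .appL hl, hσ'⟩⟩, rfl⟩
    · have := hcl x (by simp)
      rw [hx] at this
      exact this.elim

end ProofTree

theorem Step.exists_appR {t u : PTerm} (h : Step s .appL t u) : ∃ v, Step s .appR t v := by
  cases h with
  | appL t u => exact ⟨_, .appR t u⟩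

theorem Step.exists_appL {t u : PTerm} (h : Step s .appR t u) : ∃ v, Step s .appL t v := by
  cases h with
  | appR t u => exact ⟨_, .appL t u⟩

open Classical in
/-- A scope-delimiting choice of steps that does not depend on a derivation: both steps from an
application, and one arbitrary step from all other terms. -/
def DefaultStep (s : Sys) (t : PTerm) (x : Rule × PTerm) : Prop :=
  if ∃ u, Step s .appL t u then (x.1 = .appL ∨ x.1 = .appR) ∧ Step s x.1 t x.2
  else ∃ h : ∃ y : Rule × PTerm, Step s y.1 t y.2, x = h.choose

theorem DefaultStep.step {t : PTerm} {x : Rule × PTerm} (h : DefaultStep s t x) :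
    Step s x.1 t x.2 := by
  unfold DefaultStep at h
  split_ifs at h
  · exact h.2
  · obtain ⟨h, rfl⟩ := h
    exact h.choose_spec

theorem exists_defaultStep {t u : PTerm} {r : Rule} (h : Step s r t u) :
    ∃ x, DefaultStep s t x := by
  unfold DefaultStep
  split_ifs with h'
  · obtain ⟨v, hv⟩ := h'
    exact ⟨(.appL, v), Or.inl rfl, hv⟩
  · exact ⟨_, ⟨(r, u), h⟩, rfl⟩

theorem DefaultStep.branch {t : PTerm} {x y : Rule × PTerm} (h : DefaultStep s t x)
    (h' : DefaultStep s t y) (hne : x ≠ y) :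
    (x.1 = .appL ∧ y.1 = .appR) ∨ (x.1 = .appR ∧ y.1 = .appL) := by
  unfold DefaultStep at h h'
  obtain ⟨r, u⟩ := x
  obtain ⟨r', u'⟩ := y
  split_ifs at h h'
  · obtain ⟨rfl | rfl, hs⟩ := h <;> obtain ⟨rfl | rfl, hs'⟩ := h'
    · exact absurd (by rw [show u = u' from hs.unique hs']) hne
    · exact Or.inl ⟨rfl, rfl⟩
    · exact Or.inr ⟨rfl, rfl⟩
    · exact absurd (by rw [show u = u' from hs.unique hs']) hne
  · obtain ⟨_, h⟩ := h
    obtain ⟨_, h'⟩ := h'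
    exact absurd (h.trans h'.symm) hne

theorem defaultStep_appL_iff_appR (t : PTerm) :
    (∃ x, DefaultStep s t x ∧ x.1 = .appL) ↔ (∃ x, DefaultStep s t x ∧ x.1 = .appR) := by
  constructor
  · rintro ⟨⟨r, u⟩, h, rfl⟩
    have hs := h.step
    obtain ⟨v, hv⟩ := hs.exists_appR
    refine ⟨(.appR, v), ?_, rfl⟩
    rw [DefaultStep, if_pos ⟨u, hs⟩]
    exact ⟨Or.inr rfl, hv⟩
  · rintro ⟨⟨r, u⟩, h, rfl⟩
    obtain ⟨v, hv⟩ := h.step.exists_appL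
    refine ⟨(.appL, v), ?_, rfl⟩
    rw [DefaultStep, if_pos ⟨v, hv⟩]
    exact ⟨Or.inl rfl, hv⟩

namespace ProofTree

variable {L : Tm 0 0} {D : ProofTree s 0 0 L}

/-- The strategy of a derivation. The label of a term is the rewrite sequence that has led to it. As
long as this sequence corresponds, possibly partially, to an access path, the strategy
continues it accordingly; terms with other labels, which cannot be reached from the conclusion,
are rewritten by default steps. -/
def strategy (D : ProofTree s 0 0 L) : Strategy s where
  Label := RSeq
  init _ := []
  relabel _ l r u := l ++ [(r, u)]
  next t l x := (t = target (.ofTm L) l ∧ D.Next l x) ∨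
    (¬ (t = target (.ofTm L) l ∧ ∃ y, D.Next l y) ∧ DefaultStep s t x)
  step_of_next := by
    rintro t l x (⟨rfl, h⟩ | ⟨-, h⟩)
    · exact h.step
    · exact h.step
  next_of_step := by
    intro t l r u h
    by_cases hc : t = target (.ofTm L) l ∧ ∃ y, D.Next l y
    · obtain ⟨ht, y, hy⟩ := hc
      exact ⟨y, Or.inl ⟨ht, hy⟩⟩
    · obtain ⟨x, hx⟩ := exists_defaultStep h
      exact ⟨x, Or.inr ⟨hc, hx⟩⟩

theorem strategy_isScopeDelimiting (hD : D.IsDerivation) : D.strategy.IsScopeDelimiting := by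
  intro t l
  by_cases hc : t = target (.ofTm L) l ∧ ∃ y, D.Next l y
  · have hn : ∀ x, D.strategy.next t l x ↔ D.Next l x := fun x =>
      ⟨fun h => by
        rcases h with h | h
        · exact h.2
        · exact absurd hc h.1, fun h => Or.inl ⟨hc.1, h⟩⟩
    simp only [hn]
    exact ⟨fun x y hx hy hne => hx.branch hy hne, Next.appL_iff_appR hD l⟩
  · have hn : ∀ x, D.strategy.next t l x ↔ DefaultStep s t x := fun x =>
      ⟨fun h => by
        rcases h with h | h
        · exact absurd ⟨h.1, x, h.2⟩ hc
        · exact h.2, fun h => Or.inr ⟨hc, h⟩⟩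
    simp only [hn]
    exact ⟨fun x y hx hy hne => hx.branch hy hne, defaultStep_appL_iff_appR t⟩

theorem Good.of_append {l τ : RSeq} (h : D.Good (l ++ τ)) : D.Good l := by
  induction τ using List.reverseRecOn with
  | nil => simpa using h
  | append_singleton τ x ih =>
    rw [← List.append_assoc] at h
    exact ih h.next.good_left

theorem Good.of_prefix {l τ : RSeq} (h : D.Good τ) (hl : l <+: τ) : D.Good l := by
  obtain ⟨σ, rfl⟩ := hl
  exact h.of_append

theorem strategy_isSeqFrom_iff (hD : D.IsDerivation) {l τ : RSeq} (h : D.Good l) :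
    D.strategy.IsSeqFrom (target (.ofTm L) l) l τ ↔ D.Good (l ++ τ) := by
  induction τ generalizing l with
  | nil => simpa [Strategy.IsSeqFrom] using h
  | cons x τ ih =>
    have hnext : D.strategy.next (target (.ofTm L) l) l x ↔ D.Next l x := by
      constructor
      · rintro (h' | ⟨h', hx⟩)
        · exact h'.2
        · exact absurd ⟨rfl, h.exists_next hD hx.step⟩ h'
      · exact fun h' => Or.inl ⟨rfl, h'⟩
    have ht : x.2 = target (.ofTm L) (l ++ [x]) := by rw [target_append]; rfl
    have hl : l ++ x :: τ = l ++ [x] ++ τ := by simp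
    change (D.strategy.next _ l x ∧ D.strategy.IsSeqFrom x.2 (l ++ [x]) τ) ↔ _
    rw [hnext, hl, ht]
    constructor
    · rintro ⟨h₁, h₂⟩
      exact (ih (h₁.good hD)).1 h₂
    · intro h'
      exact ⟨h'.of_append.next, (ih h'.of_append).2 h'⟩

theorem strategy_isSeq_iff (hD : D.IsDerivation) {τ : RSeq} :
    D.strategy.IsSeq L τ ↔ D.Good τ :=
  strategy_isSeqFrom_iff hD (good_nil hD)

/-! ### Finite access paths -/

theorem IsAccessPathFrom.append {q r : Pos} {N M : ℕ} {f g : ℕ → Pos}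
    (hf : D.IsAccessPathFrom q N f) (hr : f N = r) (hg : D.IsAccessPathFrom r M g) :
    D.IsAccessPathFrom q (N + M) (fun k => if k < N then f k else g (k - N)) := by
  constructor
  · dsimp only
    split_ifs with h
    · exact hf.1
    · obtain rfl : N = 0 := by omega
      rw [Nat.sub_zero, hg.1, ← hr, hf.1]
  · intro i hi
    rcases lt_trichotomy (i + 1) N with h | h | h
    · simpa [h, (Nat.lt_succ_self i).trans h] using hf.2 i (by omega)
    · have := hf.2 i (by omega)
      rw [h, hr, ← hg.1] at this
      simpa [← h] using this
    · obtain ⟨κ, h'⟩ := hg.2 (i - N) (by omega)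
      refine ⟨κ, ?_⟩
      dsimp only
      rw [if_neg (by omega), if_neg (by omega), show i + 1 - N = i - N + 1 by omega]
      exact h'

theorem IsAccessPathFrom.exists_run (hD : D.IsDerivation) {N : ℕ} {f : ℕ → Pos}
    (h : D.IsAccessPathFrom [] N f) : ∃ τ, D.Run ((List.range N).map f) (f N) τ := by
  induction N with
  | zero =>
    rw [h.1]
    exact ⟨[], .start⟩
  | succ N ih =>
    obtain ⟨τ, hτ⟩ := ih ⟨h.1, fun i hi => h.2 i (by omega)⟩
    obtain ⟨κ, hacc⟩ := h.2 N (by omega)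
    obtain ⟨σ, -, hr⟩ := hτ.exists_next hD hacc
    rw [List.range_succ, List.map_append]
    exact ⟨_, hr⟩

theorem Run.isAccessPath {π : List Pos} {p : Pos} {τ : RSeq} (h : D.Run π p τ) :
    D.IsAccessPath (π ++ [p]) := by
  suffices ∃ N f, D.IsAccessPathFrom [] N f ∧ f N = p ∧ π ++ [p] = (List.range (N + 1)).map f by
    obtain ⟨N, f, hf, -, h⟩ := this
    exact ⟨N, f, hf, h⟩
  induction h with
  | start => exact ⟨0, fun _ => [], ⟨rfl, by simp⟩, rfl, rfl⟩
  | @step π p q κ τ σ o _ hacc _ _ _ ih =>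
    obtain ⟨N, f, hf, hN, hP⟩ := ih
    refine ⟨N + 1, fun i => if i ≤ N then f i else q, ⟨by simpa using hf.1, fun i hi => ?_⟩,
      by simp, ?_⟩
    · dsimp only
      rcases (Nat.lt_succ_iff.1 hi).lt_or_eq with h | rfl
      · rw [if_pos (by omega), if_pos (by omega)]
        exact hf.2 i h
      · rw [if_pos le_rfl, if_neg (by omega), hN]
        exact ⟨κ, hacc⟩
    · rw [List.range_succ, List.map_append, hP]
      congr 1
      · refine List.map_congr_left fun i hi => ?_
        rw [if_pos (by have := List.mem_range.1 hi; omega)]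
      · simp

theorem good_iff (hD : D.IsDerivation) {τ : RSeq} :
    D.Good τ ↔ ∃ π, D.IsAccessPath π ∧ (D.Corresponds π τ ∨ D.CorrespondsPartially π τ) := by
  constructor
  · rintro ⟨p, τ, σ, rfl, π, hr, ⟨rfl, -⟩ | hσ⟩
    · exact ⟨_, hr.isAccessPath, Or.inl (corresponds_iff.2 ⟨π, p, rfl, by simpa using hr⟩)⟩
    · exact ⟨_, hr.isAccessPath, Or.inr ⟨π, p, τ, σ, rfl, rfl, corresponds_iff.2 ⟨π, p, rfl, hr⟩, hσ⟩⟩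
  · rintro ⟨P, -, h | ⟨π, p, τ, σ, rfl, rfl, h, hσ⟩⟩
    · obtain ⟨π, p, rfl, hr⟩ := corresponds_iff.1 h
      exact hr.good hD
    · obtain ⟨π', p', hp, hr⟩ := corresponds_iff.1 h
      obtain ⟨rfl, hp⟩ := List.append_inj' hp rfl
      obtain rfl : p = p' := by simpa using hp
      exact ⟨p, τ, σ, rfl, π, hr, Or.inr hσ⟩

theorem IsAccessPath.exists_corresponds (hD : D.IsDerivation) {P : List Pos}
    (h : D.IsAccessPath P) : ∃ τ, D.Good τ ∧ D.Corresponds P τ := by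
  obtain ⟨N, f, hf, rfl⟩ := h
  obtain ⟨τ, hτ⟩ := hf.exists_run hD
  exact ⟨τ, hτ.good hD, corresponds_iff.2 ⟨_, _, by rw [List.range_succ, List.map_append]; rfl, hτ⟩⟩

theorem generatedSubterms_strategy (hD : D.IsDerivation) :
    D.strategy.generatedSubterms L = D.arisingTerms := by
  ext t
  constructor
  · rintro ⟨τ, hτ, rfl⟩
    obtain ⟨π, hπ, h⟩ := (good_iff hD).1 ((strategy_isSeq_iff hD).1 hτ)
    exact ⟨π, τ, hπ, h, rfl⟩
  · rintro ⟨π, τ, hπ, h, rfl⟩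
    exact ⟨τ, (strategy_isSeq_iff hD).2 ((good_iff hD).2 ⟨π, hπ, h⟩), rfl⟩

/-! ### Regularity -/

theorem finite_positions_of_premises {o : Occ s} {K : ℕ}
    (hK : ∀ i o', IsPremise o i o' → i < K)
    (h : ∀ i o', IsPremise o i o' → {q : Pos | ∃ x, q.foldlM Occ.child o' = some x}.Finite) :
    {q : Pos | ∃ x, q.foldlM Occ.child o = some x}.Finite := by
  have hsub : {q : Pos | ∃ x, q.foldlM Occ.child o = some x} ⊆
      {[]} ∪ ⋃ i ∈ Set.Iio K, (fun q => i :: q) ''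
        {q : Pos | ∃ o', o.child i = some o' ∧ ∃ x, q.foldlM Occ.child o' = some x} := by
    rintro (- | ⟨i, q⟩) ⟨x, hx⟩
    · exact Or.inl rfl
    · rw [List.foldlM_cons] at hx
      obtain ⟨o', ho', hx⟩ := Option.bind_eq_some_iff.1 hx
      refine Or.inr (Set.mem_biUnion (hK i o' (child_eq_some_iff.1 ho')) ⟨q, ⟨o', ho', x, hx⟩, rfl⟩)
  refine Set.Finite.subset (Set.Finite.union (Set.finite_singleton _)
    (Set.Finite.biUnion (Set.finite_Iio K) fun i _ => Set.Finite.image _ ?_)) hsub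
  cases ho : o.child i with
  | none => simp
  | some o' =>
    refine (h i o' (child_eq_some_iff.1 ho)).subset ?_
    rintro q ⟨o'', ho'', hq⟩
    obtain rfl := Option.some.inj ho''
    exact hq

theorem finite_positions_of_deriv {n m : ℕ} {t : Tm n m} (d : ProofTree s n m t) :
    ∀ (p : Pos) (org : Fin m → Pos × ℕ) (bd : Fin m → Tm n m → Prop) (b : Prop),
      {q : Pos | ∃ x, q.foldlM Occ.child ⟨p, n, m, t, d, org, bd, b⟩ = some x}.Finite := by
  induction d with
  | ax x hx =>
    intro p org bd b
    refine finite_positions_of_premises (K := 0) ?_ ?_ <;> intro i o' h <;> cases h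
  | assumption f =>
    intro p org bd b
    refine finite_positions_of_premises (K := 0) ?_ ?_ <;> intro i o' h <;> cases h
  | lam d ih =>
    intro p org bd b
    refine finite_positions_of_premises (K := 1) ?_ ?_ <;> intro i o' h <;> cases h
    · omega
    · exact ih ..
  | app d d' ih ih' =>
    intro p org bd b
    refine finite_positions_of_premises (K := 2) ?_ ?_ <;> intro i o' h <;> cases h
    · omega
    · omega
    · exact ih ..
    · exact ih' ..
  | vac i hi ht d ih =>
    intro p org bd b
    refine finite_positions_of_premises (K := 1) ?_ ?_ <;> intro i o' h <;> cases h
    · omega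
    · exact ih ..
  | @fix n m k B t dB d ihB ih =>
    intro p org bd b
    refine finite_positions_of_premises (K := k + 1) ?_ ?_ <;> intro i o' h <;> cases h
    · omega
    · omega
    · exact ihB ..
    · exact ih ..

theorem finite_positions (D : ProofTree s 0 0 L) : {p | ∃ o, D.occ p = some o}.Finite :=
  finite_positions_of_deriv D _ _ _ _

theorem finite_arises {p : Pos} {o : Occ s} (h : D.occ p = some o) : {t | o.Arises t}.Finite := by
  have hplain : Set.Finite {t : PTerm | ∃ u : Tm o.len 0, t = ⟨o.len, u⟩ ∧
      u.ren id Fin.elim0 = o.term} := by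
    refine Set.Subsingleton.finite ?_
    rintro _ ⟨u, rfl, hu⟩ _ ⟨u', rfl, hu'⟩
    rw [Tm.ren_injective u Function.injective_id (fun x => x.elim0) u' (hu.trans hu'.symm)]
  have hfix : Set.Finite (⋃ k ∈ Set.Iic o.consts, ⋃ e : Fin k ↪o Fin o.consts,
      {t : PTerm | ∃ B P, t = ⟨o.len, .letrec k B P⟩ ∧ o.Represents e B P}) := by
    refine (Set.finite_Iic _).biUnion fun k _ => Set.finite_iUnion fun e => ?_
    refine Set.Subsingleton.finite ?_
    rintro _ ⟨B, P, rfl, hr⟩ _ ⟨B', P', rfl, hr'⟩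
    have inj := groupMap_injective e
    rw [Tm.ren_injective P Function.injective_id inj P' (hr.term.trans hr'.term.symm),
      show B = B' from funext fun j => Tm.ren_injective _ Function.injective_id inj _
        (binds_unique h _ (hr.binds j) (hr'.binds j))]
  refine (hplain.union hfix).subset fun t ht => ?_
  by_cases hb : o.inFix
  · obtain ⟨k, e, B, P, rfl, hr⟩ := Occ.Arises.represents hb ht
    right
    have hk : k ≤ o.consts := by
      simpa using Fintype.card_le_of_injective e e.injective
    exact Set.mem_biUnion hk (Set.mem_iUnion.2 ⟨e, B, P, rfl, hr⟩)
  · exact Or.inl (Occ.Arises.plain hb ht)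

/-- The rules that are used for the first of two steps of a code, or at axioms. -/
def partialRules : Set Rule := {.unfApp, .unfLam, .unfRec, .unfReduce, .unfNil}

theorem _root_.LetrecReg.AxForm.length_le {t : PTerm} (h : AxForm s t) {σ : RSeq}
    (hs : IsRewriteSeq s t σ) (hσ : ∀ x ∈ σ, x.1.IsCleanup) : σ.length ≤ 2 := by
  have hvar : ∀ {n : ℕ} {x : Fin n} {σ : RSeq}, IsRewriteSeq s ⟨n, .var x⟩ σ →
      (∀ x ∈ σ, x.1.IsCleanup) → σ.length ≤ 0 := by
    intro n x σ hs hσ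
    rcases σ with - | ⟨⟨r, u⟩, σ⟩
    · simp
    · have hr : r.IsCleanup := hσ (r, u) (by simp)
      have := hs.1
      rcases Rule.isCleanup_iff.1 hr with rfl | rfl <;> cases this
  have hnil : ∀ {n : ℕ} {x : Fin n} {B : Fin 0 → Tm n 0} {σ : RSeq},
      IsRewriteSeq s ⟨n, .letrec 0 B (.var x)⟩ σ → (∀ x ∈ σ, x.1.IsCleanup) → σ.length ≤ 1 := by
    intro n x B σ hs hσ
    rcases σ with - | ⟨⟨r, u⟩, σ⟩
    · simp
    · have hr : r.IsCleanup := hσ (r, u) (by simp)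
      have h₁ := hs.1
      have h₂ := hs.2
      rcases Rule.isCleanup_iff.1 hr with rfl | rfl
      · obtain ⟨_, _, _, _, _, _, _, _, hk, -, -, -, ht, -⟩ := h₁.unfReduce_inv
        cases ht
        omega
      · cases h₁
        have := hvar h₂ fun x hx => hσ x (by simp [hx])
        simpa using this
  obtain ⟨n, x, hx, rfl | ⟨k, B, rfl⟩⟩ := h
  · exact (hvar hs hσ).trans (by omega)
  · rcases σ with - | ⟨⟨r, u⟩, σ⟩
    · simp
    · have hr : r.IsCleanup := hσ (r, u) (by simp)
      have h₁ := hs.1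
      have h₂ := hs.2
      have hσ' : ∀ x ∈ σ, x.1.IsCleanup := fun x hx => hσ x (by simp [hx])
      rcases Rule.isCleanup_iff.1 hr with rfl | rfl
      · cases h₁ with
        | @unfReduce _ _ k' _ _ e B' t' hk he hB ht =>
          cases t' <;> simp only [Tm.ren, reduceCtorEq, Tm.var.injEq, id] at ht
          subst ht
          obtain rfl : k' = 0 := by
            by_contra h0
            exact not_reachable_var ((he _).1 ⟨⟨0, Nat.pos_of_ne_zero h0⟩, rfl⟩)
          have := hnil h₂ hσ'
          simpa using this
      · cases h₁
        have := hvar h₂ hσ'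
        simp at this
        simp [this]

theorem PartialSteps.bounds {p : Pos} {o : Occ s} (h : D.occ p = some o) {t : PTerm}
    (ha : o.Arises t) {σ : RSeq} (hσ : D.PartialSteps p t σ) :
    σ.length ≤ 2 ∧ IsRewriteSeq s t σ ∧ ∀ x ∈ σ, x.1 ∈ partialRules := by
  obtain ⟨hne, ⟨κ, q, ρ, hacc, hρ, hc⟩ | ⟨hax, hrs, hcl⟩⟩ := partialSteps_iff.1 hσ
  · have hrs := (isRewriteSeq_append.1 hc.isRewriteSeq).1
    have key : ∀ {x y : Rule × PTerm}, σ ++ ρ = [x, y] → σ = [x] := by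
      intro x y h
      rcases σ with - | ⟨a, - | ⟨b, σ⟩⟩
      · exact absurd rfl hne
      · simp at h; rw [h.1]
      · rcases ρ with - | ⟨c, ρ⟩
        · exact absurd rfl hρ
        · simp at h
    have key' : ∀ {x : Rule × PTerm}, σ ++ ρ ≠ [x] := by
      intro x h
      rcases σ with - | ⟨a, σ⟩
      · exact absurd rfl hne
      · simp at h; exact hρ h.2.2
    refine ⟨?_, hrs, ?_⟩
    all_goals
      generalize hw : σ ++ ρ = w at hc
      cases hc with
      | fix => simp [hne] at hw
      | fixUnf | appL | appR | lam | vac | jump => exact absurd hw key'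
      | appLUnf | appRUnf | lamUnf | vacUnf | jumpUnf =>
        rw [key hw]
        simp [partialRules]
  · refine ⟨(axForm_of_arises h hax ha).length_le hrs hcl, hrs, fun x hx => ?_⟩
    rcases Rule.isCleanup_iff.1 (hcl x hx) with h | h <;> simp [h, partialRules]

theorem finite_targets {R : Set Rule} (hR : R.Finite) (t : PTerm) (N : ℕ) :
    {u | ∃ σ : RSeq, σ.length ≤ N ∧ IsRewriteSeq s t σ ∧ (∀ x ∈ σ, x.1 ∈ R) ∧
      target t σ = u}.Finite := by
  induction N generalizing t with
  | zero =>
    refine (Set.finite_singleton t).subset ?_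
    rintro u ⟨σ, hσ, -, -, rfl⟩
    obtain rfl := List.length_eq_zero_iff.1 (Nat.le_zero.1 hσ)
    rfl
  | succ N ih =>
    have hfin : {v | ∃ r ∈ R, Step s r t v}.Finite := by
      have : {v | ∃ r ∈ R, Step s r t v} = ⋃ r ∈ R, {v | Step s r t v} := by ext; simp
      rw [this]
      exact hR.biUnion fun r _ => Set.Subsingleton.finite fun _ h _ h' => h.unique h'
    refine ((Set.finite_singleton t).union (hfin.biUnion fun v _ => ih v)).subset ?_
    rintro u ⟨- | ⟨x, σ⟩, hσ, hs, hr, rfl⟩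
    · exact Or.inl rfl
    · exact Or.inr (Set.mem_biUnion ⟨x.1, hr x (by simp), hs.1⟩
        ⟨σ, by simpa using hσ, hs.2, fun y hy => hr y (by simp [hy]), rfl⟩)

theorem strategy_regular (hD : D.IsDerivation) : D.strategy.Regular L := by
  have hfin : (⋃ p ∈ {p | ∃ o, D.occ p = some o}, ⋃ t ∈ {t | ∃ o, D.occ p = some o ∧ o.Arises t},
      {u | ∃ σ : RSeq, σ.length ≤ 2 ∧ IsRewriteSeq s t σ ∧ (∀ x ∈ σ, x.1 ∈ partialRules) ∧
        target t σ = u}).Finite := by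
    refine D.finite_positions.biUnion fun p hp => Set.Finite.biUnion ?_ fun t _ =>
      finite_targets (by unfold partialRules; exact Set.toFinite _) t 2
    obtain ⟨o, ho⟩ := hp
    refine (finite_arises ho).subset ?_
    rintro t ⟨o', ho', ha⟩
    obtain rfl := Option.some.inj (ho.symm.trans ho')
    exact ha
  refine hfin.subset ?_
  rintro _ ⟨l, hl, rfl⟩
  obtain ⟨p, τ, σ, rfl, π, hr, hσ⟩ := (strategy_isSeq_iff hD).1 hl
  obtain ⟨o, ho, ha⟩ := hr.exists_occ
  refine Set.mem_biUnion ⟨o, ho⟩ (Set.mem_biUnion ⟨o, ho, ha⟩ ⟨σ, ?_⟩)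
  rw [target_append]
  rcases hσ with ⟨rfl, -⟩ | hσ
  · exact ⟨by simp, trivial, by simp, rfl⟩
  · obtain ⟨h₁, h₂, h₃⟩ := hσ.bounds ho ha
    exact ⟨h₁, h₂, h₃, rfl⟩

end ProofTree

/-! ### Infinite access paths -/

theorem map_range_prefix {α : Type*} (σ : ℕ → α) {N M : ℕ} (h : N ≤ M) :
    (List.range N).map σ <+: (List.range M).map σ := by
  obtain ⟨b, rfl⟩ := Nat.exists_eq_add_of_le h
  rw [List.range_add, List.map_append]
  exact List.prefix_append ..

/-- The limit of a sequence of lists that extend one another. -/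
theorem exists_limit {α : Type*} {τ : ℕ → List α} (h : ∀ N, τ N <+: τ (N + 1))
    (hlen : ∀ N, ∃ M, N < (τ M).length) :
    ∃ σ : ℕ → α, ∀ N, (List.range (τ N).length).map σ = τ N := by
  have hmono : ∀ {N M}, N ≤ M → τ N <+: τ M := fun hNM =>
    Nat.le_induction (List.prefix_refl _) (fun _ _ ih => ih.trans (h _)) _ hNM
  choose M hM using hlen
  refine ⟨fun i => (τ (M i))[i]'(hM i), fun N => ?_⟩
  refine List.ext_getElem (by simp) fun i h₁ h₂ => ?_
  simp only [List.getElem_map, List.getElem_range]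
  rcases le_total N (M i) with hle | hle
  · exact ((hmono hle).getElem h₂).symm
  · exact (hmono hle).getElem (hM i)

namespace ProofTree

variable {L : Tm 0 0} {D : ProofTree s 0 0 L}

/-- Two successive steps of an access path do not both have an empty code. -/
theorem PassSteps.nil_nil {p q : Pos} {κ κ' : Pass} {t t' : PTerm} {o : Occ s}
    (hacc : D.Access κ p q) (ho : D.occ q = some o) (h : D.PassSteps p κ t [])
    (h' : D.PassSteps q κ' t' []) : False := by
  obtain ⟨rfl, -⟩ := h.nil
  exact h'.nil.2 (hacc.inFix_of_fix ho)

theorem IsInfAccessPath.exists_runs (hD : D.IsDerivation) {p : ℕ → Pos}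
    (h : D.IsInfAccessPath p) : ∃ τ : ℕ → RSeq,
      (∀ N, D.Run ((List.range N).map p) (p N) (τ N)) ∧
      (∀ N, ∃ κ σ, D.Access κ (p N) (p (N + 1)) ∧
        D.PassSteps (p N) κ (target (.ofTm L) (τ N)) σ ∧ τ (N + 1) = τ N ++ σ) ∧
      ∀ N, N ≤ (τ (2 * N)).length := by
  choose τ hτ using fun N => (h N).exists_run hD
  have hstep : ∀ N, ∃ κ σ, D.Access κ (p N) (p (N + 1)) ∧
      D.PassSteps (p N) κ (target (.ofTm L) (τ N)) σ ∧ τ (N + 1) = τ N ++ σ := by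
    intro N
    have hr := hτ (N + 1)
    rw [List.range_succ, List.map_append] at hr
    obtain ⟨κ, τ', σ, hr', hacc, hσ, he⟩ := hr.inv
    obtain rfl := hr'.unique (hτ N)
    exact ⟨κ, σ, hacc, hσ, he⟩
  refine ⟨τ, hτ, hstep, fun N => ?_⟩
  induction N with
  | zero => simp
  | succ N ih =>
    obtain ⟨κ, σ, hacc, hσ, he⟩ := hstep (2 * N)
    obtain ⟨κ', σ', hacc', hσ', he'⟩ := hstep (2 * N + 1)
    have : σ ≠ [] ∨ σ' ≠ [] := by
      by_contra! hc
      obtain ⟨rfl, rfl⟩ := hc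
      obtain ⟨o, ho, -⟩ := (hτ (2 * N + 1)).exists_occ
      exact PassSteps.nil_nil hacc ho hσ hσ'
    rw [show 2 * (N + 1) = 2 * N + 1 + 1 by ring, he', he]
    simp only [List.length_append]
    rcases this with h0 | h0 <;> have := List.length_pos_iff.2 h0 <;> omega

theorem correspondsInf_of_runs {p : ℕ → Pos} {τ : ℕ → RSeq} {σ : ℕ → Rule × PTerm}
    (hτ : ∀ N, D.Run ((List.range N).map p) (p N) (τ N)) (hmono : ∀ N, τ N <+: τ (N + 1))
    (hlen : ∀ N, N ≤ (τ (2 * N)).length)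
    (hσ : ∀ N, (List.range (τ N).length).map σ = τ N) : D.CorrespondsInf p σ := by
  have hm : Monotone fun N => (τ N).length := monotone_nat_of_le_succ fun N => (hmono N).length_le
  refine ⟨fun N => (τ N).length, hm, ?_, fun N => ?_⟩
  · exact Filter.tendsto_atTop_atTop_of_monotone hm fun b => ⟨2 * b, hlen b⟩
  · rw [hσ]
    exact corresponds_iff.2 ⟨_, _, by rw [List.range_succ, List.map_append]; rfl, hτ N⟩

theorem IsInfAccessPath.exists_correspondsInf (hD : D.IsDerivation) {p : ℕ → Pos}
    (h : D.IsInfAccessPath p) : ∃ σ, D.strategy.IsInfSeq L σ ∧ D.CorrespondsInf p σ := by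
  obtain ⟨τ, hτ, hstep, hlen⟩ := h.exists_runs hD
  have hmono : ∀ N, τ N <+: τ (N + 1) := fun N => by
    obtain ⟨κ, σ, -, -, he⟩ := hstep N
    rw [he]
    exact List.prefix_append ..
  obtain ⟨σ, hσ⟩ := exists_limit hmono fun N => ⟨2 * (N + 1), hlen (N + 1)⟩
  refine ⟨σ, fun N => ?_, correspondsInf_of_runs hτ hmono hlen hσ⟩
  rw [strategy_isSeq_iff hD]
  refine ((hτ (2 * N)).good hD).of_prefix ?_
  rw [← hσ (2 * N)]
  exact map_range_prefix σ (hlen N)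

theorem PassSteps.length_le {p : Pos} {κ : Pass} {t : PTerm} {σ : RSeq}
    (h : D.PassSteps p κ t σ) : σ.length ≤ 2 := by
  cases h <;> simp

theorem Run.length_le {π : List Pos} {p : Pos} {τ : RSeq} (h : D.Run π p τ) :
    τ.length ≤ 2 * π.length := by
  induction h with
  | start => simp
  | step _ _ hσ _ _ ih =>
    have := hσ.length_le
    simp only [List.length_append, List.length_singleton]
    omega

theorem Run.truncate {π : List Pos} {p : Pos} {τ : RSeq} (h : D.Run π p τ) {N : ℕ}
    (hN : N ≤ π.length) : ∃ π' p' τ', D.Run π' p' τ' ∧ π'.length = N ∧ τ' <+: τ := by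
  induction h with
  | start => exact ⟨[], [], [], .start, (Nat.le_zero.1 hN).symm, List.prefix_refl _⟩
  | @step π p q κ τ σ o hr hacc hσ ho ha ih =>
    rcases hN.lt_or_eq with hN | rfl
    · obtain ⟨π', p', τ', h₁, h₂, h₃⟩ := ih (by simpa [Nat.lt_succ_iff] using hN)
      exact ⟨π', p', τ', h₁, h₂, h₃.trans (List.prefix_append ..)⟩
    · exact ⟨_, _, _, hr.step hacc hσ ho ha, rfl, List.prefix_refl _⟩

theorem Run.eq_of_length {π π' : List Pos} {p p' : Pos} {τ τ' ρ : RSeq} (h : D.Run π p τ)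
    (h' : D.Run π' p' τ') (hl : π.length = π'.length) (hτ : τ <+: ρ) (hτ' : τ' <+: ρ) :
    π = π' ∧ p = p' := by
  have key : ∀ {π π' : List Pos} {p p' : Pos} {τ τ' : RSeq}, D.Run π p τ → D.Run π' p' τ' →
      π.length = π'.length → τ <+: τ' → π = π' ∧ p = p' := by
    intro π π' p p' τ τ' h h' hl hpre
    rcases h.decode h' hpre with h₁ | ⟨-, rfl, -⟩
    · obtain ⟨h₂, h₃⟩ := List.append_inj' (h₁.eq_of_length (by simp [hl])) rfl
      exact ⟨h₂, by simpa using h₃⟩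
    · simp at hl
  rcases List.prefix_or_prefix_of_prefix hτ hτ' with h₁ | h₁
  · exact key h h' hl h₁
  · obtain ⟨rfl, rfl⟩ := key h' h hl.symm h₁
    exact ⟨rfl, rfl⟩

/-- Every infinite rewrite sequence according to the strategy is decoded to an infinite access path,
because its initial segments decode to arbitrarily long access paths, which are unique. -/
theorem exists_infAccessPath (hD : D.IsDerivation) {σ : ℕ → Rule × PTerm}
    (h : D.strategy.IsInfSeq L σ) : ∃ p, D.IsInfAccessPath p ∧ D.CorrespondsInf p σ := by
  set pre : ℕ → RSeq := fun N => (List.range N).map σ with hpre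
  have hpm : ∀ {N M}, N ≤ M → pre N <+: pre M := fun hNM =>
    map_range_prefix σ hNM
  have hex : ∀ N, ∃ π p τ, D.Run π p τ ∧ π.length = N ∧ τ <+: pre (2 * N + 2) := by
    intro N
    obtain ⟨p, τ, ρ, he, π, hr, hρ⟩ := (strategy_isSeq_iff hD).1 (h (2 * N + 2))
    obtain ⟨o, ho, ha⟩ := hr.exists_occ
    have h₁ : ρ.length ≤ 2 := by
      rcases hρ with ⟨rfl, -⟩ | hρ
      · simp
      · exact (hρ.bounds ho ha).1
    have h₂ := hr.length_le
    have h₃ := congrArg List.length he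
    simp at h₃
    obtain ⟨π', p', τ', h₄, h₅, h₆⟩ := hr.truncate (N := N) (by omega)
    refine ⟨π', p', τ', h₄, h₅, h₆.trans ?_⟩
    change τ <+: (List.range (2 * N + 2)).map σ
    rw [he]
    exact List.prefix_append ..
  choose π p τ hr hl hτ using hex
  have hπ : ∀ N, π N = (List.range N).map p ∧ ∃ κ, D.Access κ (p N) (p (N + 1)) := by
    have hs : ∀ N, π (N + 1) = π N ++ [p N] ∧ ∃ κ, D.Access κ (p N) (p (N + 1)) := by
      intro N
      have hr' := hr (N + 1)
      rcases List.eq_nil_or_concat (π (N + 1)) with h0 | ⟨π', p', h0⟩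
      · have := hl (N + 1)
        simp [h0] at this
      · rw [List.concat_eq_append] at h0
        rw [h0] at hr'
        obtain ⟨κ, τ', σ', hr'', hacc, -, he⟩ := hr'.inv
        have hlen : π'.length = N := by
          have := hl (N + 1)
          simpa [h0] using this
        obtain ⟨rfl, rfl⟩ := hr''.eq_of_length (hr N) (hlen.trans (hl N).symm)
          (ρ := pre (2 * (N + 1) + 2)) ((List.prefix_append ..).trans (he ▸ hτ (N + 1)))
          ((hτ N).trans (hpm (by omega)))
        exact ⟨h0, κ, hacc⟩
    intro N
    refine ⟨?_, (hs N).2⟩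
    induction N with
    | zero => simpa using hl 0
    | succ N ih => rw [(hs N).1, ih, List.range_succ, List.map_append]; rfl
  have hp0 : p 0 = [] := by
    have h0 := (hr 0).head
    rw [(hπ 0).1] at h0
    have := h0.eq_of_length (by simp)
    simpa using this.symm
  have hinf : D.IsInfAccessPath p := fun N => ⟨hp0, fun i _ => (hπ i).2⟩
  refine ⟨p, hinf, ?_⟩
  obtain ⟨τ', hτ', hstep, hlen⟩ := hinf.exists_runs hD
  have heq : τ' = τ := funext fun N => (hτ' N).unique ((hπ N).1 ▸ hr N)
  subst heq
  refine correspondsInf_of_runs hτ' (fun N => ?_) hlen fun N => ?_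
  · obtain ⟨κ, ρ, -, -, he⟩ := hstep N
    rw [he]
    exact List.prefix_append ..
  · have h₁ := (hτ N).length_le
    have h₂ : (List.range (τ' N).length).map σ <+: pre (2 * N + 2) :=
      hpm (by simpa [hpre] using h₁)
    exact (List.prefix_of_prefix_length_le h₂ (hτ N) (by simp)).eq_of_length (by simp)

/-! ### Productivity and guardedness -/

theorem exists_isGuard_iff {p q : Pos} {κ : Pass} {t : PTerm} {σ : RSeq} (hacc : D.Access κ p q)
    (h : D.PassSteps p κ t σ) :
    (∃ x ∈ σ, x.1.IsGuard) ↔ (D.LastAt p .lam ∨ D.LastAt p .app) := by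
  have hiff : (D.LastAt p .lam ∨ D.LastAt p .app) ↔ κ = .lam ∨ κ = .appL ∨ κ = .appR := by
    constructor
    · rintro (h | h)
      · rcases hacc.cases (.lam h) with h' | h' | h' <;> simp_all
      · rcases hacc.cases (.appL h) with h' | h' | h' <;> simp_all
    · rintro (rfl | rfl | rfl) <;> cases hacc <;> simp_all
  rw [hiff]
  cases h <;> simp [Rule.IsGuard]

/-- The decomposition of an infinite rewrite sequence into the codes of the steps of the infinite
access path to which it corresponds. -/
theorem CorrespondsInf.exists_codes {p : ℕ → Pos} {σ : ℕ → Rule × PTerm}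
    (h : D.CorrespondsInf p σ) : ∃ g : ℕ → ℕ, Monotone g ∧ Filter.Tendsto g .atTop .atTop ∧
      ∀ M, (∃ i, g M ≤ i ∧ i < g (M + 1) ∧ (σ i).1.IsGuard) ↔
        (D.LastAt (p M) .lam ∨ D.LastAt (p M) .app) := by
  obtain ⟨g, hg, hg', hc⟩ := h
  refine ⟨g, hg, hg', fun M => ?_⟩
  have hrun : ∀ M, D.Run ((List.range M).map p) (p M) ((List.range (g M)).map σ) := by
    intro M
    obtain ⟨π, q, he, hr⟩ := corresponds_iff.1 (hc M)
    rw [List.range_succ, List.map_append] at he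
    obtain ⟨rfl, hq⟩ := List.append_inj' he rfl
    obtain rfl : p M = q := by simpa using hq
    exact hr
  have hr := hrun (M + 1)
  rw [List.range_succ, List.map_append] at hr
  obtain ⟨κ, τ, ρ, hr', hacc, hρ, he⟩ := hr.inv
  obtain rfl := hr'.unique (hrun M)
  obtain ⟨b, hb⟩ := Nat.exists_eq_add_of_le (hg (Nat.le_succ M))
  rw [show M.succ = M + 1 from rfl] at hb
  rw [hb, List.range_add, List.map_append, List.append_cancel_left_eq, List.map_map] at he
  rw [← exists_isGuard_iff hacc hρ, ← he, hb]
  simp only [List.mem_map, List.mem_range, Function.comp_apply]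
  constructor
  · rintro ⟨i, h₁, h₂, h₃⟩
    exact ⟨_, ⟨i - g M, by omega, by rw [Nat.add_sub_cancel' h₁]⟩, h₃⟩
  · rintro ⟨_, ⟨a, ha, rfl⟩, h₃⟩
    exact ⟨g M + a, by omega, by omega, h₃⟩

theorem productive_of_guarded (hD : D.IsDerivation) (hG : D.GuardedOnAccessPathCycles) :
    D.strategy.Productive L := by
  intro σ hσ N
  by_contra! hN
  obtain ⟨p, hp, hc⟩ := exists_infAccessPath hD hσ
  obtain ⟨g, hg, hg', hgu⟩ := hc.exists_codes
  obtain ⟨M, hM⟩ := (hg'.eventually_ge_atTop N).exists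
  have hfin := D.finite_positions.to_subtype
  have hocc : ∀ k, ∃ o, D.occ (p k) = some o := fun k => by
    obtain ⟨τ, hτ⟩ := (hp k).exists_run hD
    obtain ⟨o, ho, -⟩ := hτ.exists_occ
    exact ⟨o, ho⟩
  -- There are only finitely many positions, so that one of them is visited twice.
  obtain ⟨a, b, hab, he⟩ := Finite.exists_ne_map_eq_of_infinite
    (fun k => (⟨p (M + k), hocc _⟩ : {p | ∃ o, D.occ p = some o}))
  have he : p (M + a) = p (M + b) := congrArg Subtype.val he
  have key : ∀ a b, a < b → p (M + a) = p (M + b) → False := by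
    intro a b hab he
    obtain ⟨l, h₁, h₂, h₃⟩ := hG (M + b) p (hp _) (M + a) (M + b) (by omega) le_rfl he
    obtain ⟨i, h₄, h₅, h₆⟩ := (hgu l).2 h₃
    exact hN i (hM.trans ((hg (by omega)).trans h₄)) h₆
  rcases hab.lt_or_gt with h | h
  · exact key a b h he
  · exact key b a h he.symm

theorem guarded_of_productive (hD : D.IsDerivation) (hP : D.strategy.Productive L) :
    D.GuardedOnAccessPathCycles := by
  intro N p hp i j hij hjN he
  by_contra! hl
  -- Repeating an unguarded cycle forever gives an infinite access path.
  set d := j - i with hd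
  have hd0 : 0 < d := by omega
  set p' : ℕ → Pos := fun n => if n < i then p n else p (i + (n - i) % d) with hp'
  have hinf : D.IsInfAccessPath p' := by
    refine fun K => ⟨?_, fun n _ => ?_⟩
    · rw [← hp.1]
      simp only [hp']
      split_ifs with h
      · rfl
      · obtain rfl : i = 0 := by omega
        simp
    · simp only [hp']
      by_cases h₁ : n < i
      · have h₂ := hp.2 n (by omega)
        rw [if_pos h₁]
        split_ifs with h₃
        · exact h₂
        · obtain rfl : i = n + 1 := by omega
          simpa using h₂
      · rw [if_neg h₁, if_neg (by omega), show n + 1 - i = n - i + 1 by omega, Nat.add_mod]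
        have hr := Nat.mod_lt (n - i) hd0
        set r := (n - i) % d
        obtain ⟨κ, h₂⟩ := hp.2 (i + r) (by omega)
        refine ⟨κ, ?_⟩
        rcases (show r + 1 ≤ d from hr).lt_or_eq with h₃ | h₃
        · rw [Nat.mod_eq_of_lt (show 1 < d by omega), Nat.mod_eq_of_lt h₃, ← Nat.add_assoc]
          exact h₂
        · rw [← Nat.add_mod_mod, Nat.mod_mod, Nat.add_mod_mod, h₃, Nat.mod_self, Nat.add_zero, he]
          rwa [Nat.add_assoc, h₃, show i + d = j by omega] at h₂
  obtain ⟨σ, hσ, hc⟩ := hinf.exists_correspondsInf hD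
  obtain ⟨g, hg, hg', hgu⟩ := hc.exists_codes
  obtain ⟨k, hk, hguard⟩ := hP σ hσ (g i)
  have hex : ∃ M, k < g M := (hg'.eventually_gt_atTop k).exists
  classical
  have hlt := Nat.find_spec hex
  have hmin := fun m => Nat.find_min hex (m := m)
  generalize Nat.find hex = M at hlt hmin
  rcases M with - | M
  · have := hg (Nat.zero_le i)
    omega
  have hM : g M ≤ k := not_lt.1 (hmin M (Nat.lt_succ_self M))
  have hiM : i ≤ M := by
    by_contra hc
    have := hg (show M + 1 ≤ i by omega)
    omega
  have h₁ := (hgu M).1 ⟨k, hM, hlt, hguard⟩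
  have hr := Nat.mod_lt (M - i) hd0
  have h₂ := hl (i + (M - i) % d) (by omega) (by omega)
  simp only [hp', if_neg (not_lt.2 hiM)] at h₁
  rcases h₁ with h₁ | h₁
  · exact h₂.1 h₁
  · exact h₂.2 h₁

/-- A step of an access path leads to a premise, or from a discharged assumption to a premise of an
instance of the letrec-rule. -/
theorem Access.exists_occ {p q : Pos} {κ : Pass} (h : D.Access κ p q) : ∃ o o',
    D.occ p = some o ∧ D.occ q = some o' ∧
      ((∃ i, q = p ++ [i] ∧ IsPremise o i o') ∨ (o.inFix ∧ o'.inFix)) := by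
  cases h with
  | lam h =>
    obtain ⟨o, ho, hl⟩ := h
    obtain ⟨_, _, _, _, _, _, _, _, rfl⟩ := Occ.last_eq_lam hl
    exact ⟨_, _, ho, occ_concat_eq_some.2 ⟨_, ho, .lam ..⟩, Or.inl ⟨0, rfl, .lam ..⟩⟩
  | appL h =>
    obtain ⟨o, ho, hl⟩ := h
    obtain ⟨_, _, _, _, _, _, _, _, _, _, rfl⟩ := Occ.last_eq_app hl
    exact ⟨_, _, ho, occ_concat_eq_some.2 ⟨_, ho, .appL ..⟩, Or.inl ⟨0, rfl, .appL ..⟩⟩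
  | appR h =>
    obtain ⟨o, ho, hl⟩ := h
    obtain ⟨_, _, _, _, _, _, _, _, _, _, rfl⟩ := Occ.last_eq_app hl
    exact ⟨_, _, ho, occ_concat_eq_some.2 ⟨_, ho, .appR ..⟩, Or.inl ⟨1, rfl, .appR ..⟩⟩
  | vac h =>
    obtain ⟨o, ho, hl⟩ := h
    obtain ⟨_, _, _, _, _, _, _, _, _, _, _, rfl⟩ := Occ.last_eq_vac hl
    exact ⟨_, _, ho, occ_concat_eq_some.2 ⟨_, ho, .vac ..⟩, Or.inl ⟨0, rfl, .vac ..⟩⟩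
  | fix h =>
    obtain ⟨o, ho, hl⟩ := h
    obtain ⟨_, _, _, _, _, _, _, _, _, _, rfl⟩ := Occ.last_eq_fix hl
    exact ⟨_, _, ho, occ_concat_eq_some.2 ⟨_, ho, .fixBody ..⟩, Or.inl ⟨_, rfl, .fixBody ..⟩⟩
  | jump h =>
    obtain ⟨o, ho, hl⟩ := h
    obtain ⟨f, -, hf⟩ := Occ.last_eq_assumption hl
    obtain ⟨c, o', hI⟩ := exists_introduces ho f
    have ho' := hI.occ_premise
    rw [Occ.source, hf] at ho'
    refine ⟨o, o', ho, ho', Or.inr ⟨?_, hI.inFix⟩⟩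
    -- The assumption is above the instance by which it is discharged.
    obtain ⟨r, hr⟩ := hI.isPrefix
    rw [pos_of_occ ho] at hr
    rcases r with - | ⟨i, r⟩
    · exact absurd (by rw [pos_of_occ ho, ← hr, List.append_nil]) hI.ne
    · have hpre : (o.origin f).1 ++ [i] <+: p := ⟨r, by rw [← hr]; simp⟩
      obtain ⟨o₁, ho₁⟩ := occ_of_prefix ho hpre
      obtain ⟨c', hc', hprem⟩ := occ_concat_eq_some.1 ho₁
      obtain rfl := Option.some.inj (hI.occ_conclusion.symm.trans hc')
      obtain ⟨k, hk⟩ := hI.last_conclusion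
      exact inFix_of_prefix ho₁ ho hpre (hprem.inFix_of_fix hk)

theorem Access.inFix {p q : Pos} {κ : Pass} (h : D.Access κ p q) (hp : D.InFix p) : D.InFix q := by
  obtain ⟨o, o', ho, ho', ⟨i, -, hi⟩ | ⟨-, h'⟩⟩ := h.exists_occ
  · exact (inFix_iff ho').2 (hi.inFix ((inFix_iff ho).1 hp))
  · exact (inFix_iff ho').2 h'

theorem Access.length_eq {p q : Pos} {κ : Pass} (h : D.Access κ p q) (hq : ¬ D.InFix q) :
    q.length = p.length + 1 := by
  obtain ⟨o, o', ho, ho', ⟨i, rfl, -⟩ | ⟨-, h'⟩⟩ := h.exists_occ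
  · simp
  · exact absurd ((inFix_iff ho').2 h') hq

theorem Access.lastAt_fix {p q : Pos} {κ : Pass} (h : D.Access κ p q) (hp : ¬ D.InFix p)
    (hq : D.InFix q) : ∃ k, D.LastAt p (.fix k) := by
  obtain ⟨o, o', ho, ho', ⟨i, -, hi⟩ | ⟨h', -⟩⟩ := h.exists_occ
  · rw [inFix_iff ho] at hp
    rw [inFix_iff ho'] at hq
    cases hi with
    | fixBind | fixBody => exact ⟨_, _, ho, rfl⟩
    | _ => exact absurd hq hp
  · exact absurd ((inFix_iff ho).2 h') hp

/-- Below the bottommost instances of the letrec-rule, every occurrence is on an access path. -/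
theorem exists_accessPath_of_not_inFix {q : Pos} {o : Occ s} (h : D.occ q = some o)
    (hq : ¬ o.inFix) : ∃ N p, D.IsAccessPathFrom [] N p ∧ p N = q := by
  induction q using List.reverseRecOn generalizing o with
  | nil => exact ⟨0, fun _ => [], ⟨rfl, by simp⟩, rfl⟩
  | append_singleton q i ih =>
    obtain ⟨o₁, ho₁, hi⟩ := occ_concat_eq_some.1 h
    obtain ⟨N, p, hp, hN⟩ := ih ho₁ (mt hi.inFix hq)
    have hacc : ∃ κ, D.Access κ q (q ++ [i]) := by
      cases hi with
      | lam => exact ⟨_, .lam ⟨_, ho₁, rfl⟩⟩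
      | appL => exact ⟨_, .appL ⟨_, ho₁, rfl⟩⟩
      | appR => exact ⟨_, .appR ⟨_, ho₁, rfl⟩⟩
      | vac => exact ⟨_, .vac ⟨_, ho₁, rfl⟩⟩
      | fixBind | fixBody => exact absurd trivial hq
    refine ⟨N + 1, _, hp.append (g := fun k => if k = 0 then q else q ++ [i]) (M := 1) hN
      ⟨rfl, fun k hk => ?_⟩, ?_⟩
    · obtain rfl : k = 0 := by omega
      simpa using hacc
    · simp

theorem guarded_iff_bottommost :
    D.GuardedOnAccessPathCycles ↔
      ∀ q k, D.LastAt q (.fix k) → ¬ D.InFix q → D.GuardedFrom q := by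
  constructor
  · rintro hG q k ⟨o, ho, -⟩ hq N p hp i j hij hjN he
    obtain ⟨K, f, hf, hK⟩ := exists_accessPath_of_not_inFix ho (mt (inFix_iff ho).2 hq)
    obtain ⟨l, h₁, h₂, h₃⟩ := hG _ _ (hf.append hK hp) (K + i) (K + j) (by omega) (by omega)
      (by simpa using he)
    refine ⟨l - K, by omega, by omega, ?_⟩
    rwa [if_neg (by omega)] at h₃
  · intro hG N p hp i j hij hjN he
    have hmono : ∀ a b, a ≤ b → b ≤ N → D.InFix (p a) → D.InFix (p b) := by
      intro a b hab
      induction b, hab using Nat.le_induction with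
      | base => exact fun _ h => h
      | succ b hab ih =>
        intro hb h
        obtain ⟨κ, hacc⟩ := hp.2 b (by omega)
        exact hacc.inFix (ih (by omega) h)
    by_cases hi : D.InFix (p i)
    · -- The path passes a bottommost instance of the letrec-rule before the cycle.
      classical
      have hex : ∃ l, D.InFix (p l) := ⟨i, hi⟩
      have hspec := Nat.find_spec hex
      have hmin := fun m => Nat.find_min hex (m := m)
      have hle := Nat.find_min' hex hi
      generalize Nat.find hex = l at hspec hmin hle
      rcases l with - | l
      · exfalso
        rw [hp.1] at hspec
        exact (inFix_iff occ_nil).1 hspec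
      · have hnot := hmin l (Nat.lt_succ_self l)
        obtain ⟨κ, hacc⟩ := hp.2 l (by omega)
        obtain ⟨k, hk⟩ := hacc.lastAt_fix hnot hspec
        obtain ⟨m, h₁, h₂, h₃⟩ := hG _ k hk hnot (N - l) (fun n => p (l + n))
          ⟨rfl, fun n hn => hp.2 (l + n) (by omega)⟩ (i - l) (j - l) (by omega) (by omega)
          (by simpa [show l + (i - l) = i by omega, show l + (j - l) = j by omega] using he)
        exact ⟨l + m, by omega, by omega, h₃⟩
    · -- Below the letrec-rule, access paths only lead upwards.
      exfalso
      have hj : ¬ D.InFix (p j) := he ▸ hi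
      have hlen : ∀ b, i ≤ b → b ≤ j → (p b).length = (p i).length + (b - i) := by
        intro b hib
        induction b, hib using Nat.le_induction with
        | base => simp
        | succ b hib ih =>
          intro hb
          obtain ⟨κ, hacc⟩ := hp.2 b (by omega)
          rw [hacc.length_eq (fun h => hj (hmono _ _ hb hjN h)), ih (by omega)]
          omega
      have := hlen j hij.le le_rfl
      rw [← he] at this
      omega

end ProofTree

end LetrecReg

theorem mainTheorem8 (s : LetrecReg.Sys) (L : LetrecReg.Tm 0 0)
    (D : LetrecReg.ProofTree s 0 0 L) (hD : D.IsDerivation) :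
    ∃ S : LetrecReg.Strategy s, S.IsScopeDelimiting ∧
      ((∀ π, D.IsAccessPath π → ∃ τ, S.IsSeq L τ ∧ D.Corresponds π τ) ∧
        (∀ p, D.IsInfAccessPath p → ∃ σ, S.IsInfSeq L σ ∧ D.CorrespondsInf p σ)) ∧
      ((∀ τ, S.IsSeq L τ →
          ∃ π, D.IsAccessPath π ∧ (D.Corresponds π τ ∨ D.CorrespondsPartially π τ)) ∧
        (∀ σ, S.IsInfSeq L σ → ∃ p, D.IsInfAccessPath p ∧ D.CorrespondsInf p σ)) ∧
      (S.generatedSubterms L = D.arisingTerms ∧ S.Regular L) ∧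
      ((S.Productive L ↔ D.GuardedOnAccessPathCycles) ∧
        (S.Productive L ↔ D.IsGuardedDerivation)) := by
  have hiff : D.strategy.Productive L ↔ D.GuardedOnAccessPathCycles :=
    ⟨LetrecReg.ProofTree.guarded_of_productive hD, LetrecReg.ProofTree.productive_of_guarded hD⟩
  refine ⟨D.strategy, LetrecReg.ProofTree.strategy_isScopeDelimiting hD, ⟨fun π hπ => ?_, fun p hp =>
    hp.exists_correspondsInf hD⟩, ⟨fun τ hτ => ?_, fun σ hσ =>
    LetrecReg.ProofTree.exists_infAccessPath hD hσ⟩,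
    ⟨LetrecReg.ProofTree.generatedSubterms_strategy hD,
      LetrecReg.ProofTree.strategy_regular hD⟩, hiff, hiff.trans ?_⟩
  · obtain ⟨τ, hτ, hc⟩ := hπ.exists_corresponds hD
    exact ⟨τ, (LetrecReg.ProofTree.strategy_isSeq_iff hD).2 hτ, hc⟩
  · exact (LetrecReg.ProofTree.good_iff hD).1 ((LetrecReg.ProofTree.strategy_isSeq_iff hD).1 hτ)
  · exact LetrecReg.ProofTree.guarded_iff_bottommost.trans ⟨fun h => ⟨hD, h⟩, fun h => h.2⟩
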